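/- Let $d\ge 1$ and write $\langle r\rangle:=\sqrt{1+r^2}$. Suppose $V:[0,\infty)\to\mathbb{C}$ is differentiable (one-sidedly at $0$) and satisfies $|V(r)|\le C\langle r\rangle^{-2}$ and $|V'(r)|\le C\langle r\rangle^{-3}$ for all $r\ge 0$ and some constant $C>0$. For $u\in C^\infty(\mathbb{R}^d)$ (complex-valued) put $$\mathcal L_V u(x):=\Delta u(x)-2x\cdot\nabla u(x)+V(|x|)u(x),$$ set $$\mathcal D(\tilde L):=\{u\in H^2(\mathbb{R}^d)\cap C^\infty(\mathbb{R}^d):\ \mathcal L_V u\in L^2(\mathbb{R}^d)\},$$ and define $\tilde L:\mathcal D(\tilde L)\subset L^2(\mathbb{R}^d)\to L^2(\mathbb{R}^d)$ by $\tilde L u:=\mathcal L_V u$. Then $\tilde L$ is densely defined and closable, and its closure $L$ generates a strongly continuous one-parameter semigroup $\{S(t):t\ge 0\}$ of bounded operators on $L^2(\mathbb{R}^d)$ such that $$\sigma(S(t))\setminus\{0\}=\{e^{t\lambda}:\lambda\in\sigma(L)\}\qquad\text{for all } t\ge 0.$$ -/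

import Mathlib

open MeasureTheory Filter Topology Set
open scoped NNReal ContDiff SchwartzMap

noncomputable section

/-- The complex Hilbert space `L²(ℝ^d)` with respect to Lebesgue measure. -/
abbrev L2Space (d : ℕ) : Type :=
  Lp ℂ 2 (volume : Measure (EuclideanSpace ℝ (Fin d)))

/-- The Japanese bracket `⟨r⟩ = √(1 + r²)`. -/
def japaneseBracket (r : ℝ) : ℝ := Real.sqrt (1 + r ^ 2)

/-! ### The differential operator -/

/-- The formal differential expression `Δu(x) - 2 x·∇u(x) + V(|x|) u(x)`.
Only the values of `V` on `[0, ∞)` matter. -/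
def ouExpr {d : ℕ} (V : ℝ → ℂ) (u : EuclideanSpace ℝ (Fin d) → ℂ) :
    EuclideanSpace ℝ (Fin d) → ℂ :=
  fun x => Laplacian.laplacian u x - 2 * fderiv ℝ u x x + V ‖x‖ * u x

theorem ouExpr_add {d : ℕ} (V : ℝ → ℂ) {u v : EuclideanSpace ℝ (Fin d) → ℂ}
    (hu : ContDiff ℝ ∞ u) (hv : ContDiff ℝ ∞ v) :
    ouExpr V (u + v) = ouExpr V u + ouExpr V v := by
  funext x
  have h1 := ContDiffAt.laplacian_add (contDiff_infty.1 hu 2).contDiffAt (contDiff_infty.1 hv 2).contDiffAt (x := x)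
  have h3 := fderiv_add (hu.differentiable (by simp) x) (hv.differentiable (by simp) x)
  simp only [ouExpr, h1, h3, Pi.add_apply, add_apply]
  ring

theorem ouExpr_smul {d : ℕ} (V : ℝ → ℂ) (c : ℂ) {u : EuclideanSpace ℝ (Fin d) → ℂ}
    (hu : ContDiff ℝ ∞ u) :
    ouExpr V (c • u) = c • ouExpr V u := by
  funext x
  have h1 := InnerProductSpace.laplacian_smul c (contDiff_infty.1 hu 2).contDiffAt (x := x)
  have h3 := fderiv_const_smul (hu.differentiable (by simp) x) c
  simp only [ouExpr, h1, h3, Pi.smul_apply, smul_apply, smul_eq_mul]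
  ring

/-- `u` is a smooth function representing the `L²` class `f`, the class `f` lies in `H²(ℝ^d)`, and
`Δu - 2 x·∇u + V(|x|) u` lies in `L²(ℝ^d)`. -/
structure IsOURep {d : ℕ} (V : ℝ → ℂ) (f : L2Space d) (u : EuclideanSpace ℝ (Fin d) → ℂ) :
    Prop where
  smooth : ContDiff ℝ ∞ u
  ae_eq : f =ᵐ[volume] u
  sobolev : TemperedDistribution.MemSobolev 2 2 (f : 𝓢'(EuclideanSpace ℝ (Fin d), ℂ))
  memLp : MemLp (ouExpr V u) 2 volume

theorem IsOURep.unique {d : ℕ} {V : ℝ → ℂ} {f : L2Space d} {u v : EuclideanSpace ℝ (Fin d) → ℂ}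
    (hu : IsOURep V f u) (hv : IsOURep V f v) : u = v :=
  (Continuous.ae_eq_iff_eq (μ := volume) hu.smooth.continuous hv.smooth.continuous).1
    (hu.ae_eq.symm.trans hv.ae_eq)

theorem IsOURep.add {d : ℕ} {V : ℝ → ℂ} {f g : L2Space d} {u v : EuclideanSpace ℝ (Fin d) → ℂ}
    (hu : IsOURep V f u) (hv : IsOURep V g v) : IsOURep V (f + g) (u + v) where
  smooth := hu.smooth.add hv.smooth
  ae_eq := (Lp.coeFn_add f g).trans (hu.ae_eq.add hv.ae_eq)
  sobolev := by
    have h := hu.sobolev.add hv.sobolev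
    simp only [← Lp.toTemperedDistributionCLM_apply] at h ⊢
    rwa [map_add]
  memLp := by
    rw [ouExpr_add V hu.smooth hv.smooth]
    exact hu.memLp.add hv.memLp

theorem IsOURep.smul {d : ℕ} {V : ℝ → ℂ} {f : L2Space d} {u : EuclideanSpace ℝ (Fin d) → ℂ}
    (c : ℂ) (hu : IsOURep V f u) : IsOURep V (c • f) (c • u) where
  smooth := hu.smooth.const_smul c
  ae_eq := (Lp.coeFn_smul c f).trans (hu.ae_eq.const_smul c)
  sobolev := by
    have h := hu.sobolev.smul c
    simp only [← Lp.toTemperedDistributionCLM_apply] at h ⊢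
    rwa [map_smul]
  memLp := by
    rw [ouExpr_smul V c hu.smooth]
    exact hu.memLp.const_smul c

theorem IsOURep.zero {d : ℕ} (V : ℝ → ℂ) : IsOURep V (0 : L2Space d) 0 where
  smooth := contDiff_const
  ae_eq := Lp.coeFn_zero _ _ _
  sobolev := by
    rw [← Lp.toTemperedDistributionCLM_apply, map_zero]
    exact TemperedDistribution.memSobolev_fun_zero _ _ _ _
  memLp := by
    have h := ouExpr_smul V (0 : ℂ) (u := (0 : EuclideanSpace ℝ (Fin d) → ℂ)) contDiff_const
    rw [zero_smul, zero_smul] at h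
    rw [h]
    exact MemLp.zero

/-- The domain `{u ∈ H²(ℝ^d) ∩ C^∞(ℝ^d) : Δu - 2 x·∇u + V(|x|) u ∈ L²(ℝ^d)}`, as a subspace of
`L²(ℝ^d)`. -/
def ouDomain (d : ℕ) (V : ℝ → ℂ) : Submodule ℂ (L2Space d) where
  carrier := {f | ∃ u, IsOURep V f u}
  zero_mem' := ⟨0, IsOURep.zero V⟩
  add_mem' := fun ⟨u, hu⟩ ⟨v, hv⟩ => ⟨u + v, hu.add hv⟩
  smul_mem' := fun c _ ⟨u, hu⟩ => ⟨c • u, hu.smul c⟩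

/-- The (unique) smooth representative of an element of the domain. -/
def ouRep {d : ℕ} {V : ℝ → ℂ} (f : ouDomain d V) : EuclideanSpace ℝ (Fin d) → ℂ :=
  Classical.choose f.2

theorem ouRep_spec {d : ℕ} {V : ℝ → ℂ} (f : ouDomain d V) : IsOURep V (f : L2Space d) (ouRep f) :=
  Classical.choose_spec f.2

/-- The unbounded operator on `L²(ℝ^d)` with domain `ouDomain d V` that sends `u` to
`Δu - 2 x·∇u + V(|x|) u`. -/
def ouOperator (d : ℕ) (V : ℝ → ℂ) : L2Space d →ₗ.[ℂ] L2Space d where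
  domain := ouDomain d V
  toFun :=
    { toFun := fun f => (ouRep_spec f).memLp.toLp (ouExpr V (ouRep f))
      map_add' := fun f g => by
        rw [← MemLp.toLp_add]
        apply MemLp.toLp_congr
        rw [(ouRep_spec (f + g)).unique ((ouRep_spec f).add (ouRep_spec g)),
          ouExpr_add V (ouRep_spec f).smooth (ouRep_spec g).smooth]
      map_smul' := fun c f => by
        rw [RingHom.id_apply, ← MemLp.toLp_const_smul]
        apply MemLp.toLp_congr
        rw [(ouRep_spec (c • f)).unique ((ouRep_spec f).smul c),
          ouExpr_smul V c (ouRep_spec f).smooth] }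

/-- The graph of `ouOperator`, without the choice of a representative. -/
theorem mem_graph_ouOperator_iff {d : ℕ} {V : ℝ → ℂ} (f g : L2Space d) :
    (f, g) ∈ (ouOperator d V).graph ↔ ∃ u, IsOURep V f u ∧ g =ᵐ[volume] ouExpr V u := by
  rw [LinearPMap.mem_graph_iff]
  constructor
  · rintro ⟨y, rfl, rfl⟩
    exact ⟨ouRep y, ouRep_spec y, MemLp.coeFn_toLp (ouRep_spec y).memLp⟩
  · rintro ⟨u, hu, hg⟩
    refine ⟨⟨f, u, hu⟩, rfl, Lp.ext ?_⟩
    refine (MemLp.coeFn_toLp (ouRep_spec (⟨f, u, hu⟩ : ouDomain d V)).memLp).trans ?_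
    rw [(ouRep_spec (⟨f, u, hu⟩ : ouDomain d V)).unique hu]
    exact hg.symm

/-! ### Semigroups, generators, and the spectrum of an unbounded operator -/

/-- `S` is a strongly continuous one-parameter semigroup of bounded operators on `X`. -/
structure IsC0Semigroup {X : Type*} [NormedAddCommGroup X] [NormedSpace ℂ X]
    (S : ℝ≥0 → X →L[ℂ] X) : Prop where
  map_zero : S 0 = ContinuousLinearMap.id ℂ X
  map_add : ∀ s t, S (s + t) = (S s).comp (S t)
  strongly_continuous : ∀ x, Continuous fun t => S t x

/-- `A` is the infinitesimal generator of `S`: a vector `x` is in the domain of `A` with `A x = y`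
if and only if `t⁻¹ (S(t) x - x) → y` as `t → 0+`. -/
def IsGenerator {X : Type*} [NormedAddCommGroup X] [NormedSpace ℂ X]
    (A : X →ₗ.[ℂ] X) (S : ℝ≥0 → X →L[ℂ] X) : Prop :=
  ∀ x y : X, (x, y) ∈ A.graph ↔
    Tendsto (fun t : ℝ≥0 => ((t : ℝ) : ℂ)⁻¹ • (S t x - x)) (𝓝[>] 0) (𝓝 y)

/-- The resolvent set of an unbounded operator `A`: all `z` such that `z - A`, as a map from the
domain of `A` to `X`, has a bounded two-sided inverse `R`. -/
def unboundedResolventSet {X : Type*} [NormedAddCommGroup X] [NormedSpace ℂ X]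
    (A : X →ₗ.[ℂ] X) : Set ℂ :=
  {z | ∃ R : X →L[ℂ] X,
    (∀ x : X, ∃ h : R x ∈ A.domain, z • R x - A ⟨R x, h⟩ = x) ∧
    (∀ x : A.domain, R (z • (x : X) - A x) = x)}

/-- The spectrum of an unbounded operator. -/
def unboundedSpectrum {X : Type*} [NormedAddCommGroup X] [NormedSpace ℂ X]
    (A : X →ₗ.[ℂ] X) : Set ℂ :=
  (unboundedResolventSet A)ᶜ

end

/-! On the Fourier side `Δ - 2x·∇` becomes the first-order operator `2d - 4π²|ξ|² + 2ξ·∇`, whose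
flow is explicit: `f ↦ e^{2dt} exp(-π²|ξ|²(e^{4t} - 1)) f(e^{2t}ξ)`. This is a strongly continuous
semigroup `S` with `‖S(t)‖ ≤ e^{dt}`. Its generator `A₀` has no eigenvalue with `Re z < d`, while
its adjoint has eigenfunctions built from `|η|^{-z/2} e^{-π²|η|²}`, which are square integrable
exactly there. Hence `z - A₀` is injective but not onto for `Re z < d`
(`eq_zero_of_eigenvector_fourierOU`, `not_surjective_fourierOU`).

The potential acts as a bounded multiplication `B`, so `A₀ + B` generates a semigroup `U` given by
Duhamel's formula (`exists_perturbation`, `genPair_iff_of_duhamel`). It is the closure of the given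
operator: Schwartz functions form a core for `A₀`, because test functions stay Schwartz under the
flow (`dense_rangeSubFourierGen`), and smooth elements of the domain are graph-norm limits of their
cutoffs (`mem_closure_ouSchwartzGraph`).

Since `V` vanishes at infinity, `S(ε)B` is compact for `ε > 0`: after truncating `V`, Gaussian times
Fourier transform times `V` is Hilbert–Schmidt. Two consequences follow. First, the half-plane `Re z
≤ d` stays in the spectrum of `A₀ + B`: a resolvent `R` at `z` with `Re z < d` would make `RB`
compact, and the Fredholm alternative for `1 + RB` would make `z - A₀` onto
(`surjective_of_resolvent_perturbation`); the boundary line follows because resolvent sets are open.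
Second, `U(t) - S(t)` is compact for `t > 0` (`isCompactOperator_sub_of_duhamel`).

The spectral mapping is then read off (`spectral_mapping_of_duhamel`). Points with `0 < |μ| ≤
e^{dt}` are exponentials of the half-plane. Spectral values of `U(t)` with `|μ| > e^{dt}` lie
outside the spectrum of `S(t)`, so they are eigenvalues by Fredholm, and eigenvalues always lift to
the generator (`exists_genPair_eigenvector`). The inclusion `e^{tσ(A)} ⊆ σ(U(t))` holds for every
semigroup. -/

noncomputable section

/-! ### Strongly continuous semigroups and their generators -/

section Semigroup

variable {X : Type*} [NormedAddCommGroup X] [NormedSpace ℂ X] {S : ℝ≥0 → X →L[ℂ] X}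

/-- The pair `(x, y)` belongs to the graph of the infinitesimal generator of `S`. -/
def GenPair (S : ℝ≥0 → X →L[ℂ] X) (x y : X) : Prop :=
  Tendsto (fun t : ℝ≥0 => ((t : ℝ) : ℂ)⁻¹ • (S t x - x)) (𝓝[>] 0) (𝓝 y)

theorem tendsto_coe_nhdsGT_zero : Tendsto (fun t : ℝ≥0 => (t : ℝ)) (𝓝[>] 0) (𝓝[>] 0) := by
  refine tendsto_nhdsWithin_iff.2 ⟨?_, ?_⟩
  · exact (NNReal.continuous_coe.tendsto' 0 0 rfl).mono_left nhdsWithin_le_nhds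
  · filter_upwards [self_mem_nhdsWithin] with t ht
    exact NNReal.coe_pos.2 ht

theorem tendsto_toNNReal_sub_nhdsGT (s : ℝ) :
    Tendsto (fun r : ℝ => (r - s).toNNReal) (𝓝[>] s) (𝓝[>] 0) := by
  refine tendsto_nhdsWithin_iff.2 ⟨?_, ?_⟩
  · refine (Continuous.tendsto' (by fun_prop) s 0 (by simp)).mono_left nhdsWithin_le_nhds
  · filter_upwards [self_mem_nhdsWithin] with r hr
    simpa using hr

theorem GenPair.add {x y x' y' : X} (h : GenPair S x y) (h' : GenPair S x' y') :
    GenPair S (x + x') (y + y') := by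
  refine (Tendsto.add h h').congr fun t => ?_
  rw [map_add, ← smul_add]
  congr 1
  abel

theorem GenPair.smul {x y : X} (c : ℂ) (h : GenPair S x y) : GenPair S (c • x) (c • y) := by
  refine (Tendsto.const_smul h c).congr fun t => ?_
  rw [map_smul, smul_comm, smul_sub c]

theorem GenPair.neg {x y : X} (h : GenPair S x y) : GenPair S (-x) (-y) := by
  simpa using h.smul (-1)

theorem GenPair.sub {x y x' y' : X} (h : GenPair S x y) (h' : GenPair S x' y') :
    GenPair S (x - x') (y - y') := by
  simpa only [sub_eq_add_neg] using h.add h'.neg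

theorem GenPair.unique {x y y' : X} (h : GenPair S x y) (h' : GenPair S x y') : y = y' :=
  tendsto_nhds_unique h h'

namespace IsC0Semigroup

theorem continuous_orbit (hS : IsC0Semigroup S) (x : X) :
    Continuous fun s : ℝ => S s.toNNReal x :=
  (hS.strongly_continuous x).comp continuous_real_toNNReal

theorem apply_add (hS : IsC0Semigroup S) (s t : ℝ≥0) (x : X) : S (s + t) x = S s (S t x) := by
  rw [hS.map_add]; rfl

theorem apply_zero (hS : IsC0Semigroup S) (x : X) : S 0 x = x := by
  rw [hS.map_zero]; rfl

theorem apply_comm (hS : IsC0Semigroup S) (s t : ℝ≥0) (x : X) : S s (S t x) = S t (S s x) := by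
  rw [← hS.apply_add, add_comm, hS.apply_add]

theorem intervalIntegrable_orbit (hS : IsC0Semigroup S) (x : X) (a b : ℝ) :
    IntervalIntegrable (fun s : ℝ => S s.toNNReal x) volume a b :=
  (hS.continuous_orbit x).intervalIntegrable a b

theorem genPair_apply (hS : IsC0Semigroup S) {x y : X} (h : GenPair S x y) (t : ℝ≥0) :
    GenPair S (S t x) (S t y) := by
  refine (((S t).continuous.tendsto y).comp h).congr fun s => ?_
  simp only [Function.comp, map_smul, map_sub]
  rw [hS.apply_comm]

variable [CompleteSpace X]

theorem exists_norm_le (hS : IsC0Semigroup S) (T : ℝ≥0) :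
    ∃ M : ℝ, 0 ≤ M ∧ ∀ t ≤ T, ‖S t‖ ≤ M := by
  obtain ⟨M, hM⟩ := banach_steinhaus (g := fun t : Set.Icc (0 : ℝ≥0) T => S t) (fun x => by
    obtain ⟨C, hC⟩ := (isCompact_Icc (a := (0 : ℝ≥0)) (b := T)).exists_bound_of_continuousOn
      (hS.strongly_continuous x).continuousOn
    exact ⟨C, fun i => hC i i.2⟩)
  exact ⟨M, (norm_nonneg _).trans (hM ⟨0, le_rfl, bot_le⟩), fun t ht => hM ⟨t, bot_le, ht⟩⟩

/-- Strong continuity becomes joint continuity through the local uniform bound from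
Banach–Steinhaus. Besides making Duhamel integrands continuous, it makes the image of `[0, t] × k`
compact for compact `k`. -/
theorem continuous_uncurry (hS : IsC0Semigroup S) :
    Continuous fun p : ℝ≥0 × X => S p.1 p.2 := by
  rw [continuous_iff_continuousAt]
  rintro ⟨t₀, x₀⟩
  obtain ⟨M, hM0, hM⟩ := hS.exists_norm_le (t₀ + 1)
  have h1 : Tendsto (fun p : ℝ≥0 × X => S p.1 x₀) (𝓝 (t₀, x₀)) (𝓝 (S t₀ x₀)) :=
    (hS.strongly_continuous x₀).continuousAt.tendsto.comp continuousAt_fst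
  have h2 : Tendsto (fun p : ℝ≥0 × X => S p.1 (p.2 - x₀)) (𝓝 (t₀, x₀)) (𝓝 0) := by
    have h3 : Tendsto (fun p : ℝ≥0 × X => M * ‖p.2 - x₀‖) (𝓝 (t₀, x₀)) (𝓝 0) :=
      Continuous.tendsto' (by fun_prop) _ _ (by simp)
    refine squeeze_zero_norm' ?_ h3
    have h4 : ∀ᶠ p : ℝ≥0 × X in 𝓝 (t₀, x₀), p.1 < t₀ + 1 :=
      continuousAt_fst.eventually (gt_mem_nhds (lt_add_one t₀))
    filter_upwards [h4] with p hp
    exact (S p.1).le_of_opNorm_le (hM _ hp.le) _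
  have := h1.add h2
  simp only [map_sub, add_sub_cancel, add_zero] at this
  exact this

theorem continuous_apply {Y : Type*} [TopologicalSpace Y] (hS : IsC0Semigroup S) {f : Y → ℝ≥0}
    {g : Y → X} (hf : Continuous f) (hg : Continuous g) : Continuous fun y => S (f y) (g y) :=
  hS.continuous_uncurry.comp (hf.prodMk hg)

theorem apply_integral (hS : IsC0Semigroup S) (r : ℝ≥0) (x : X) {a b : ℝ} (ha : 0 ≤ a)
    (hb : 0 ≤ b) :
    S r (∫ s in a..b, S s.toNNReal x) = ∫ s in (a + r)..(b + r), S s.toNNReal x := by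
  rw [← ContinuousLinearMap.intervalIntegral_comp_comm _ (hS.intervalIntegrable_orbit x a b),
    ← intervalIntegral.integral_comp_add_right (fun s : ℝ => S s.toNNReal x) (r : ℝ)]
  refine intervalIntegral.integral_congr fun s hs => ?_
  have hs0 : 0 ≤ s := (le_min ha hb).trans hs.1
  rw [Real.toNNReal_add hs0 r.coe_nonneg, Real.toNNReal_coe, add_comm, hS.apply_add]

theorem genPair_of_integral (hS : IsC0Semigroup S) {x y : X}
    (h : ∀ t : ℝ≥0, S t x - x = ∫ s in (0 : ℝ)..t, S s.toNNReal y) : GenPair S x y := by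
  have hd : HasDerivAt (fun t : ℝ => ∫ s in (0 : ℝ)..t, S s.toNNReal y) (S (0 : ℝ).toNNReal y) 0 :=
    ((hS.continuous_orbit y).integral_hasStrictDerivAt 0 0).hasDerivAt
  rw [Real.toNNReal_zero, hS.apply_zero, hasDerivAt_iff_tendsto_slope] at hd
  have h2 := (hd.mono_left (nhdsWithin_mono 0 (fun t (ht : t ∈ Ioi (0 : ℝ)) => ne_of_gt ht))).comp
    tendsto_coe_nhdsGT_zero
  refine h2.congr fun t => ?_
  simp only [Function.comp, slope, sub_zero, intervalIntegral.integral_same, vsub_eq_sub]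
  rw [h t, ← Complex.ofReal_inv, Complex.coe_smul]

theorem integral_of_genPair (hS : IsC0Semigroup S) {x y : X} (h : GenPair S x y) (t : ℝ≥0) :
    S t x - x = ∫ s in (0 : ℝ)..t, S s.toNNReal y := by
  -- The definition of the generator yields only a right derivative of the orbit, so the version of
  -- the fundamental theorem for continuous functions with right derivatives is needed.
  have h1 := intervalIntegral.integral_eq_sub_of_hasDeriv_right (a := 0) (b := (t : ℝ))
    (f := fun s : ℝ => S s.toNNReal x) (f' := fun s : ℝ => S s.toNNReal y)
    (hS.continuous_orbit x).continuousOn (fun s hs => by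
      have hs0 : 0 ≤ s := by
        have := hs.1
        rw [min_eq_left t.coe_nonneg] at this
        exact this.le
      rw [hasDerivWithinAt_iff_tendsto_slope' (by simp)]
      have h2 := ((S s.toNNReal).continuous.tendsto y).comp
        (Tendsto.comp h (tendsto_toNNReal_sub_nhdsGT s))
      refine h2.congr' ?_
      filter_upwards [self_mem_nhdsWithin] with r hr
      have hr' : 0 < r - s := sub_pos.2 hr
      simp only [Function.comp, slope, vsub_eq_sub]
      rw [map_smul, map_sub, ← hS.apply_add, ← Real.toNNReal_add hs0 hr'.le, add_sub_cancel,
        Real.coe_toNNReal _ hr'.le, ← Complex.ofReal_inv, Complex.coe_smul])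
    (hS.intervalIntegrable_orbit y _ _)
  rw [h1, Real.toNNReal_coe, Real.toNNReal_zero, hS.apply_zero]

/-- The integrated form contains no limit in `t`, so it passes to limits in `(x, y)`; closedness of
the generator rests on it. -/
theorem genPair_iff (hS : IsC0Semigroup S) {x y : X} :
    GenPair S x y ↔ ∀ t : ℝ≥0, S t x - x = ∫ s in (0 : ℝ)..t, S s.toNNReal y :=
  ⟨fun h => hS.integral_of_genPair h, hS.genPair_of_integral⟩

theorem genPair_integral (hS : IsC0Semigroup S) (x : X) (t : ℝ≥0) :
    GenPair S (∫ s in (0 : ℝ)..t, S s.toNNReal x) (S t x - x) := by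
  rw [hS.genPair_iff]
  intro r
  have hi := hS.intervalIntegrable_orbit x
  have e1 : ∀ s ∈ uIcc (0 : ℝ) r, S s.toNNReal (S t x - x) =
      S (s + t).toNNReal x - S s.toNNReal x := by
    intro s hs
    have hs0 : 0 ≤ s := (le_min le_rfl r.coe_nonneg).trans hs.1
    rw [map_sub, ← hS.apply_add, Real.toNNReal_add hs0 t.coe_nonneg, Real.toNNReal_coe]
  have hi2 : IntervalIntegrable (fun s : ℝ => S (s + t).toNNReal x) volume 0 r :=
    ((hS.continuous_orbit x).comp (continuous_add_const (t : ℝ))).intervalIntegrable _ _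
  rw [hS.apply_integral r x le_rfl t.coe_nonneg, intervalIntegral.integral_congr e1,
    intervalIntegral.integral_sub hi2 (hi _ _),
    intervalIntegral.integral_comp_add_right (fun s : ℝ => S s.toNNReal x) (t : ℝ), zero_add,
    zero_add, ← intervalIntegral.integral_interval_sub_left (hi 0 (t + r)) (hi 0 r),
    ← intervalIntegral.integral_interval_sub_left (hi 0 (r + t)) (hi 0 t), add_comm (t : ℝ) r]
  abel

theorem isClosed_genPair (hS : IsC0Semigroup S) : IsClosed {p : X × X | GenPair S p.1 p.2} := by
  simp only [hS.genPair_iff, Set.ofPred_forall]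
  refine isClosed_iInter fun t => isClosed_eq (by fun_prop) ?_
  refine intervalIntegral.continuous_parametric_intervalIntegral_of_continuous' ?_ _ _
  exact hS.continuous_apply (by fun_prop) (by fun_prop)

end IsC0Semigroup

/-- The semigroup `e^{-zt} S(t)`. -/
def expRescale (z : ℂ) (S : ℝ≥0 → X →L[ℂ] X) (t : ℝ≥0) : X →L[ℂ] X :=
  Complex.exp (-z * ((t : ℝ) : ℂ)) • S t

theorem expRescale_apply (z : ℂ) (t : ℝ≥0) (x : X) :
    expRescale z S t x = Complex.exp (-z * ((t : ℝ) : ℂ)) • S t x := rfl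

theorem expRescale_expRescale (z w : ℂ) :
    expRescale z (expRescale w S) = expRescale (z + w) S := by
  funext t
  simp only [expRescale, smul_smul, ← Complex.exp_add]
  congr 2
  ring

theorem expRescale_zero : expRescale 0 S = S := by
  funext t
  simp [expRescale]

theorem IsC0Semigroup.expRescale (hS : IsC0Semigroup S) (z : ℂ) :
    IsC0Semigroup (expRescale z S) where
  map_zero := by simp [_root_.expRescale, hS.map_zero]
  map_add s t := by
    ext x
    simp only [_root_.expRescale, hS.map_add, NNReal.coe_add, Complex.ofReal_add, mul_add,
      Complex.exp_add, smul_apply, ContinuousLinearMap.comp_apply, map_smul,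
      smul_smul]
    rw [mul_comm]
  strongly_continuous x := by
    simp only [expRescale_apply]
    exact Continuous.smul (by fun_prop) (hS.strongly_continuous x)

theorem tendsto_exp_sub_one_div (z : ℂ) :
    Tendsto (fun t : ℝ≥0 => ((t : ℝ) : ℂ)⁻¹ * (Complex.exp (z * ((t : ℝ) : ℂ)) - 1)) (𝓝[>] 0)
      (𝓝 z) := by
  have hd : HasDerivAt (fun t : ℝ => Complex.exp (z * (t : ℂ))) z 0 := by
    have := (((hasDerivAt_id (0 : ℝ)).ofReal_comp).const_mul z).cexp
    simpa using this
  rw [hasDerivAt_iff_tendsto_slope] at hd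
  have h2 := (hd.mono_left (nhdsWithin_mono 0 (fun t (ht : t ∈ Ioi (0 : ℝ)) => ne_of_gt ht))).comp
    tendsto_coe_nhdsGT_zero
  refine h2.congr fun t => ?_
  simp [slope]

theorem GenPair.expRescale {x y : X} (h : GenPair S x y) (z : ℂ) :
    GenPair (expRescale z S) x (y - z • x) := by
  have h1 : Tendsto (fun t : ℝ≥0 => Complex.exp (-z * ((t : ℝ) : ℂ))) (𝓝[>] 0) (𝓝 1) :=
    (Continuous.tendsto' (by fun_prop) 0 1 (by simp)).mono_left nhdsWithin_le_nhds
  have h2 := (h1.smul h).add ((tendsto_exp_sub_one_div (-z)).smul_const x)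
  rw [one_smul, neg_smul, ← sub_eq_add_neg] at h2
  refine h2.congr fun t => ?_
  rw [expRescale_apply, smul_comm (Complex.exp _), mul_smul, ← smul_add]
  congr 1
  rw [smul_sub, sub_smul, one_smul]
  abel

/-- Rescaling shifts the generator by `z`, which reduces statements about `z - A` to statements at
the spectral parameter `0`. -/
theorem genPair_expRescale_iff {x y : X} {z : ℂ} :
    GenPair (expRescale z S) x y ↔ GenPair S x (y + z • x) := by
  constructor
  · intro h
    have := h.expRescale (-z)
    rwa [expRescale_expRescale, neg_add_cancel, expRescale_zero, neg_smul, sub_neg_eq_add] at this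
  · intro h
    simpa using h.expRescale z

end Semigroup

/-! ### Bounded perturbation by Duhamel's formula -/

section Perturbation

open BoundedContinuousFunction

variable {X : Type*} [NormedAddCommGroup X] [NormedSpace ℂ X] [CompleteSpace X]
  {S : ℝ≥0 → X →L[ℂ] X}

namespace IsC0Semigroup

omit [CompleteSpace X] in
theorem norm_apply_le_of_stable {a : ℝ} (ha : 0 < a)
    (hSa : ∀ t : ℝ≥0, ‖S t‖ ≤ Real.exp (-a * t)) (t : ℝ≥0) (x : X) : ‖S t x‖ ≤ ‖x‖ := by
  have h1 : Real.exp (-a * t) ≤ 1 := Real.exp_le_one_iff.2 (by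
    have := mul_nonneg ha.le t.coe_nonneg
    linarith)
  simpa using (S t).le_of_opNorm_le ((hSa t).trans h1) x

theorem continuous_duhamel_integrand (hS : IsC0Semigroup S) {g : ℝ≥0 → X} (hg : Continuous g) :
    Continuous (Function.uncurry fun (t : ℝ≥0) (s : ℝ) => S (t - s.toNNReal) (g s.toNNReal)) :=
  hS.continuous_apply (by fun_prop) (hg.comp (by fun_prop))

theorem continuous_duhamel_integrand_right (hS : IsC0Semigroup S) {g : ℝ≥0 → X}
    (hg : Continuous g) (t : ℝ≥0) :
    Continuous fun s : ℝ => S (t - s.toNNReal) (g s.toNNReal) :=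
  hS.continuous_apply (by fun_prop) (hg.comp (by fun_prop))

theorem continuous_duhamel (hS : IsC0Semigroup S) {g : ℝ≥0 → X} (hg : Continuous g) :
    Continuous fun t : ℝ≥0 => ∫ s in (0 : ℝ)..t, S (t - s.toNNReal) (g s.toNNReal) :=
  intervalIntegral.continuous_parametric_intervalIntegral_of_continuous
    (hS.continuous_duhamel_integrand hg) NNReal.continuous_coe

omit [CompleteSpace X] in
theorem norm_duhamel_le {a : ℝ} (ha : 0 < a)
    (hSa : ∀ t : ℝ≥0, ‖S t‖ ≤ Real.exp (-a * t)) {g : ℝ≥0 → X} {c : ℝ} (hgc : ∀ t, ‖g t‖ ≤ c)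
    (t : ℝ≥0) :
    ‖∫ s in (0 : ℝ)..t, S (t - s.toNNReal) (g s.toNNReal)‖ ≤ c / a := by
  have hc : 0 ≤ c := (norm_nonneg _).trans (hgc 0)
  have h1 : ∀ s ∈ Ioc (0 : ℝ) t, ‖S (t - s.toNNReal) (g s.toNNReal)‖ ≤
      c * Real.exp (-a * (t - s)) := by
    intro s hs
    refine ((S _).le_opNorm _).trans ?_
    rw [mul_comm]
    have h2 := hSa (t - s.toNNReal)
    have h3 : s.toNNReal ≤ t := Real.toNNReal_le_iff_le_coe.2 hs.2
    rw [NNReal.coe_sub h3, Real.coe_toNNReal _ hs.1.le] at h2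
    exact mul_le_mul (hgc _) h2 (norm_nonneg _) hc
  have hd : ∀ s : ℝ, HasDerivAt (fun s : ℝ => c / a * Real.exp (-a * (t - s)))
      (c * Real.exp (-a * (t - s))) s := by
    intro s
    have := ((((hasDerivAt_id s).const_sub (t : ℝ)).const_mul (-a)).exp).const_mul (c / a)
    refine this.congr_deriv ?_
    have : a ≠ 0 := ha.ne'
    simp only [id]
    field_simp
  have hcont : Continuous fun s : ℝ => c * Real.exp (-a * (t - s)) := by fun_prop
  have h4 := intervalIntegral.integral_eq_sub_of_hasDerivAt (a := 0) (b := (t : ℝ))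
    (fun s _ => hd s) (hcont.intervalIntegrable _ _)
  refine (intervalIntegral.norm_integral_le_of_norm_le t.coe_nonneg
    (Eventually.of_forall h1) (hcont.intervalIntegrable _ _)).trans ?_
  rw [h4]
  simp only [sub_self, mul_zero, Real.exp_zero, mul_one, sub_zero]
  have : 0 ≤ c / a * Real.exp (-a * t) := by positivity
  linarith

/-- The orbit map of an exponentially stable semigroup. -/
def orbitL (hS : IsC0Semigroup S) {a : ℝ} (ha : 0 < a)
    (hSa : ∀ t : ℝ≥0, ‖S t‖ ≤ Real.exp (-a * t)) : X →L[ℂ] (ℝ≥0 →ᵇ X) :=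
  LinearMap.mkContinuous
    { toFun := fun x => BoundedContinuousFunction.ofNormedAddCommGroup (fun t => S t x)
        (hS.strongly_continuous x) ‖x‖ (fun t => norm_apply_le_of_stable ha hSa t x)
      map_add' := fun x y => by ext t; simp
      map_smul' := fun c x => by ext t; simp } 1
    (fun x => by
      rw [one_mul]
      exact (BoundedContinuousFunction.norm_le (norm_nonneg _)).2
        fun t => norm_apply_le_of_stable ha hSa t x)

/-- The Volterra operator `u ↦ ∫₀ᵗ S(t - s) B u(s) ds`. -/
def volterraL (hS : IsC0Semigroup S) {a : ℝ} (ha : 0 < a)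
    (hSa : ∀ t : ℝ≥0, ‖S t‖ ≤ Real.exp (-a * t)) (B : X →L[ℂ] X) :
    (ℝ≥0 →ᵇ X) →L[ℂ] (ℝ≥0 →ᵇ X) :=
  LinearMap.mkContinuous
    { toFun := fun u => BoundedContinuousFunction.ofNormedAddCommGroup
        (fun t : ℝ≥0 => ∫ s in (0 : ℝ)..t, S (t - s.toNNReal) (B (u s.toNNReal)))
        (hS.continuous_duhamel (g := fun t => B (u t)) (by fun_prop)) (‖B‖ * ‖u‖ / a)
        (norm_duhamel_le (g := fun t => B (u t)) ha hSa
          (fun t => B.le_opNorm_of_le (u.norm_coe_le_norm t)))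
      map_add' := fun u v => by
        ext t
        have h := fun w : ℝ≥0 →ᵇ X => (hS.continuous_duhamel_integrand_right
          (g := fun t => B (w t)) (by fun_prop) t).intervalIntegrable (μ := volume) 0 t
        simp only [coe_ofNormedAddCommGroup, BoundedContinuousFunction.add_apply]
        rw [← intervalIntegral.integral_add (h u) (h v)]
        simp only [_root_.map_add]
      map_smul' := fun c u => by
        ext t
        simp only [coe_ofNormedAddCommGroup, BoundedContinuousFunction.smul_apply, map_smul,
          RingHom.id_apply]
        exact intervalIntegral.integral_smul c _ } (‖B‖ / a)
    (fun u => by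
      rw [div_mul_eq_mul_div]
      exact (BoundedContinuousFunction.norm_le (by positivity)).2 fun t =>
        norm_duhamel_le (g := fun t => B (u t)) ha hSa
          (fun t => B.le_opNorm_of_le (u.norm_coe_le_norm t)) t)

/-- Splitting the integral at time `s` restarts the evolution there. With uniqueness for the Duhamel
equation this gives the semigroup law of the perturbed family. -/
theorem duhamel_add (hS : IsC0Semigroup S) {g : ℝ≥0 → X} (hg : Continuous g) (s t : ℝ≥0) :
    ∫ r in (0 : ℝ)..(t + s : ℝ≥0), S (t + s - r.toNNReal) (g r.toNNReal) =
      S t (∫ r in (0 : ℝ)..s, S (s - r.toNNReal) (g r.toNNReal)) +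
        ∫ r in (0 : ℝ)..t, S (t - r.toNNReal) (g (r.toNNReal + s)) := by
  have hi := fun (τ : ℝ≥0) (a b : ℝ) =>
    (hS.continuous_duhamel_integrand_right hg τ).intervalIntegrable (μ := volume) a b
  rw [← intervalIntegral.integral_add_adjacent_intervals (hi (t + s) 0 s) (hi (t + s) s _),
    ← ContinuousLinearMap.intervalIntegral_comp_comm _ (hi s 0 s)]
  congr 1
  · refine intervalIntegral.integral_congr fun r hr => ?_
    rw [uIcc_of_le s.coe_nonneg] at hr
    have h1 : r.toNNReal ≤ s := Real.toNNReal_le_iff_le_coe.2 hr.2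
    rw [← hS.apply_add, add_tsub_assoc_of_le h1]
  · have h := intervalIntegral.integral_comp_add_right (a := 0) (b := (t : ℝ))
      (fun r : ℝ => S (t + s - r.toNNReal) (g r.toNNReal)) (s : ℝ)
    rw [zero_add] at h
    rw [NNReal.coe_add, ← h]
    refine intervalIntegral.integral_congr fun r hr => ?_
    rw [uIcc_of_le t.coe_nonneg] at hr
    rw [Real.toNNReal_add hr.1 s.coe_nonneg, Real.toNNReal_coe, add_tsub_add_eq_tsub_right]

/-- The integrand is jointly continuous with value `g 0` at the origin, and both time variables are
at most `t`. The limit is the term `B x` by which the two generators differ. -/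
theorem tendsto_average_duhamel (hS : IsC0Semigroup S) {g : ℝ≥0 → X} (hg : Continuous g) :
    Tendsto (fun t : ℝ≥0 => ((t : ℝ) : ℂ)⁻¹ •
      ∫ s in (0 : ℝ)..t, S (t - s.toNNReal) (g s.toNNReal)) (𝓝[>] 0) (𝓝 (g 0)) := by
  rw [Metric.tendsto_nhds]
  intro ε hε
  have hc : ContinuousAt (fun p : ℝ≥0 × ℝ≥0 => S (p.1 - p.2) (g p.2)) (0, 0) :=
    (hS.continuous_apply (by fun_prop) (hg.comp continuous_snd)).continuousAt
  have h1 := Metric.tendsto_nhds.1 hc (ε / 2) (half_pos hε)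
  rw [nhds_prod_eq, eventually_prod_iff] at h1
  obtain ⟨p, hp, q, hq, hpq⟩ := h1
  have h2 : ∀ᶠ t : ℝ≥0 in 𝓝 0, ∀ s ≤ t, q s := by
    obtain ⟨δ, hδ, h⟩ := (nhds_bot_basis (α := ℝ≥0)).eventually_iff.1 hq
    exact (nhds_bot_basis (α := ℝ≥0)).eventually_iff.2
      ⟨δ, hδ, fun t ht s hs => h (lt_of_le_of_lt hs ht)⟩
  filter_upwards [nhdsWithin_le_nhds hp, nhdsWithin_le_nhds h2, self_mem_nhdsWithin]
    with t htp htq ht0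
  have ht : (0 : ℝ) < t := NNReal.coe_pos.2 ht0
  have hi := (hS.continuous_duhamel_integrand_right hg t).intervalIntegrable (μ := volume) 0 t
  have h3 : ((t : ℝ) : ℂ)⁻¹ • (∫ s in (0 : ℝ)..t, S (t - s.toNNReal) (g s.toNNReal)) - g 0 =
      ((t : ℝ) : ℂ)⁻¹ • ∫ s in (0 : ℝ)..t, (S (t - s.toNNReal) (g s.toNNReal) - g 0) := by
    rw [intervalIntegral.integral_sub hi intervalIntegrable_const,
      intervalIntegral.integral_const, sub_zero, smul_sub, ← Complex.coe_smul, smul_smul,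
      inv_mul_cancel₀ (by exact_mod_cast ht.ne'), one_smul]
  rw [dist_eq_norm, h3, norm_smul, norm_inv, Complex.norm_real, Real.norm_of_nonneg ht.le]
  have h4 : ‖∫ s in (0 : ℝ)..t, (S (t - s.toNNReal) (g s.toNNReal) - g 0)‖ ≤
      ε / 2 * |(t : ℝ) - 0| := by
    refine intervalIntegral.norm_integral_le_of_norm_le_const fun s hs => ?_
    rw [uIoc_of_le ht.le] at hs
    have := hpq htp (htq s.toNNReal (Real.toNNReal_le_iff_le_coe.2 hs.2))
    simp only [tsub_zero, hS.apply_zero, dist_eq_norm] at this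
    exact this.le
  rw [sub_zero, abs_of_pos ht] at h4
  calc (t : ℝ)⁻¹ * _ ≤ (t : ℝ)⁻¹ * (ε / 2 * t) := by gcongr
    _ = ε / 2 := by field_simp
    _ < ε := half_lt_self hε

/-- The generator of a semigroup that satisfies the Duhamel formula. -/
theorem genPair_iff_of_duhamel (hS : IsC0Semigroup S) {U : ℝ≥0 → X →L[ℂ] X}
    (hU : IsC0Semigroup U) {B : X →L[ℂ] X}
    (hd : ∀ t x, U t x = S t x + ∫ s in (0 : ℝ)..t, S (t - s.toNNReal) (B (U s.toNNReal x)))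
    (x y : X) : GenPair U x y ↔ GenPair S x (y - B x) := by
  have h := hS.tendsto_average_duhamel (g := fun t => B (U t x))
    (B.continuous.comp (hU.strongly_continuous x))
  simp only [hU.apply_zero] at h
  constructor
  · intro h1
    refine (Tendsto.sub h1 h).congr fun t => ?_
    rw [hd t x, ← smul_sub]
    congr 1
    abel
  · intro h1
    have h2 := Tendsto.add h1 h
    rw [sub_add_cancel] at h2
    refine h2.congr fun t => ?_
    rw [hd t x, ← smul_add]
    congr 1
    abel

/-- For decay rate `a > ‖B‖` the Volterra operator has norm at most `‖B‖ / a < 1` on bounded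
continuous functions, so a Neumann series solves the Duhamel equation on all of `[0, ∞)` at once,
with uniqueness. -/
theorem exists_perturbation_of_stable (hS : IsC0Semigroup S) {a : ℝ} (ha : 0 < a)
    (hSa : ∀ t : ℝ≥0, ‖S t‖ ≤ Real.exp (-a * t)) (B : X →L[ℂ] X) (hB : ‖B‖ < a) :
    ∃ U : ℝ≥0 → X →L[ℂ] X, IsC0Semigroup U ∧
      ∀ t x, U t x = S t x + ∫ s in (0 : ℝ)..t, S (t - s.toNNReal) (B (U s.toNNReal x)) := by
  set J := hS.orbitL ha hSa
  set W := hS.volterraL ha hSa B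
  have hW : ‖W‖ < 1 := lt_of_le_of_lt (LinearMap.mkContinuous_norm_le _ (by positivity) _)
    ((div_lt_one ha).2 hB)
  obtain ⟨Φ, hΦ⟩ := isUnit_one_sub_of_norm_lt_one hW
  have hinv : ∀ u, (↑Φ⁻¹ : (ℝ≥0 →ᵇ X) →L[ℂ] (ℝ≥0 →ᵇ X)) (u - W u) = u := by
    intro u
    have : u - W u = (Φ : (ℝ≥0 →ᵇ X) →L[ℂ] (ℝ≥0 →ᵇ X)) u := by rw [hΦ]; rfl
    rw [this, ← mul_apply_eq_comp, Units.inv_mul]; rfl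
  have hfix : ∀ u, (↑Φ⁻¹ : (ℝ≥0 →ᵇ X) →L[ℂ] (ℝ≥0 →ᵇ X)) u =
      u + W ((↑Φ⁻¹ : (ℝ≥0 →ᵇ X) →L[ℂ] (ℝ≥0 →ᵇ X)) u) := by
    intro u
    have h : (Φ : (ℝ≥0 →ᵇ X) →L[ℂ] (ℝ≥0 →ᵇ X))
        ((↑Φ⁻¹ : (ℝ≥0 →ᵇ X) →L[ℂ] (ℝ≥0 →ᵇ X)) u) = u := by
      rw [← mul_apply_eq_comp, Units.mul_inv]; rfl
    rw [hΦ] at h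
    exact sub_eq_iff_eq_add.1 h
  set Ψ : X →L[ℂ] (ℝ≥0 →ᵇ X) := (↑Φ⁻¹ : (ℝ≥0 →ᵇ X) →L[ℂ] (ℝ≥0 →ᵇ X)).comp J with hΨ
  have hd : ∀ (t : ℝ≥0) (x : X), Ψ x t =
      S t x + ∫ s in (0 : ℝ)..t, S (t - s.toNNReal) (B (Ψ x s.toNNReal)) := by
    intro t x
    have := DFunLike.congr_fun (hfix (J x)) t
    exact this
  have huniq : ∀ (x : X) (v : ℝ≥0 →ᵇ X), (∀ t, v t =
      S t x + ∫ s in (0 : ℝ)..t, S (t - s.toNNReal) (B (v s.toNNReal))) → v = Ψ x := by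
    intro x v hv
    have : v - W v = J x := by
      ext t
      simp only [BoundedContinuousFunction.sub_apply]
      rw [hv t, sub_eq_iff_eq_add]
      rfl
    rw [hΨ, ContinuousLinearMap.comp_apply, ← this, hinv]
  refine ⟨fun t => (BoundedContinuousFunction.evalCLM ℂ t).comp Ψ, ⟨?_, ?_, ?_⟩, hd⟩
  · ext x
    have := hd 0 x
    simp only [NNReal.coe_zero, intervalIntegral.integral_same, add_zero, hS.apply_zero] at this
    exact this
  · intro s t
    ext x
    -- The orbit shifted by `t` solves the Duhamel equation with initial value `Ψ x t`; uniqueness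
    -- identifies it with the orbit of that value.
    set v : ℝ≥0 →ᵇ X := (Ψ x).compContinuous ⟨fun r => r + t, by fun_prop⟩ with hv
    have hv' : ∀ r, v r = Ψ x (r + t) := fun r => rfl
    have h1 : v = Ψ (Ψ x t) := by
      refine huniq _ _ fun r => ?_
      rw [hv', hd (r + t) x, hS.duhamel_add (g := fun r => B (Ψ x r)) (by fun_prop), hd t x,
        _root_.map_add, hS.apply_add, add_assoc]
      rfl
    have h2 := DFunLike.congr_fun h1 s
    rw [hv'] at h2
    exact h2
  · intro x
    exact (Ψ x).continuous

/-- Bounded perturbation of a semigroup, with the Duhamel formula. -/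
theorem exists_perturbation (hS : IsC0Semigroup S) {γ : ℝ}
    (hSγ : ∀ t : ℝ≥0, ‖S t‖ ≤ Real.exp (γ * t)) (B : X →L[ℂ] X) :
    ∃ U : ℝ≥0 → X →L[ℂ] X, IsC0Semigroup U ∧
      ∀ t x, U t x = S t x + ∫ s in (0 : ℝ)..t, S (t - s.toNNReal) (B (U s.toNNReal x)) := by
  -- Any `a > ‖B‖` would do; rescaling by `κ = γ + a` turns the growth bound `γ` into decay at rate
  -- `a`.
  set a : ℝ := ‖B‖ + 1
  set κ : ℝ := γ + a
  obtain ⟨U, hU, hd⟩ := (IsC0Semigroup.expRescale hS κ).exists_perturbation_of_stable (a := a) (by positivity)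
    (fun t => by
      rw [_root_.expRescale, norm_smul, Complex.norm_exp]
      calc _ ≤ Real.exp (-κ * t) * Real.exp (γ * t) := by
            gcongr
            · simp
            · exact hSγ t
        _ = _ := by rw [← Real.exp_add]; congr 1; simp only [κ]; ring) B (lt_add_one _)
  refine ⟨_root_.expRescale (-κ) U, IsC0Semigroup.expRescale hU _, fun t x => ?_⟩
  rw [expRescale_apply, hd t x, smul_add, expRescale_apply, smul_smul, ← Complex.exp_add,
    ← intervalIntegral.integral_smul]
  congr 1
  · simp
  · refine intervalIntegral.integral_congr fun s hs => ?_
    rw [uIcc_of_le t.coe_nonneg] at hs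
    have h3 : s.toNNReal ≤ t := Real.toNNReal_le_iff_le_coe.2 hs.2
    simp only [expRescale_apply, map_smul, smul_smul, ← Complex.exp_add]
    rw [NNReal.coe_sub h3]
    congr 2
    push_cast
    ring

end IsC0Semigroup

end Perturbation

/-! ### Spectral inclusion, point spectrum, and compactness of integrals -/

section SpectralMapping

variable {X : Type*} [NormedAddCommGroup X] [NormedSpace ℂ X] [CompleteSpace X]
  {S : ℝ≥0 → X →L[ℂ] X}

/-- The spectrum of an unbounded operator, in terms of the semigroup it generates. -/
theorem mem_unboundedResolventSet_iff {X : Type*} [NormedAddCommGroup X] [NormedSpace ℂ X]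
    {S : ℝ≥0 → X →L[ℂ] X} {A : X →ₗ.[ℂ] X} (hA : IsGenerator A S) (z : ℂ) :
    z ∈ unboundedResolventSet A ↔ ∃ R : X →L[ℂ] X,
      (∀ x, GenPair S (R x) (z • R x - x)) ∧ ∀ x y, GenPair S x y → R (z • x - y) = x := by
  refine exists_congr fun R => and_congr (forall_congr' fun x => ?_) ?_
  · rw [GenPair, ← hA, LinearPMap.mem_graph_iff]
    constructor
    · rintro ⟨h, e⟩
      exact ⟨⟨R x, h⟩, rfl, (sub_eq_of_eq_add' (sub_eq_iff_eq_add.1 e)).symm⟩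
    · rintro ⟨y, e1, e2⟩
      have h : R x ∈ A.domain := by
        rw [show R x = y from e1.symm]
        exact y.2
      have hy : y = ⟨R x, h⟩ := Subtype.ext e1
      exact ⟨h, by rw [← hy, e2, sub_sub_cancel]⟩
  · constructor
    · intro h x y hxy
      rw [GenPair, ← hA, LinearPMap.mem_graph_iff] at hxy
      obtain ⟨w, rfl, rfl⟩ := hxy
      exact h w
    · intro h x
      exact h x (A x) ((hA _ _).1 (LinearPMap.mem_graph A x))

namespace IsC0Semigroup

/-- The operator `x ↦ ∫₀ᵗ S(s) x ds`. -/
def integralL (hS : IsC0Semigroup S) (t : ℝ≥0) : X →L[ℂ] X :=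
  have hM := hS.exists_norm_le t
  LinearMap.mkContinuous
    { toFun := fun x => ∫ s in (0 : ℝ)..t, S s.toNNReal x
      map_add' := fun x y => by
        simp only [_root_.map_add]
        exact intervalIntegral.integral_add (hS.intervalIntegrable_orbit x _ _)
          (hS.intervalIntegrable_orbit y _ _)
      map_smul' := fun c x => by
        simp only [map_smul, RingHom.id_apply]
        exact intervalIntegral.integral_smul c _ } (hM.choose * t)
    (fun x => by
      have h := intervalIntegral.norm_integral_le_of_norm_le_const (a := 0) (b := (t : ℝ))
        (f := fun s : ℝ => S s.toNNReal x) (C := hM.choose * ‖x‖) (fun s hs => by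
          rw [uIoc_of_le t.coe_nonneg] at hs
          exact (S _).le_of_opNorm_le
            (hM.choose_spec.2 _ (Real.toNNReal_le_iff_le_coe.2 hs.2)) x)
      rw [sub_zero, abs_of_nonneg t.coe_nonneg] at h
      exact h.trans (le_of_eq (by ring)))

theorem integralL_apply (hS : IsC0Semigroup S) (t : ℝ≥0) (x : X) :
    hS.integralL t x = ∫ s in (0 : ℝ)..t, S s.toNNReal x := rfl

theorem norm_integralL_le (hS : IsC0Semigroup S) {T : ℝ≥0} {M : ℝ} (hM0 : 0 ≤ M)
    (hM : ∀ t ≤ T, ‖S t‖ ≤ M) {t : ℝ≥0} (ht : t ≤ T) : ‖hS.integralL t‖ ≤ M * t := by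
  refine ContinuousLinearMap.opNorm_le_bound _ (by positivity) fun x => ?_
  have h := intervalIntegral.norm_integral_le_of_norm_le_const (a := 0) (b := (t : ℝ))
    (f := fun s : ℝ => S s.toNNReal x) (C := M * ‖x‖) (fun s hs => by
      rw [uIoc_of_le t.coe_nonneg] at hs
      exact (S _).le_of_opNorm_le (hM _ ((Real.toNNReal_le_iff_le_coe.2 hs.2).trans ht)) x)
  rw [sub_zero, abs_of_nonneg t.coe_nonneg] at h
  exact h.trans (le_of_eq (by ring))

theorem apply_integralL (hS : IsC0Semigroup S) (r t : ℝ≥0) (x : X) :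
    S r (hS.integralL t x) = hS.integralL t (S r x) := by
  rw [integralL_apply, integralL_apply,
    ← ContinuousLinearMap.intervalIntegral_comp_comm _ (hS.intervalIntegrable_orbit x _ _)]
  simp only [hS.apply_comm r]

theorem integralL_add (hS : IsC0Semigroup S) (r t : ℝ≥0) (x : X) :
    hS.integralL (r + t) x = hS.integralL r x + hS.integralL t (S r x) := by
  rw [← hS.apply_integralL, integralL_apply, integralL_apply, integralL_apply,
    hS.apply_integral r x le_rfl t.coe_nonneg, zero_add, add_comm (t : ℝ), NNReal.coe_add,
    intervalIntegral.integral_add_adjacent_intervals (hS.intervalIntegrable_orbit x _ _)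
      (hS.intervalIntegrable_orbit x _ _)]

theorem genPair_integralL (hS : IsC0Semigroup S) (t : ℝ≥0) (x : X) :
    GenPair S (hS.integralL t x) (S t x - x) := hS.genPair_integral x t

theorem integralL_of_genPair (hS : IsC0Semigroup S) (t : ℝ≥0) {x y : X} (h : GenPair S x y) :
    hS.integralL t y = S t x - x := (hS.integral_of_genPair h t).symm

/-- After rescaling by `z` the generator kills `x`, so the rescaled orbit is constant. -/
theorem apply_of_eigenvector (hS : IsC0Semigroup S) {z : ℂ} {x : X} (h : GenPair S x (z • x))
    (t : ℝ≥0) : S t x = Complex.exp (z * ((t : ℝ) : ℂ)) • x := by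
  have h1 : GenPair (_root_.expRescale z S) x 0 := by
    rw [genPair_expRescale_iff, zero_add]; exact h
  have h2 := (IsC0Semigroup.expRescale hS z).integralL_of_genPair t h1
  rw [_root_.map_zero, eq_comm, sub_eq_zero, expRescale_apply] at h2
  rw [← h2, smul_smul, ← Complex.exp_add, h2]
  simp

/-- With `N = ∫₀ᵗ e^{-zs} S(s) ds` one has `(A - z) N = e^{-zt} S(t) - 1`, and the factors commute
on the domain. Inverting `1 - e^{-zt} S(t)` therefore inverts `z - A`. -/
theorem exists_resolvent_of_not_mem_spectrum (hS : IsC0Semigroup S) {z : ℂ} {t : ℝ≥0}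
    (h : Complex.exp (((t : ℝ) : ℂ) * z) ∉ spectrum ℂ (S t)) :
    ∃ R : X →L[ℂ] X,
      (∀ x, GenPair S (R x) (z • R x - x)) ∧ ∀ x y, GenPair S x y → R (z • x - y) = x := by
  set U := _root_.expRescale z S with hUdef
  have hU : IsC0Semigroup U := hS.expRescale z
  rw [spectrum.notMem_iff] at h
  obtain ⟨q, hq⟩ := h
  have hqx : ∀ x, (q : X →L[ℂ] X) x = Complex.exp (((t : ℝ) : ℂ) * z) • (x - U t x) := by
    intro x
    rw [hq, hUdef, expRescale_apply, smul_sub, smul_smul, ← Complex.exp_add, mul_comm _ z, neg_mul,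
      add_neg_cancel, Complex.exp_zero, one_smul]
    simp [Algebra.algebraMap_eq_smul_one]
  set Q : X →L[ℂ] X := Complex.exp (((t : ℝ) : ℂ) * z) • (↑q⁻¹ : X →L[ℂ] X) with hQ
  have hQ1 : ∀ x, Q x - U t (Q x) = x := by
    intro x
    have h1 : (q : X →L[ℂ] X) ((↑q⁻¹ : X →L[ℂ] X) x) = x := by
      rw [← mul_apply_eq_comp, Units.mul_inv]; rfl
    rw [hqx] at h1
    rw [hQ, smul_apply, map_smul, ← smul_sub, h1]
  have hQ2 : ∀ x, Q (x - U t x) = x := by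
    intro x
    have h1 : (↑q⁻¹ : X →L[ℂ] X) ((q : X →L[ℂ] X) x) = x := by
      rw [← mul_apply_eq_comp, Units.inv_mul]; rfl
    rw [hqx, map_smul] at h1
    rw [hQ, smul_apply, h1]
  have hcomm : ∀ x, hU.integralL t (Q x) = Q (hU.integralL t x) := by
    intro x
    conv_lhs => rw [← hQ2 (hU.integralL t (Q x)), hU.apply_integralL, ← map_sub, hQ1]
  refine ⟨(hU.integralL t).comp Q, fun x => ?_, fun x y hxy => ?_⟩
  · have h1 := hU.genPair_integralL t (Q x)
    rw [genPair_expRescale_iff, ← neg_sub (Q x), hQ1, neg_add_eq_sub] at h1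
    exact h1
  · have h1 := hU.integralL_of_genPair t (hxy.expRescale z)
    rw [ContinuousLinearMap.comp_apply, hcomm, ← neg_sub y, map_neg, h1, neg_sub, hQ2]

/-- The orbit of `x` rescaled by a logarithm of `μ` is `t`-periodic. Its Fourier coefficients are
eigenvectors of the generator or zero, the `n`-th one for the logarithm `zn n`. They cannot all
vanish, since the orbit starts at `x ≠ 0`. -/
theorem exists_genPair_eigenvector (hS : IsC0Semigroup S) {t : ℝ≥0} (ht : 0 < t) {μ : ℂ}
    (hμ : μ ≠ 0) {x : X} (hx : x ≠ 0) (h : S t x = μ • x) :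
    ∃ z : ℂ, Complex.exp (((t : ℝ) : ℂ) * z) = μ ∧ ∃ v ≠ 0, GenPair S v (z • v) := by
  have ht' : ((t : ℝ) : ℂ) ≠ 0 := by exact_mod_cast ht.ne'
  set ζ : ℂ := Complex.log μ / ((t : ℝ) : ℂ) with hζ
  have hζt : ((t : ℝ) : ℂ) * ζ = Complex.log μ := by rw [hζ]; field_simp
  set zn : ℤ → ℂ := fun n => ζ + n * (2 * Real.pi * Complex.I) / ((t : ℝ) : ℂ) with hzn
  have hznt : ∀ n, ((t : ℝ) : ℂ) * zn n = Complex.log μ + n * (2 * Real.pi * Complex.I) := by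
    intro n
    rw [hzn, ← hζt]
    field_simp
  have hexp : ∀ n, Complex.exp (((t : ℝ) : ℂ) * zn n) = μ := by
    intro n
    rw [hznt, Complex.exp_add, Complex.exp_int_mul_two_pi_mul_I, mul_one, Complex.exp_log hμ]
  have hper : ∀ n, _root_.expRescale (zn n) S t x = x := by
    intro n
    rw [expRescale_apply, h, smul_smul, neg_mul, Complex.exp_neg, mul_comm (zn n), hexp,
      inv_mul_cancel₀ hμ, one_smul]
  by_contra hcon
  push Not at hcon
  have hzero : ∀ n, ∫ s in (0 : ℝ)..t, _root_.expRescale (zn n) S s.toNNReal x = 0 := by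
    intro n
    by_contra hne
    refine hcon (zn n) (hexp n) _ hne ?_
    have h1 := (IsC0Semigroup.expRescale hS (zn n)).genPair_integral x t
    rw [genPair_expRescale_iff, hper, sub_self, zero_add] at h1
    exact h1
  -- A norming functional makes the orbit scalar. Its Fourier coefficients all vanish, so its
  -- Fourier series is summable and represents the function pointwise; at `0` this gives `‖x‖ = 0`.
  obtain ⟨φ, -, hφ⟩ := exists_dual_vector ℂ x (norm_ne_zero_iff.2 hx)
  have : Fact (0 < (t : ℝ)) := ⟨NNReal.coe_pos.2 ht⟩
  set f : ℝ → ℂ := fun s => φ (_root_.expRescale ζ S s.toNNReal x) with hf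
  have hfc : Continuous f :=
    φ.continuous.comp ((IsC0Semigroup.expRescale hS ζ).continuous_orbit x)
  have hz0 : zn 0 = ζ := by simp [hzn]
  have hf0 : f 0 = φ x := by
    simp only [hf, Real.toNNReal_zero, (IsC0Semigroup.expRescale hS ζ).apply_zero]
  have hft : f (0 + t) = f 0 := by
    rw [hf0]
    simp only [hf, zero_add, Real.toNNReal_coe]
    rw [← hz0, hper]
  set F : C(AddCircle (t : ℝ), ℂ) := ⟨AddCircle.liftIco (t : ℝ) 0 f,
    AddCircle.liftIco_continuous hft.symm hfc.continuousOn⟩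
  have hcoef : ∀ n, fourierCoeff F n = 0 := by
    intro n
    have h1 : fourierCoeff F n = fourierCoeff (AddCircle.liftIco (t : ℝ) 0 f) n := rfl
    rw [h1, fourierCoeff_liftIco_eq, fourierCoeffOn_eq_integral]
    have h2 : ∀ s ∈ uIcc (0 : ℝ) (0 + t), fourier (-n) (s : AddCircle ((0 : ℝ) + t - 0)) • f s =
        φ (_root_.expRescale (zn n) S s.toNNReal x) := by
      intro s hs
      rw [uIcc_of_le (by simp)] at hs
      rw [fourier_coe_apply]
      simp only [hf, expRescale_apply, map_smul, smul_eq_mul]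
      rw [← mul_assoc, ← Complex.exp_add, Real.coe_toNNReal _ hs.1]
      congr 2
      simp only [hzn]
      have h3 : (((0 : ℝ) + t - 0 : ℝ) : ℂ) = ((t : ℝ) : ℂ) := by simp
      rw [h3]
      push_cast
      field_simp
      ring
    rw [intervalIntegral.integral_congr h2, ContinuousLinearMap.intervalIntegral_comp_comm _
      ((IsC0Semigroup.expRescale hS (zn n)).intervalIntegrable_orbit x _ _), zero_add, hzero,
      _root_.map_zero, smul_zero]
  have hsum := has_pointwise_sum_fourier_series_of_summable (f := F)
    (by simp only [funext hcoef]; exact summable_zero) (0 : ℝ)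
  simp only [hcoef, zero_smul] at hsum
  have h3 := hsum.unique hasSum_zero
  have h4 : F ((0 : ℝ) : AddCircle (t : ℝ)) = f 0 :=
    AddCircle.liftIco_coe_apply (f := f) ⟨le_rfl, (NNReal.coe_pos.2 ht).trans_eq (zero_add _).symm⟩
  rw [h4, hf0, hφ] at h3
  exact hx (by simpa using h3)

/-- Dropping the time interval `[0, ε]` changes the integral by `O(ε)` in norm, and what remains
factors through the compact operator `S(ε) B`. -/
theorem isCompactOperator_integralL_comp (hS : IsC0Semigroup S) {B : X →L[ℂ] X}
    (hB : ∀ ε > 0, IsCompactOperator ((S ε).comp B)) :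
    IsCompactOperator ((hS.integralL 1).comp B) := by
  obtain ⟨M, hM0, hM⟩ := hS.exists_norm_le 1
  set e : ℕ → ℝ≥0 := fun n => 1 / ((n : ℝ≥0) + 1) with he
  have he1 : ∀ n, e n ≤ 1 := fun n => by
    rw [he]
    exact div_le_one_of_le₀ (by simp) (by positivity)
  have hepos : ∀ n, 0 < e n := fun n => by positivity
  have htend : Tendsto (fun n => (e n : ℝ)) atTop (𝓝 0) := by
    simpa [he] using tendsto_one_div_add_atTop_nhds_zero_nat (𝕜 := ℝ)
  refine isCompactOperator_of_tendsto (l := atTop)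
    (F := fun n => (hS.integralL (1 - e n)).comp ((S (e n)).comp B)) ?_
    (Eventually.of_forall fun n => IsCompactOperator.clm_comp (hB _ (hepos n)) (hS.integralL (1 - e n)))
  rw [tendsto_iff_norm_sub_tendsto_zero]
  have h1 : Tendsto (fun n => M * (e n : ℝ) * ‖B‖) atTop (𝓝 0) := by
    simpa using (htend.const_mul M).mul_const ‖B‖
  refine squeeze_zero (fun _ => norm_nonneg _) (fun n => ?_) h1
  have h2 : (hS.integralL (1 - e n)).comp ((S (e n)).comp B) - (hS.integralL 1).comp B =
      -((hS.integralL (e n)).comp B) := by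
    ext x
    have := hS.integralL_add (e n) (1 - e n) (B x)
    rw [add_tsub_cancel_of_le (he1 n)] at this
    simp only [sub_apply, neg_apply,
      ContinuousLinearMap.comp_apply, this]
    abel
  rw [h2, norm_neg]
  exact (ContinuousLinearMap.opNorm_comp_le _ _).trans
    (mul_le_mul_of_nonneg_right (hS.norm_integralL_le hM0 hM (he1 n)) (norm_nonneg _))

end IsC0Semigroup

/-- An average of values in a compact set lies in its closed convex hull, which is again compact
(Mazur). Only pointwise values are needed, no norm continuity of the integrand. -/
theorem isCompactOperator_of_integral {N : X →L[ℂ] X} {f : X → ℝ → X} {a b : ℝ} (hab : a < b)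
    (hN : ∀ x, N x = ∫ s in a..b, f x s)
    {k : Set X} (hk : IsCompact k) (hf : ∀ x, ‖x‖ ≤ 1 → ∀ s ∈ Ioc a b, f x s ∈ k)
    (hi : ∀ x, IntervalIntegrable (f x) volume a b) : IsCompactOperator N := by
  have hc : IsCompact (closure (convexHull ℝ k)) :=
    (totallyBounded_convexHull.2 hk.totallyBounded).closure.isCompact_of_isClosed isClosed_closure
  refine ⟨(fun x => (b - a) • x) '' closure (convexHull ℝ k), hc.image (by fun_prop), ?_⟩
  filter_upwards [Metric.closedBall_mem_nhds (0 : X) one_pos] with x hx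
  rw [mem_closedBall_zero_iff] at hx
  refine ⟨⨍ s in Ioc a b, f x s, ?_, ?_⟩
  · refine (convex_convexHull ℝ k).set_average_mem_closure ?_ ?_ ?_ ((hi x).1)
    · simpa using hab
    · simp
    · filter_upwards [ae_restrict_mem measurableSet_Ioc] with s hs
      exact subset_convexHull ℝ k (hf x hx s hs)
  · rw [setAverage_eq, hN, intervalIntegral.integral_of_le hab.le]
    simp [Measure.real, hab.le, smul_smul, (sub_pos.2 hab).ne']

end SpectralMapping

/-! ### Relatively compact perturbations and the spectral mapping theorem -/

section CompactPerturbation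

variable {X : Type*} [NormedAddCommGroup X] [NormedSpace ℂ X] [CompleteSpace X]
  {S U : ℝ≥0 → X →L[ℂ] X} {B : X →L[ℂ] X}

namespace IsC0Semigroup

theorem apply_sub_comp_of_duhamel (hS : IsC0Semigroup S) (hU : IsC0Semigroup U)
    (hd : ∀ t x, U t x = S t x + ∫ s in (0 : ℝ)..t, S (t - s.toNNReal) (B (U s.toNNReal x)))
    (ε t : ℝ≥0) (x : X) :
    S ε ((U t - S t) x) =
      ∫ s in (0 : ℝ)..t, S (t - s.toNNReal) (S ε (B (U s.toNNReal x))) := by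
  have hg : Continuous fun t => B (U t x) := B.continuous.comp (hU.strongly_continuous x)
  rw [sub_apply, hd, add_sub_cancel_left,
    ← ContinuousLinearMap.intervalIntegral_comp_comm _
      ((hS.continuous_duhamel_integrand_right hg t).intervalIntegrable _ _)]
  simp only [hS.apply_comm ε]

/-- If `S(ε) B` is compact for all `ε > 0`, then the perturbed semigroup differs from `S` by a
compact operator. -/
theorem isCompactOperator_sub_of_duhamel (hS : IsC0Semigroup S) (hU : IsC0Semigroup U)
    (hd : ∀ t x, U t x = S t x + ∫ s in (0 : ℝ)..t, S (t - s.toNNReal) (B (U s.toNNReal x)))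
    (hB : ∀ ε > 0, IsCompactOperator ((S ε).comp B)) {t : ℝ≥0} (ht : 0 < t) :
    IsCompactOperator (U t - S t) := by
  obtain ⟨M, hM0, hM⟩ := hS.exists_norm_le t
  obtain ⟨M', hM0', hM'⟩ := hU.exists_norm_le t
  -- The shift by `2` keeps `e n < t` already at `n = 0`.
  set e : ℕ → ℝ≥0 := fun n => t / ((n : ℝ≥0) + 2) with he
  have het : ∀ n, e n < t := fun n => div_lt_self ht (by
    have : (0 : ℝ≥0) ≤ n := bot_le
    linarith)
  have hepos : ∀ n, 0 < e n := fun n => by positivity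
  have htend : Tendsto (fun n => (e n : ℝ)) atTop (𝓝 0) := by
    have h1 : Tendsto (fun n : ℕ => (n : ℝ) + 2) atTop atTop :=
      tendsto_atTop_add_const_right _ _ tendsto_natCast_atTop_atTop
    simpa [he] using h1.const_div_atTop (t : ℝ)
  -- The factor `S(ε)` moves inside the Duhamel integral next to `B`. The vectors `U(s)x` stay in a
  -- ball, `S(ε)B` maps it into a compact set, and the remaining `S(r)` with `r ≤ t` keep it in a
  -- compact set.
  have hcpt : ∀ n, IsCompactOperator ((S (e n)).comp (U (t - e n) - S (t - e n))) := by
    intro n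
    obtain ⟨k, hk, hsub⟩ := (hB _ (hepos n)).image_closedBall_subset_compact M'
    have hpos : (0 : ℝ) < (t - e n : ℝ≥0) := NNReal.coe_pos.2 (tsub_pos_of_lt (het n))
    refine isCompactOperator_of_integral hpos
      (fun x => hS.apply_sub_comp_of_duhamel hU hd (e n) (t - e n) x)
      (k := (fun p : ℝ≥0 × X => S p.1 p.2) '' (Icc 0 t ×ˢ k))
      ((isCompact_Icc.prod hk).image hS.continuous_uncurry) ?_ ?_
    · intro x hx s hs
      refine ⟨(t - e n - s.toNNReal, S (e n) (B (U s.toNNReal x))), ⟨⟨bot_le, ?_⟩, hsub ?_⟩, rfl⟩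
      · exact tsub_le_self.trans tsub_le_self
      · refine ⟨U s.toNNReal x, ?_, rfl⟩
        rw [mem_closedBall_zero_iff]
        have h1 : s.toNNReal ≤ t := (Real.toNNReal_le_iff_le_coe.2 hs.2).trans tsub_le_self
        calc _ ≤ M' * ‖x‖ := (U _).le_of_opNorm_le (hM' _ h1) x
          _ ≤ M' * 1 := by gcongr
          _ = M' := mul_one _
    · intro x
      have hg : Continuous fun r => S (e n) (B (U r x)) :=
        (S (e n)).continuous.comp (B.continuous.comp (hU.strongly_continuous x))
      exact (hS.continuous_duhamel_integrand_right hg (t - e n)).intervalIntegrable _ _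
  refine isCompactOperator_of_tendsto (l := atTop) ?_ (Eventually.of_forall hcpt)
  rw [tendsto_iff_norm_sub_tendsto_zero]
  have h1 : Tendsto (fun n => M * ‖B‖ * M' * (e n : ℝ)) atTop (𝓝 0) := by
    simpa using htend.const_mul (M * ‖B‖ * M')
  refine squeeze_zero (fun _ => norm_nonneg _) (fun n => ?_) h1
  refine ContinuousLinearMap.opNorm_le_bound _ (by positivity) fun x => ?_
  have hte : t - e n + e n = t := tsub_add_cancel_of_le (het n).le
  have hg : Continuous fun r => B (U r x) := B.continuous.comp (hU.strongly_continuous x)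
  -- The error is the Duhamel integral over the last interval, of length `e n`, hence small in
  -- operator norm.
  have h2 : ((S (e n)).comp (U (t - e n) - S (t - e n)) - (U t - S t)) x =
      -∫ s in (0 : ℝ)..e n, S (e n - s.toNNReal) (B (U (s.toNNReal + (t - e n)) x)) := by
    have h3 := hS.duhamel_add hg (t - e n) (e n)
    rw [add_comm (e n), hte] at h3
    have h4 := hd t x
    rw [h3] at h4
    have h5 : (U (t - e n) - S (t - e n)) x = ∫ s in (0 : ℝ)..(t - e n : ℝ≥0),
        S (t - e n - s.toNNReal) (B (U s.toNNReal x)) := by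
      rw [sub_apply, hd, add_sub_cancel_left]
    rw [sub_apply, ContinuousLinearMap.comp_apply, h5, sub_apply, h4]
    abel
  rw [h2, norm_neg]
  have h6 := intervalIntegral.norm_integral_le_of_norm_le_const (a := 0) (b := (e n : ℝ))
    (f := fun s : ℝ => S (e n - s.toNNReal) (B (U (s.toNNReal + (t - e n)) x)))
    (C := M * (‖B‖ * (M' * ‖x‖))) (fun s hs => by
      rw [uIoc_of_le (e n).coe_nonneg] at hs
      refine (S _).le_of_opNorm_le_of_le (hM _ (tsub_le_self.trans (het n).le))
        (B.le_opNorm_of_le ((U _).le_of_opNorm_le (hM' _ ?_) x))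
      calc _ ≤ e n + (t - e n) := by
            gcongr
            exact Real.toNNReal_le_iff_le_coe.2 hs.2
        _ = t := by rw [add_comm, hte])
  rw [sub_zero, abs_of_nonneg (e n).coe_nonneg] at h6
  exact h6.trans (le_of_eq (by ring))

end IsC0Semigroup

/-- Since `z' - A = (1 - (z - z') R)(z - A)`, a Neumann series inverts the first factor. The `+ 1`
in the radius `(‖R‖ + 1)⁻¹` covers `R = 0`. -/
theorem isOpen_resolvent_genPair {z : ℂ} {R : X →L[ℂ] X}
    (h1 : ∀ x, GenPair S (R x) (z • R x - x)) (h2 : ∀ x y, GenPair S x y → R (z • x - y) = x) :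
    ∃ δ > 0, ∀ z' : ℂ, ‖z' - z‖ < δ → ∃ R' : X →L[ℂ] X,
      (∀ x, GenPair S (R' x) (z' • R' x - x)) ∧ ∀ x y, GenPair S x y → R' (z' • x - y) = x := by
  refine ⟨(‖R‖ + 1)⁻¹, by positivity, fun z' hz' => ?_⟩
  have hn : ‖(z - z') • R‖ < 1 := by
    rw [norm_smul, norm_sub_rev]
    calc _ ≤ ‖z' - z‖ * (‖R‖ + 1) := by gcongr; linarith
      _ < (‖R‖ + 1)⁻¹ * (‖R‖ + 1) := by gcongr
      _ = 1 := inv_mul_cancel₀ (by positivity)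
  obtain ⟨q, hq⟩ := isUnit_one_sub_of_norm_lt_one hn
  have hqx : ∀ x, (q : X →L[ℂ] X) x = x - (z - z') • R x := fun x => by rw [hq]; rfl
  have hq1 : ∀ x, (q : X →L[ℂ] X) ((↑q⁻¹ : X →L[ℂ] X) x) = x := fun x => by
    rw [← mul_apply_eq_comp, Units.mul_inv]; rfl
  have hq2 : ∀ x, (↑q⁻¹ : X →L[ℂ] X) ((q : X →L[ℂ] X) x) = x := fun x => by
    rw [← mul_apply_eq_comp, Units.inv_mul]; rfl
  refine ⟨R.comp (↑q⁻¹ : X →L[ℂ] X), fun x => ?_, fun x y hxy => ?_⟩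
  · have h3 := h1 ((↑q⁻¹ : X →L[ℂ] X) x)
    have h4 := hq1 x
    rw [hqx] at h4
    have h5 : z • R ((↑q⁻¹ : X →L[ℂ] X) x) - (↑q⁻¹ : X →L[ℂ] X) x =
        z' • R ((↑q⁻¹ : X →L[ℂ] X) x) - x := by
      nth_rewrite 4 [← h4]
      module
    rw [h5] at h3
    exact h3
  · have h3 := h2 x y hxy
    have h4 : z' • x - y = (q : X →L[ℂ] X) (z • x - y) := by
      rw [hqx, h3]
      module
    rw [ContinuousLinearMap.comp_apply, h4, hq2, h3]

/-- If `z` is in the resolvent set of the generator of the perturbed semigroup `U` but is not an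
eigenvalue of the generator of `S`, then `z - A` is onto for the generator `A` of `S`. -/
theorem surjective_of_resolvent_perturbation (hS : IsC0Semigroup S)
    (hUS : ∀ x y, GenPair U x y ↔ GenPair S x (y - B x))
    (hB : ∀ ε > 0, IsCompactOperator ((S ε).comp B)) {z : ℂ}
    (hinj : ∀ x, GenPair S x (z • x) → x = 0) {R : X →L[ℂ] X}
    (h1 : ∀ x, GenPair U (R x) (z • R x - x)) (h2 : ∀ x y, GenPair U x y → R (z • x - y) = x)
    (w : X) : ∃ x y, GenPair S x y ∧ z • x - y = w := by
  set W := expRescale z S with hW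
  have hWS : IsC0Semigroup W := hS.expRescale z
  have hBW : ∀ ε > 0, IsCompactOperator ((W ε).comp B) := fun ε hε =>
    (hB ε hε).smul (Complex.exp (-z * ((ε : ℝ) : ℂ)))
  set N := hWS.integralL 1
  have hN : IsCompactOperator (N.comp B) := hWS.isCompactOperator_integralL_comp hBW
  -- With `A₀`, `A` the generators of `S`, `U`, the identity `(z - A₀) N x = x - W(1) x` becomes `(z
  -- - A) N x = x - W(1) x - B N x`; then `R` is applied.
  have hR : ∀ x, R x = N x + R (W 1 x) + R (B (N x)) := by
    intro x
    have h3 := hWS.genPair_integralL 1 x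
    rw [genPair_expRescale_iff] at h3
    have h4 := (hUS (N x) (W 1 x - x + z • N x + B (N x))).2 (by rwa [add_sub_cancel_right])
    have h5 := h2 _ _ h4
    rw [show z • N x - (W 1 x - x + z • N x + B (N x)) = x - W 1 x - B (N x) by abel, map_sub,
      map_sub, sub_sub, sub_eq_iff_eq_add] at h5
    rw [h5]
    abel
  -- At `B x` every term of the identity contains one of the compact operators `N B` and `W(1) B`.
  have hRB : IsCompactOperator (R.comp B) := by
    have h3 : R.comp B = N.comp B + R.comp ((W 1).comp B) + (R.comp B).comp (N.comp B) := by
      ext x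
      simp only [ContinuousLinearMap.comp_apply, add_apply]
      exact hR (B x)
    rw [h3]
    exact (hN.add (IsCompactOperator.clm_comp (hBW 1 one_pos) R)).add
      (IsCompactOperator.clm_comp hN (R.comp B))
  -- Fredholm alternative for `1 + RB`. If `RBx = -x`, applying `z - A` gives `(z - A₀) x = 0`,
  -- which `hinj` excludes.
  rcases hRB.hasEigenvalue_or_mem_resolventSet (neg_ne_zero.2 one_ne_zero) with h | h
  · exfalso
    obtain ⟨x, hx⟩ := h.exists_hasEigenvector
    have h3 : R (B x) = (-1 : ℂ) • x := hx.apply_eq_smul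
    have h4 := h1 (B x)
    rw [h3, hUS] at h4
    have h5 := h4.smul (-1)
    refine hx.2 (hinj x ?_)
    convert h5 using 1
    · simp
    · rw [map_smul]
      module
  · rw [spectrum.mem_resolventSet_iff] at h
    obtain ⟨q, hq⟩ := h
    have hqx : ∀ x, (q : X →L[ℂ] X) x = -(x + R (B x)) := fun x => by
      rw [hq]
      simp [Algebra.algebraMap_eq_smul_one]
      abel
    -- Then `x = R(w - B x)`, so `(z - A) x = w - B x`, that is, `(z - A₀) x = w`.
    obtain ⟨x, hx⟩ : ∃ x, x + R (B x) = R w := by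
      refine ⟨(↑q⁻¹ : X →L[ℂ] X) (-(R w)), ?_⟩
      rw [← neg_inj, ← hqx, ← mul_apply_eq_comp, Units.mul_inv]; rfl
    have h3 := (h1 w).sub (h1 (B x))
    have h4 : R w - R (B x) = x := by rw [← hx, add_sub_cancel_right]
    have h5 : z • R w - w - (z • R (B x) - B x) = z • x - w + B x := by
      rw [← hx]
      module
    rw [h4, h5, hUS, add_sub_cancel_right] at h3
    exact ⟨x, _, h3, by abel⟩

/-- A spectral mapping theorem for a bounded perturbation of a semigroup `S` of growth bound `γ`
that becomes compact after smoothing by `S`, provided that no `z` with `Re z < γ` is an eigenvalue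
or in the resolvent set of the generator of `S`. -/
theorem spectral_mapping_of_duhamel [Nontrivial X] (hS : IsC0Semigroup S) {γ : ℝ}
    (hγ : ∀ t : ℝ≥0, ‖S t‖ ≤ Real.exp (γ * t)) (hU : IsC0Semigroup U)
    (hd : ∀ t x, U t x = S t x + ∫ s in (0 : ℝ)..t, S (t - s.toNNReal) (B (U s.toNNReal x)))
    (hB : ∀ ε > 0, IsCompactOperator ((S ε).comp B))
    (hinj : ∀ z : ℂ, z.re < γ → ∀ x, GenPair S x (z • x) → x = 0)
    (hsurj : ∀ z : ℂ, z.re < γ → ¬ ∀ w, ∃ x y, GenPair S x y ∧ z • x - y = w)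
    {A : X →ₗ.[ℂ] X} (hA : IsGenerator A U) (t : ℝ≥0) :
    spectrum ℂ (U t) \ {0} =
      (fun z : ℂ => Complex.exp (((t : ℝ) : ℂ) * z)) '' unboundedSpectrum A := by
  have hUS := hS.genPair_iff_of_duhamel hU hd
  have hhalf : ∀ z : ℂ, z.re ≤ γ → z ∈ unboundedSpectrum A := by
    intro z hz hmem
    rw [mem_unboundedResolventSet_iff hA] at hmem
    obtain ⟨R, h1, h2⟩ := hmem
    obtain ⟨δ, hδ, h3⟩ := isOpen_resolvent_genPair h1 h2
    -- Moving left inside the open resolvent set also handles the line `Re z = γ`, where nothing is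
    -- assumed about `S`.
    obtain ⟨R', h4, h5⟩ := h3 (z - ((δ / 2 : ℝ) : ℂ)) (by
      rw [sub_sub_cancel_left, norm_neg, Complex.norm_real, Real.norm_of_nonneg (by positivity)]
      linarith)
    have hre : (z - ((δ / 2 : ℝ) : ℂ)).re < γ := by
      rw [Complex.sub_re, Complex.ofReal_re]
      linarith
    exact hsurj _ hre
      (surjective_of_resolvent_perturbation hS hUS hB (hinj _ hre) h4 h5)
  ext μ
  constructor
  · rintro ⟨hμ, hμ0⟩
    have hμ0 : μ ≠ 0 := hμ0
    rcases eq_or_ne t 0 with rfl | ht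
    -- At `t = 0` every exponential is `1`, so it suffices that the spectrum of the generator is
    -- nonempty.
    · refine ⟨(γ : ℂ), hhalf _ (by simp), ?_⟩
      rw [hU.map_zero] at hμ
      have h1 : spectrum ℂ (ContinuousLinearMap.id ℂ X) = {1} := spectrum.one_eq
      rw [h1] at hμ
      simp [mem_singleton_iff.1 hμ]
    have ht : 0 < t := pos_iff_ne_zero.2 ht
    have ht' : ((t : ℝ) : ℂ) ≠ 0 := by exact_mod_cast ht.ne'
    have htr : (0 : ℝ) < t := NNReal.coe_pos.2 ht
    -- Inside the disc of radius `e^{γt}` the point `log μ / t` lies in the spectral half-plane;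
    -- outside it, `μ` is a regular value of `S(t)`.
    rcases le_or_gt ‖μ‖ (Real.exp (γ * t)) with hle | hgt
    · refine ⟨Complex.log μ / ((t : ℝ) : ℂ), hhalf _ ?_, ?_⟩
      · rw [Complex.div_ofReal_re, Complex.log_re, div_le_iff₀ htr]
        exact (Real.log_le_iff_le_exp (norm_pos_iff.2 hμ0)).2 hle
      · simp only
        rw [mul_div_cancel₀ _ ht', Complex.exp_log hμ0]
    · have hres : μ ∈ resolventSet ℂ (S t) := by
        by_contra hcon
        exact absurd (spectrum.norm_le_norm_of_mem (k := μ) (a := S t) hcon)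
          (not_le.2 ((hγ t).trans_lt hgt))
      obtain ⟨q, hq⟩ := spectrum.mem_resolventSet_iff.1 hres
      have hqx : ∀ x, (q : X →L[ℂ] X) x = μ • x - S t x := fun x => by
        rw [hq]
        simp [Algebra.algebraMap_eq_smul_one]
      have hq2 : ∀ x, (↑q⁻¹ : X →L[ℂ] X) ((q : X →L[ℂ] X) x) = x := fun x => by
        rw [← mul_apply_eq_comp, Units.inv_mul]; rfl
      have hq1 : ∀ x, (q : X →L[ℂ] X) ((↑q⁻¹ : X →L[ℂ] X) x) = x := fun x => by
        rw [← mul_apply_eq_comp, Units.mul_inv]; rfl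
      -- `μ - U(t) = (μ - S(t)) (1 - (μ - S(t))⁻¹ (U(t) - S(t)))`: either the second factor is
      -- invertible, or its kernel consists of eigenvectors of `U(t)` for `μ`.
      have hK : IsCompactOperator ((↑q⁻¹ : X →L[ℂ] X).comp (U t - S t)) :=
        IsCompactOperator.clm_comp (hS.isCompactOperator_sub_of_duhamel hU hd hB ht) _
      rcases hK.hasEigenvalue_or_mem_resolventSet one_ne_zero with h | h
      · obtain ⟨x, hx⟩ := h.exists_hasEigenvector
        have h3 : (↑q⁻¹ : X →L[ℂ] X) (U t x - S t x) = (1 : ℂ) • x := hx.apply_eq_smul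
        have h4 := hq1 (U t x - S t x)
        rw [h3, one_smul, hqx, sub_left_inj] at h4
        obtain ⟨z, hz, v, hv, hgv⟩ := hU.exists_genPair_eigenvector ht hμ0 hx.2 h4.symm
        refine ⟨z, fun hmem => hv ?_, hz⟩
        obtain ⟨R, -, h2⟩ := (mem_unboundedResolventSet_iff hA z).1 hmem
        have h5 := h2 v (z • v) hgv
        rw [sub_self, map_zero] at h5
        exact h5.symm
      · exfalso
        refine spectrum.mem_iff.1 hμ ?_
        have h5 := q.isUnit.mul (spectrum.mem_resolventSet_iff.1 h)
        convert h5 using 1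
        ext x
        simp only [mul_apply_eq_comp, sub_apply, map_sub, ContinuousLinearMap.comp_apply,
          Algebra.algebraMap_eq_smul_one, one_smul, hq1, smul_apply, one_apply_eq_self]
        rw [hqx]
        abel
  · rintro ⟨z, hz, rfl⟩
    refine ⟨?_, Complex.exp_ne_zero _⟩
    by_contra hcon
    exact hz ((mem_unboundedResolventSet_iff hA z).2
      (hU.exists_resolvent_of_not_mem_spectrum hcon))

end CompactPerturbation

/-! ### Dominated convergence, multiplications and dilations on L² -/

section L2Operators

open scoped ENNReal

/-- Dominated convergence in `L²`. -/
theorem tendsto_lp_two_of_dominated {α ι : Type*} [MeasurableSpace α] {μ : Measure α}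
    {l : Filter ι} [l.IsCountablyGenerated] {F : ι → α → ℂ} {f : α → ℂ} {bound : α → ℝ}
    {G : ι → Lp ℂ 2 μ} {g : Lp ℂ 2 μ} (hG : ∀ᶠ n in l, G n =ᵐ[μ] F n) (hg : g =ᵐ[μ] f)
    (hbound : MemLp bound 2 μ) (hF : ∀ᶠ n in l, ∀ᵐ x ∂μ, ‖F n x‖ ≤ bound x)
    (hf : ∀ᵐ x ∂μ, ‖f x‖ ≤ bound x)
    (hlim : ∀ᵐ x ∂μ, Tendsto (fun n => F n x) l (𝓝 (f x))) : Tendsto G l (𝓝 g) := by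
  rw [Lp.tendsto_Lp_iff_tendsto_eLpNorm']
  have h1 : Tendsto (fun n => ∫⁻ x, ‖F n x - f x‖ₑ ^ (2 : ℝ) ∂μ) l (𝓝 0) := by
    have h2 := tendsto_lintegral_filter_of_dominated_convergence' (μ := μ) (l := l)
      (F := fun n x => ‖F n x - f x‖ₑ ^ (2 : ℝ)) (f := fun _ => 0)
      (fun x => ‖2 * bound x‖ₑ ^ (2 : ℝ))
      (by
        filter_upwards [hG] with n hGn
        exact ((((Lp.aestronglyMeasurable (G n)).congr hGn).sub
          ((Lp.aestronglyMeasurable g).congr hg)).enorm).pow_const _)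
      (by
        filter_upwards [hF] with n hFn
        filter_upwards [hFn, hf] with x h2 h4
        refine ENNReal.rpow_le_rpow ?_ (by norm_num)
        rw [enorm_le_iff_norm_le, Real.norm_eq_abs]
        exact ((norm_sub_le _ _).trans (by linarith)).trans (le_abs_self _))
      (by
        have h3 := (hbound.const_mul 2).2
        rw [eLpNorm_lt_top_iff_lintegral_rpow_enorm_lt_top (by norm_num) (by norm_num)] at h3
        simpa using h3.ne)
      (by
        filter_upwards [hlim] with x hx
        have h5 : Tendsto (fun n => ‖F n x - f x‖ₑ) l (𝓝 0) := by
          simpa using (hx.sub_const (f x)).enorm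
        simpa [Function.comp_def] using
          (ENNReal.continuous_rpow_const (y := 2)).continuousAt.tendsto.comp h5)
    simpa using h2
  have h6 : Tendsto (fun n => (∫⁻ x, ‖F n x - f x‖ₑ ^ (2 : ℝ) ∂μ) ^ (1 / 2 : ℝ)) l (𝓝 0) := by
    have := (ENNReal.continuous_rpow_const (y := 1 / 2)).continuousAt.tendsto.comp h1
    simpa [Function.comp_def] using this
  refine h6.congr' ?_
  filter_upwards [hG] with n hGn
  rw [eLpNorm_congr_ae (hGn.sub hg), eLpNorm_eq_lintegral_rpow_enorm_toReal (by norm_num)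
    (by norm_num)]
  simp

variable {d : ℕ}

/-- Multiplication by a bounded function, as an operator on `L²`. -/
def mulL {w : EuclideanSpace ℝ (Fin d) → ℂ} (hw : MemLp w ⊤ volume) : L2Space d →L[ℂ] L2Space d :=
  (ContinuousLinearMap.mul ℂ ℂ).holderL volume ⊤ 2 2 (hw.toLp w)

theorem coeFn_mulL {w : EuclideanSpace ℝ (Fin d) → ℂ} (hw : MemLp w ⊤ volume) (f : L2Space d) :
    mulL hw f =ᵐ[volume] fun x => w x * f x := by
  filter_upwards [ContinuousLinearMap.coeFn_holder (r := 2) (ContinuousLinearMap.mul ℂ ℂ)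
    (hw.toLp w) f, hw.coeFn_toLp] with x h1 h2
  refine h1.trans ?_
  rw [h2]
  rfl

theorem norm_mulL_apply_le {w : EuclideanSpace ℝ (Fin d) → ℂ} (hw : MemLp w ⊤ volume) {C : ℝ}
    (hC : ∀ x, ‖w x‖ ≤ C) (f : L2Space d) : ‖mulL hw f‖ ≤ C * ‖f‖ := by
  refine Lp.norm_le_mul_norm_of_ae_le_mul ?_
  filter_upwards [coeFn_mulL hw f] with x hx
  rw [hx, norm_mul]
  exact mul_le_mul_of_nonneg_right (hC x) (norm_nonneg _)

theorem ae_comp_smul {c : ℝ} (hc : c ≠ 0) {p : EuclideanSpace ℝ (Fin d) → Prop}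
    (h : ∀ᵐ x, p x) : ∀ᵐ x, p (c • x) := by
  have hq : Measure.QuasiMeasurePreserving (fun x : EuclideanSpace ℝ (Fin d) => c • x)
      volume volume := by
    refine ⟨measurable_const_smul c, ?_⟩
    rw [Measure.map_addHaar_smul _ hc]
    exact Measure.smul_absolutelyContinuous
  exact hq.ae h

theorem eLpNorm_comp_smul {c : ℝ} (hc : 0 < c) {f : EuclideanSpace ℝ (Fin d) → ℂ}
    (hf : AEStronglyMeasurable f volume) :
    eLpNorm (fun x => f (c • x)) 2 volume =
      ENNReal.ofReal ((c ^ d)⁻¹) ^ (1 / 2 : ℝ) * eLpNorm f 2 volume := by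
  have h1 : Measure.map (fun x : EuclideanSpace ℝ (Fin d) => c • x) volume =
      ENNReal.ofReal ((c ^ d)⁻¹) • volume := by
    rw [Measure.map_addHaar_smul _ hc.ne', finrank_euclideanSpace_fin,
      abs_of_nonneg (by positivity)]
  have h2 : AEStronglyMeasurable f (Measure.map (fun x : EuclideanSpace ℝ (Fin d) => c • x)
      volume) := by
    rw [h1]
    exact hf.mono_ac Measure.smul_absolutelyContinuous
  have h3 := eLpNorm_map_measure (p := 2) h2 (measurable_const_smul c).aemeasurable
  rw [h1, eLpNorm_smul_measure_of_ne_top (by norm_num)] at h3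
  simpa [Function.comp_def] using h3.symm

theorem memLp_comp_smul {c : ℝ} (hc : 0 < c) {f : EuclideanSpace ℝ (Fin d) → ℂ}
    (hf : MemLp f 2 volume) : MemLp (fun x => f (c • x)) 2 volume := by
  constructor
  · obtain ⟨g, hg, hfg⟩ := hf.1
    exact ⟨fun x => g (c • x), hg.comp_measurable (measurable_const_smul c),
      ae_comp_smul hc.ne' hfg⟩
  · rw [eLpNorm_comp_smul hc hf.1]
    exact ENNReal.mul_lt_top (ENNReal.rpow_lt_top_of_nonneg (by norm_num) ENNReal.ofReal_ne_top)
      hf.2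

/-- The dilation `f ↦ f(c ·)` on `L²`. -/
def dilL {c : ℝ} (hc : 0 < c) : L2Space d →L[ℂ] L2Space d :=
  LinearMap.mkContinuous
    { toFun := fun f => (memLp_comp_smul hc (Lp.memLp f)).toLp _
      map_add' := fun f g => by
        rw [← MemLp.toLp_add]
        exact MemLp.toLp_congr _ _ (ae_comp_smul hc.ne' (Lp.coeFn_add f g))
      map_smul' := fun a f => by
        rw [RingHom.id_apply, ← MemLp.toLp_const_smul]
        exact MemLp.toLp_congr _ _ (ae_comp_smul hc.ne' (Lp.coeFn_smul a f)) }
    (Real.sqrt ((c ^ d)⁻¹)) (fun f => by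
      change ‖(memLp_comp_smul hc (Lp.memLp f)).toLp _‖ ≤ _
      rw [Lp.norm_toLp, eLpNorm_comp_smul hc (Lp.aestronglyMeasurable f), ENNReal.toReal_mul,
        ← ENNReal.toReal_rpow, ENNReal.toReal_ofReal (by positivity), ← Real.sqrt_eq_rpow]
      rfl)

theorem coeFn_dilL {c : ℝ} (hc : 0 < c) (f : L2Space d) :
    dilL hc f =ᵐ[volume] fun x => f (c • x) :=
  MemLp.coeFn_toLp (memLp_comp_smul hc (Lp.memLp f))

theorem norm_dilL_apply {c : ℝ} (hc : 0 < c) (f : L2Space d) :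
    ‖dilL hc f‖ = Real.sqrt ((c ^ d)⁻¹) * ‖f‖ := by
  change ‖(memLp_comp_smul hc (Lp.memLp f)).toLp _‖ = _
  rw [Lp.norm_toLp, eLpNorm_comp_smul hc (Lp.aestronglyMeasurable f), ENNReal.toReal_mul,
    ← ENNReal.toReal_rpow, ENNReal.toReal_ofReal (by positivity), ← Real.sqrt_eq_rpow]
  rfl

/-- A square integrable majorant of Schwartz functions. -/
def decayBound (d : ℕ) (x : EuclideanSpace ℝ (Fin d)) : ℝ := ((1 + ‖x‖) ^ (d + 1))⁻¹

theorem decayBound_nonneg (x : EuclideanSpace ℝ (Fin d)) : 0 ≤ decayBound d x := by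
  unfold decayBound; positivity

theorem decayBound_smul_le {c : ℝ} (hc : 1 ≤ c) (x : EuclideanSpace ℝ (Fin d)) :
    decayBound d (c • x) ≤ decayBound d x := by
  unfold decayBound
  gcongr
  rw [norm_smul, Real.norm_of_nonneg (by linarith)]
  exact le_mul_of_one_le_left (norm_nonneg _) hc

theorem memLp_decayBound : MemLp (decayBound d) 2 volume := by
  have hcont : Continuous (decayBound d) := by
    unfold decayBound
    exact Continuous.inv₀ (by fun_prop) (fun x => by positivity)
  rw [memLp_two_iff_integrable_sq hcont.aestronglyMeasurable]
  have h := integrable_one_add_norm (E := EuclideanSpace ℝ (Fin d)) (μ := volume)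
    (r := ((2 * (d + 1) : ℕ) : ℝ)) (by
      rw [finrank_euclideanSpace_fin]
      exact_mod_cast (by omega))
  refine h.congr (Eventually.of_forall fun x => ?_)
  simp only [decayBound]
  rw [Real.rpow_neg (by positivity), Real.rpow_natCast, inv_pow, ← pow_mul, mul_comm 2]

theorem SchwartzMap.exists_norm_le_decayBound (f : 𝓢(EuclideanSpace ℝ (Fin d), ℂ)) :
    ∃ C : ℝ, 0 ≤ C ∧ ∀ x, ‖f x‖ ≤ C * decayBound d x := by
  have h := SchwartzMap.one_add_le_sup_seminorm_apply (𝕜 := ℂ) (m := (d + 1, 0)) (k := d + 1)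
    (n := 0) le_rfl le_rfl f
  simp only [norm_iteratedFDeriv_zero] at h
  refine ⟨2 ^ (d + 1) * ((Finset.Iic (d + 1, 0)).sup
    fun m => SchwartzMap.seminorm ℂ m.1 m.2) f, by positivity, fun x => ?_⟩
  rw [decayBound, ← div_eq_mul_inv, le_div_iff₀ (by positivity), mul_comm]
  exact h x

end L2Operators

/-! ### The explicit semigroup on the Fourier side and its spectral half-plane -/

section OUSemigroup

theorem continuous_apply_of_dense {X ι : Type*} [NormedAddCommGroup X] [NormedSpace ℂ X]
    {S : ℝ≥0 → X →L[ℂ] X} {j : ι → X} (hj : DenseRange j)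
    (hc : ∀ i, Continuous fun t => S t (j i))
    (hb : ∀ T : ℝ≥0, ∃ M : ℝ, 0 ≤ M ∧ ∀ t ≤ T, ‖S t‖ ≤ M) (x : X) :
    Continuous fun t => S t x := by
  rw [continuous_iff_continuousAt]
  intro t₀
  rw [ContinuousAt, Metric.tendsto_nhds]
  intro ε hε
  obtain ⟨M, hM0, hM⟩ := hb (t₀ + 1)
  obtain ⟨i, hi⟩ := hj.exists_dist_lt x (ε := ε / (3 * (M + 1))) (by positivity)
  have hbound : ∀ t : ℝ≥0, t ≤ t₀ + 1 → dist (S t x) (S t (j i)) < ε / 3 := by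
    intro t ht
    rw [dist_eq_norm, ← map_sub]
    rw [dist_eq_norm] at hi
    calc _ ≤ (M + 1) * ‖x - j i‖ := (S t).le_of_opNorm_le ((hM t ht).trans (by linarith)) _
      _ < (M + 1) * (ε / (3 * (M + 1))) := by gcongr
      _ = ε / 3 := by field_simp
  filter_upwards [Metric.tendsto_nhds.1 (hc i).continuousAt (ε / 3) (by positivity),
    gt_mem_nhds (lt_add_one t₀)] with t h1 h2
  have h3 := hbound t h2.le
  have h4 := hbound t₀ (le_add_of_nonneg_right zero_le_one)
  rw [dist_comm] at h4
  calc _ ≤ dist (S t x) (S t (j i)) + dist (S t (j i)) (S t₀ (j i)) +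
        dist (S t₀ (j i)) (S t₀ x) := dist_triangle4 _ _ _ _
    _ < ε / 3 + ε / 3 + ε / 3 := by gcongr
    _ = ε := by ring

variable {d : ℕ}

/-- The Gaussian weight `exp(-π²|η|²(1 - e^{-4t}))`. -/
def gaussWeight (t : ℝ) (η : EuclideanSpace ℝ (Fin d)) : ℂ :=
  ((Real.exp (-(Real.pi ^ 2 * ‖η‖ ^ 2 * (1 - Real.exp (-4 * t)))) : ℝ) : ℂ)

theorem continuous_gaussWeight (t : ℝ) : Continuous (gaussWeight (d := d) t) := by
  unfold gaussWeight; fun_prop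

theorem norm_gaussWeight_le_one {t : ℝ} (ht : 0 ≤ t) (η : EuclideanSpace ℝ (Fin d)) :
    ‖gaussWeight t η‖ ≤ 1 := by
  rw [gaussWeight, Complex.norm_real, Real.norm_of_nonneg (Real.exp_pos _).le, Real.exp_le_one_iff,
    neg_nonpos]
  have : Real.exp (-4 * t) ≤ 1 := Real.exp_le_one_iff.2 (by linarith)
  have : 0 ≤ 1 - Real.exp (-4 * t) := by linarith
  positivity

theorem memLp_gaussWeight (t : ℝ≥0) : MemLp (gaussWeight (d := d) t) ⊤ volume :=
  memLp_top_of_bound (continuous_gaussWeight _).aestronglyMeasurable 1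
    (Eventually.of_forall (norm_gaussWeight_le_one t.coe_nonneg))

/-- The semigroup `e^{2dt} exp(-π²|ξ|²(e^{4t} - 1)) f(e^{2t} ξ)`, to which the Fourier transform
conjugates the semigroup generated by `Δ - 2x·∇`. -/
def fourierOU (d : ℕ) (t : ℝ≥0) : L2Space d →L[ℂ] L2Space d :=
  ((Real.exp (2 * d * t) : ℝ) : ℂ) •
    (dilL (Real.exp_pos (2 * (t : ℝ)))).comp (mulL (memLp_gaussWeight t))

/-- The symbol `exp(2dt - π²|ξ|²(e^{4t} - 1))`. -/
def ouSymbol (t : ℝ) (ξ : EuclideanSpace ℝ (Fin d)) : ℝ :=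
  Real.exp (2 * d * t - Real.pi ^ 2 * ‖ξ‖ ^ 2 * (Real.exp (4 * t) - 1))

theorem ouSymbol_pos (t : ℝ) (ξ : EuclideanSpace ℝ (Fin d)) : 0 < ouSymbol t ξ := Real.exp_pos _

theorem ouSymbol_le {t : ℝ} (ht : 0 ≤ t) (ξ : EuclideanSpace ℝ (Fin d)) :
    ouSymbol t ξ ≤ Real.exp (2 * d * t) := by
  refine Real.exp_le_exp.2 (sub_le_self _ ?_)
  have : 0 ≤ Real.exp (4 * t) - 1 := by
    have := Real.add_one_le_exp (4 * t)
    linarith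
  positivity

/-- Because `e^{4t}(1 - e^{-4t}) = e^{4t} - 1`. Multiplying before dilating leaves a weight that
decreases with `t` to a fixed Gaussian. -/
theorem exp_mul_gaussWeight (t : ℝ) (ξ : EuclideanSpace ℝ (Fin d)) :
    ((Real.exp (2 * d * t) : ℝ) : ℂ) * gaussWeight t (Real.exp (2 * t) • ξ) =
      (ouSymbol t ξ : ℂ) := by
  rw [gaussWeight, ouSymbol, ← Complex.ofReal_mul, ← Real.exp_add]
  congr 2
  have h : Real.exp (2 * t) ^ 2 * Real.exp (-4 * t) = 1 := by
    rw [← Real.exp_nat_mul, ← Real.exp_add]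
    simp
    ring
  have h2 : Real.exp (2 * t) ^ 2 = Real.exp (4 * t) := by
    rw [← Real.exp_nat_mul]
    congr 1
    push_cast
    ring
  rw [norm_smul, Real.norm_of_nonneg (Real.exp_pos _).le, ← h2]
  linear_combination (Real.pi ^ 2 * ‖ξ‖ ^ 2) * h

theorem coeFn_fourierOU (t : ℝ≥0) (f : L2Space d) :
    fourierOU d t f =ᵐ[volume]
      fun ξ => (ouSymbol (t : ℝ) ξ : ℂ) * f (Real.exp (2 * (t : ℝ)) • ξ) := by
  have hpos := Real.exp_pos (2 * (t : ℝ))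
  filter_upwards [Lp.coeFn_smul ((Real.exp (2 * d * t) : ℝ) : ℂ)
      (dilL hpos (mulL (memLp_gaussWeight t) f)),
    coeFn_dilL hpos (mulL (memLp_gaussWeight t) f),
    ae_comp_smul hpos.ne' (coeFn_mulL (memLp_gaussWeight t) f)] with ξ h1 h2 h3
  refine h1.trans ?_
  rw [Pi.smul_apply, h2, h3, smul_eq_mul, ← mul_assoc, exp_mul_gaussWeight]

/-- The dilation contributes `e^{-dt}` against the prefactor `e^{2dt}`. This exact formula gives the
growth bound `d` and also excludes eigenvalues to the left of it. -/
theorem norm_fourierOU_apply (t : ℝ≥0) (f : L2Space d) :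
    ‖fourierOU d t f‖ = Real.exp (d * t) * ‖mulL (memLp_gaussWeight t) f‖ := by
  have hpos := Real.exp_pos (2 * (t : ℝ))
  change ‖((Real.exp (2 * d * t) : ℝ) : ℂ) • dilL hpos (mulL (memLp_gaussWeight t) f)‖ = _
  rw [norm_smul, norm_dilL_apply, Complex.norm_real, Real.norm_of_nonneg (Real.exp_pos _).le,
    ← mul_assoc]
  congr 1
  have h1 : (Real.exp (2 * (t : ℝ)) ^ d)⁻¹ = Real.exp (-(d * t)) ^ 2 := by
    rw [← Real.exp_nat_mul, ← Real.exp_neg, ← Real.exp_nat_mul]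
    congr 1
    push_cast
    ring
  rw [h1, Real.sqrt_sq (Real.exp_pos _).le, ← Real.exp_add]
  congr 1
  ring

theorem norm_fourierOU_le (t : ℝ≥0) : ‖fourierOU d t‖ ≤ Real.exp (d * t) := by
  refine ContinuousLinearMap.opNorm_le_bound _ (Real.exp_pos _).le fun f => ?_
  rw [norm_fourierOU_apply]
  have := norm_mulL_apply_le (memLp_gaussWeight t) (norm_gaussWeight_le_one t.coe_nonneg) f
  rw [one_mul] at this
  gcongr

/-- The cocycle identity along the dilation flow, which is the semigroup law. -/
theorem ouSymbol_add (s t : ℝ) (ξ : EuclideanSpace ℝ (Fin d)) :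
    ouSymbol (s + t) ξ = ouSymbol s ξ * ouSymbol t (Real.exp (2 * s) • ξ) := by
  rw [ouSymbol, ouSymbol, ouSymbol, ← Real.exp_add]
  congr 1
  have h2 : Real.exp (2 * s) ^ 2 = Real.exp (4 * s) := by
    rw [← Real.exp_nat_mul]
    congr 1
    push_cast
    ring
  rw [norm_smul, Real.norm_of_nonneg (Real.exp_pos _).le, mul_pow, h2, mul_add 4, Real.exp_add]
  ring

theorem coeFn_fourierOU_toLp (t : ℝ≥0) (f : 𝓢(EuclideanSpace ℝ (Fin d), ℂ)) :
    fourierOU d t (f.toLp 2 volume) =ᵐ[volume]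
      fun ξ => (ouSymbol (t : ℝ) ξ : ℂ) * f (Real.exp (2 * (t : ℝ)) • ξ) := by
  filter_upwards [coeFn_fourierOU t (f.toLp 2 volume),
    ae_comp_smul (Real.exp_pos (2 * (t : ℝ))).ne' (f.coeFn_toLp 2 volume)] with ξ h1 h2
  rw [h1, h2]

theorem norm_ouSymbol_mul_le {t T : ℝ} (ht : 0 ≤ t) (htT : t ≤ T)
    {f : EuclideanSpace ℝ (Fin d) → ℂ} {C : ℝ} (hC0 : 0 ≤ C)
    (hC : ∀ x, ‖f x‖ ≤ C * decayBound d x) (ξ : EuclideanSpace ℝ (Fin d)) :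
    ‖(ouSymbol t ξ : ℂ) * f (Real.exp (2 * t) • ξ)‖ ≤
      Real.exp (2 * d * T) * C * decayBound d ξ := by
  rw [norm_mul, Complex.norm_real, Real.norm_of_nonneg (ouSymbol_pos _ _).le, mul_assoc]
  refine mul_le_mul ((ouSymbol_le ht ξ).trans (Real.exp_le_exp.2 (by gcongr))) ?_ (norm_nonneg _)
    (Real.exp_pos _).le
  refine (hC _).trans (mul_le_mul_of_nonneg_left (decayBound_smul_le ?_ ξ) hC0)
  exact Real.one_le_exp (by positivity)

theorem continuous_fourierOU_toLp (f : 𝓢(EuclideanSpace ℝ (Fin d), ℂ)) :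
    Continuous fun t : ℝ≥0 => fourierOU d t (f.toLp 2 volume) := by
  obtain ⟨C, hC0, hC⟩ := SchwartzMap.exists_norm_le_decayBound f
  rw [continuous_iff_continuousAt]
  intro t₀
  refine tendsto_lp_two_of_dominated (Eventually.of_forall fun t => coeFn_fourierOU_toLp t f)
    (coeFn_fourierOU_toLp t₀ f)
    (memLp_decayBound.const_mul (Real.exp (2 * d * (t₀ + 1)) * C)) ?_ ?_ ?_
  · filter_upwards [gt_mem_nhds (lt_add_one t₀)] with t ht
    exact Eventually.of_forall fun ξ => norm_ouSymbol_mul_le t.coe_nonneg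
      (by exact_mod_cast ht.le) hC0 hC ξ
  · exact Eventually.of_forall fun ξ => norm_ouSymbol_mul_le t₀.coe_nonneg (by linarith) hC0 hC ξ
  · refine Eventually.of_forall fun ξ => Continuous.tendsto ?_ t₀
    have hf : Continuous f := f.continuous
    unfold ouSymbol
    fun_prop

theorem dense_range_toLp :
    DenseRange fun f : 𝓢(EuclideanSpace ℝ (Fin d), ℂ) => (f.toLp 2 volume : L2Space d) :=
  SchwartzMap.denseRange_toLpCLM (p := 2) ENNReal.ofNat_ne_top

theorem isC0Semigroup_fourierOU (d : ℕ) : IsC0Semigroup (fourierOU d) where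
  map_zero := by
    ext f
    filter_upwards [coeFn_fourierOU 0 f] with ξ h1
    rw [h1]
    simp [ouSymbol]
  map_add s t := by
    ext f
    filter_upwards [coeFn_fourierOU (s + t) f, coeFn_fourierOU s (fourierOU d t f),
      ae_comp_smul (Real.exp_pos (2 * (s : ℝ))).ne' (coeFn_fourierOU t f)] with ξ h1 h2 h3
    rw [h1, ContinuousLinearMap.comp_apply, h2, h3, NNReal.coe_add, ouSymbol_add, smul_smul,
      ← Real.exp_add, Complex.ofReal_mul, mul_assoc, mul_add, add_comm (2 * (t : ℝ))]
  strongly_continuous := by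
    refine continuous_apply_of_dense dense_range_toLp continuous_fourierOU_toLp
      fun T => ⟨Real.exp (d * T), (Real.exp_pos _).le, fun t ht => (norm_fourierOU_le t).trans ?_⟩
    have ht' : (t : ℝ) ≤ T := by exact_mod_cast ht
    exact Real.exp_le_exp.2 (by gcongr)

/-- The Gaussian is the limit of the weights as `t → ∞`, and supplies a lower bound independent of
`t`. -/
theorem norm_exp_gaussian_le (t : ℝ≥0) (η : EuclideanSpace ℝ (Fin d)) :
    ‖((Real.exp (-(Real.pi ^ 2 * ‖η‖ ^ 2)) : ℝ) : ℂ)‖ ≤ ‖gaussWeight t η‖ := by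
  rw [gaussWeight, Complex.norm_real, Complex.norm_real, Real.norm_of_nonneg (Real.exp_pos _).le,
    Real.norm_of_nonneg (Real.exp_pos _).le, Real.exp_le_exp, neg_le_neg_iff]
  refine mul_le_of_le_one_right (by positivity) ?_
  linarith [Real.exp_pos (-4 * (t : ℝ))]

/-- The generator of `fourierOU` has no eigenvalue with real part less than `d`. -/
theorem eq_zero_of_eigenvector_fourierOU {z : ℂ} (hz : z.re < d) {f : L2Space d}
    (hf : GenPair (fourierOU d) f (z • f)) : f = 0 := by
  set g : EuclideanSpace ℝ (Fin d) → ℂ :=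
    fun η => ((Real.exp (-(Real.pi ^ 2 * ‖η‖ ^ 2)) : ℝ) : ℂ) with hgdef
  have hg : MemLp g ⊤ volume := by
    refine memLp_top_of_bound (Continuous.aestronglyMeasurable (by fun_prop)) 1
      (Eventually.of_forall fun η => (norm_exp_gaussian_le 0 η).trans ?_)
    exact norm_gaussWeight_le_one (by simp) η
  -- For an eigenvector the orbit has norm `e^{t Re z} ‖f‖`, and it also equals `e^{dt}` times the
  -- weighted norm of `f`. If `Re z < d`, the Gaussian-weighted norm must vanish.
  have h1 : ∀ t : ℝ≥0, ‖mulL hg f‖ ≤ Real.exp ((z.re - d) * t) * ‖f‖ := by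
    intro t
    have h2 : ‖mulL hg f‖ ≤ ‖mulL (memLp_gaussWeight t) f‖ := by
      refine Lp.norm_le_norm_of_ae_le ?_
      filter_upwards [coeFn_mulL hg f, coeFn_mulL (memLp_gaussWeight t) f] with η h3 h4
      rw [h3, h4, norm_mul, norm_mul]
      exact mul_le_mul_of_nonneg_right (norm_exp_gaussian_le t η) (norm_nonneg _)
    have h3 := norm_fourierOU_apply t f
    rw [(isC0Semigroup_fourierOU d).apply_of_eigenvector hf t, norm_smul, Complex.norm_exp,
      Complex.re_mul_ofReal] at h3
    refine h2.trans (le_of_eq ?_)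
    rw [sub_mul, Real.exp_sub, div_mul_eq_mul_div, h3]
    field_simp
  have h2 : Tendsto (fun t : ℝ≥0 => Real.exp ((z.re - d) * t) * ‖f‖) atTop (𝓝 0) := by
    have h3 : Tendsto (fun t : ℝ≥0 => (z.re - d) * (t : ℝ)) atTop atBot :=
      (NNReal.tendsto_coe_atTop.2 tendsto_id).const_mul_atTop_of_neg (by linarith)
    simpa using (Real.tendsto_exp_atBot.comp h3).mul_const ‖f‖
  have h3 : mulL hg f = 0 :=
    norm_le_zero_iff.1 (ge_of_tendsto' h2 h1)
  rw [Lp.eq_zero_iff_ae_eq_zero] at h3 ⊢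
  filter_upwards [h3, coeFn_mulL hg f] with η h4 h5
  rw [h5] at h4
  have h6 : g η ≠ 0 := by
    simp only [hgdef]
    exact_mod_cast (Real.exp_pos _).ne'
  exact (mul_eq_zero.1 h4).resolve_left h6

/-- The function `|η|^{-z/2} e^{-π²|η|²}`, an eigenfunction of the adjoint of `fourierOU`. -/
def adjointEigenfunction (z : ℂ) (η : EuclideanSpace ℝ (Fin d)) : ℂ :=
  ((‖η‖ : ℝ) : ℂ) ^ (-z / 2) * ((Real.exp (-(Real.pi ^ 2 * ‖η‖ ^ 2)) : ℝ) : ℂ)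

theorem measurable_adjointEigenfunction (z : ℂ) :
    Measurable (adjointEigenfunction (d := d) z) := by
  unfold adjointEigenfunction
  fun_prop

/-- In polar coordinates the squared norm is a multiple of `∫ r^{d-1-Re z} e^{-2π²r²} dr`, which
converges at `0` because `d - 1 - Re z > -1`. -/
theorem memLp_adjointEigenfunction (hd : 1 ≤ d) {z : ℂ} (hz : z.re < d) :
    MemLp (adjointEigenfunction (d := d) z) 2 volume := by
  rw [memLp_two_iff_integrable_sq_norm (measurable_adjointEigenfunction z).aestronglyMeasurable]
  have : Nonempty (Fin d) := ⟨⟨0, hd⟩⟩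
  have h1 := (integrable_fun_norm_addHaar (E := EuclideanSpace ℝ (Fin d)) volume
    (f := fun r : ℝ => ‖((r : ℝ) : ℂ) ^ (-z / 2) *
      ((Real.exp (-(Real.pi ^ 2 * r ^ 2)) : ℝ) : ℂ)‖ ^ 2)).2 (by
    refine (integrableOn_rpow_mul_exp_neg_mul_sq (b := 2 * Real.pi ^ 2) (by positivity)
      (s := d - 1 - z.re) (by linarith)).congr_fun (fun r hr => ?_) measurableSet_Ioi
    have hr : 0 < r := hr
    simp only [norm_mul, Complex.norm_real, Real.norm_of_nonneg (Real.exp_pos _).le,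
      Complex.norm_cpow_eq_rpow_re_of_pos hr, smul_eq_mul, finrank_euclideanSpace_fin]
    rw [mul_pow, ← Real.exp_nat_mul, ← Real.rpow_natCast (r ^ _) 2, ← Real.rpow_mul hr.le,
      ← Real.rpow_natCast r (d - 1), ← mul_assoc, ← Real.rpow_add hr, Nat.cast_sub hd]
    congr 2
    · simp
      ring
    · push_cast
      ring)
  exact h1

/-- Homogeneity of the power produces `e^{zt}`, and the Gaussian exponents add up since `|η|² +
e^{4t}|η|²(1 - e^{-4t}) = e^{4t}|η|²`. -/
theorem adjointEigenfunction_mul (z : ℂ) (t : ℝ) (η : EuclideanSpace ℝ (Fin d)) :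
    adjointEigenfunction z η * gaussWeight t (Real.exp (2 * t) • η) =
      Complex.exp (z * (t : ℂ)) * adjointEigenfunction z (Real.exp (2 * t) • η) := by
  have h1 : ((Real.exp (2 * t) : ℝ) : ℂ) ^ (-z / 2) = Complex.exp (-(z * (t : ℂ))) := by
    rw [Complex.cpow_def_of_ne_zero (by exact_mod_cast (Real.exp_pos _).ne'),
      ← Complex.ofReal_log (Real.exp_pos _).le, Real.log_exp]
    congr 1
    push_cast
    ring
  have h2 : Real.exp (2 * t) ^ 2 * Real.exp (-4 * t) = 1 := by
    rw [← Real.exp_nat_mul, ← Real.exp_add]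
    simp
    ring
  rw [adjointEigenfunction, adjointEigenfunction, gaussWeight, norm_smul,
    Real.norm_of_nonneg (Real.exp_pos _).le, Complex.ofReal_mul,
    Complex.mul_cpow_ofReal_nonneg (Real.exp_pos _).le (norm_nonneg _), h1, mul_assoc,
    ← Complex.ofReal_mul, ← Real.exp_add, ← mul_assoc, ← mul_assoc, ← Complex.exp_add,
    add_neg_cancel, Complex.exp_zero, one_mul]
  congr 3
  linear_combination (Real.pi ^ 2 * ‖η‖ ^ 2) * h2

/-- Substituting `e^{2t}η` gives the Jacobian `e^{-2dt}`, which cancels the prefactor of the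
semigroup. -/
theorem integral_adjointEigenfunction_mul_fourierOU (z : ℂ) (t : ℝ≥0) (f : L2Space d) :
    ∫ η, adjointEigenfunction z η * fourierOU d t f η =
      Complex.exp (z * ((t : ℝ) : ℂ)) * ∫ η, adjointEigenfunction z η * f η := by
  set G : EuclideanSpace ℝ (Fin d) → ℂ := fun η => ((Real.exp (2 * d * t) : ℝ) : ℂ) *
    (Complex.exp (z * ((t : ℝ) : ℂ)) * (adjointEigenfunction z η * f η)) with hG
  have h1 : ∀ᵐ η, adjointEigenfunction z η * fourierOU d t f η =
      G (Real.exp (2 * (t : ℝ)) • η) := by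
    filter_upwards [coeFn_fourierOU t f] with η h
    rw [h, ← exp_mul_gaussWeight]
    have := adjointEigenfunction_mul z t η
    linear_combination ((Real.exp (2 * d * t) : ℝ) : ℂ) * f (Real.exp (2 * (t : ℝ)) • η) * this
  rw [integral_congr_ae h1, Measure.integral_comp_smul volume G, finrank_euclideanSpace_fin,
    hG, integral_const_mul, integral_const_mul, abs_of_pos (by positivity), Complex.real_smul,
    ← mul_assoc, ← Complex.ofReal_mul]
  have h2 : (Real.exp (2 * (t : ℝ)) ^ d)⁻¹ * Real.exp (2 * d * t) = 1 := by
    rw [← Real.exp_nat_mul, ← Real.exp_neg, ← Real.exp_add, Real.exp_eq_one_iff]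
    ring
  rw [h2, Complex.ofReal_one, one_mul]

/-- For `Re z < d`, the range of `z - A` is not everything, `A` the generator of `fourierOU`. -/
theorem not_surjective_fourierOU (hd : 1 ≤ d) {z : ℂ} (hz : z.re < d) :
    ¬ ∀ w : L2Space d, ∃ x y, GenPair (fourierOU d) x y ∧ z • x - y = w := by
  intro hsurj
  set φ : EuclideanSpace ℝ (Fin d) → ℂ := adjointEigenfunction z with hφdef
  have hφ : MemLp φ 2 volume := memLp_adjointEigenfunction hd hz
  set ℓ : L2Space d →L[ℂ] ℂ := (ContinuousLinearMap.mul ℂ ℂ).lpPairing volume 2 2 (hφ.toLp φ)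
  have hℓ : ∀ f, ℓ f = ∫ η, φ η * f η := by
    intro f
    rw [ContinuousLinearMap.lpPairing_eq_integral]
    refine integral_congr_ae ?_
    filter_upwards [hφ.coeFn_toLp] with η h
    rw [h]
    rfl
  have hℓT : ∀ (t : ℝ≥0) f, ℓ (fourierOU d t f) = Complex.exp (z * ((t : ℝ) : ℂ)) * ℓ f := by
    intro t f
    rw [hℓ, hℓ, integral_adjointEigenfunction_mul_fourierOU]
  -- Differentiating `ℓ(S(t)x) = e^{zt} ℓ(x)` at `0` shows that `ℓ` vanishes on the range of `z -
  -- A`, hence everywhere if that range is full.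
  have hzero : ∀ w, ℓ w = 0 := by
    intro w
    obtain ⟨x, y, hxy, rfl⟩ := hsurj w
    have h1 := (ℓ.continuous.tendsto y).comp hxy
    have h2 := (tendsto_exp_sub_one_div z).mul_const (ℓ x)
    have h3 : ℓ y = z * ℓ x := by
      refine tendsto_nhds_unique (h1.congr fun t => ?_) h2
      simp only [Function.comp, map_smul, map_sub, hℓT, smul_eq_mul]
      ring
    rw [map_sub, map_smul, h3, smul_eq_mul, sub_self]
  -- Testing on the conjugate of `φ` gives `‖φ‖² = 0`, although `φ` vanishes at most at the origin.
  have hstar : MemLp (fun η => (starRingEnd ℂ) (φ η)) 2 volume := hφ.star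
  have h1 := hzero (hstar.toLp _)
  rw [hℓ] at h1
  have h2 : ∫ η, φ η * hstar.toLp _ η = ((∫ η, ‖φ η‖ ^ 2 : ℝ) : ℂ) := by
    rw [← integral_complex_ofReal]
    refine integral_congr_ae ?_
    filter_upwards [hstar.coeFn_toLp] with η h
    rw [h, Complex.mul_conj, Complex.normSq_eq_norm_sq]
  rw [h2, Complex.ofReal_eq_zero, integral_eq_zero_iff_of_nonneg (fun _ => by positivity)
    ((memLp_two_iff_integrable_sq_norm hφ.1).1 hφ)] at h1
  have : Nonempty (Fin d) := ⟨⟨0, hd⟩⟩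
  obtain ⟨v, hv⟩ := exists_ne (0 : EuclideanSpace ℝ (Fin d))
  have h3 : 0 < volume ({0}ᶜ : Set (EuclideanSpace ℝ (Fin d))) :=
    isOpen_compl_singleton.measure_pos volume ⟨v, hv⟩
  refine h3.ne' (measure_mono_null ?_ (ae_iff.1 h1))
  intro η hη h0
  have hη' : η ≠ 0 := hη
  have h4 : φ η = 0 := by simpa using h0
  rw [hφdef, adjointEigenfunction, mul_eq_zero] at h4
  rcases h4 with h4 | h4
  · rw [Complex.cpow_eq_zero_iff] at h4
    exact hη' (norm_eq_zero.1 (by exact_mod_cast h4.1))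
  · exact (Real.exp_pos _).ne' (by exact_mod_cast h4)

end OUSemigroup

/-! ### Conjugation by an isometry -/

section Conjugation

variable {X Y : Type*} [NormedAddCommGroup X] [NormedSpace ℂ X] [NormedAddCommGroup Y]
  [NormedSpace ℂ Y]

/-- Conjugation of a family of operators by an isometry. -/
def conjFamily (e : X ≃ₗᵢ[ℂ] Y) (S : ℝ≥0 → Y →L[ℂ] Y) (t : ℝ≥0) : X →L[ℂ] X :=
  (e.symm.toContinuousLinearEquiv : Y →L[ℂ] X).comp
    ((S t).comp (e.toContinuousLinearEquiv : X →L[ℂ] Y))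

theorem conjFamily_apply (e : X ≃ₗᵢ[ℂ] Y) (S : ℝ≥0 → Y →L[ℂ] Y) (t : ℝ≥0) (x : X) :
    conjFamily e S t x = e.symm (S t (e x)) := rfl

theorem IsC0Semigroup.conjFamily {S : ℝ≥0 → Y →L[ℂ] Y} (hS : IsC0Semigroup S)
    (e : X ≃ₗᵢ[ℂ] Y) : IsC0Semigroup (conjFamily e S) where
  map_zero := by
    ext x
    simp [conjFamily_apply, hS.apply_zero]
  map_add s t := by
    ext x
    simp [conjFamily_apply, hS.apply_add]
  strongly_continuous x := e.symm.continuous.comp (hS.strongly_continuous (e x))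

theorem norm_conjFamily_le (e : X ≃ₗᵢ[ℂ] Y) (S : ℝ≥0 → Y →L[ℂ] Y) (t : ℝ≥0) :
    ‖conjFamily e S t‖ ≤ ‖S t‖ := by
  refine ContinuousLinearMap.opNorm_le_bound _ (norm_nonneg _) fun x => ?_
  rw [conjFamily_apply, e.symm.norm_map]
  simpa using (S t).le_opNorm (e x)

theorem genPair_conjFamily_iff (e : X ≃ₗᵢ[ℂ] Y) (S : ℝ≥0 → Y →L[ℂ] Y) (x y : X) :
    GenPair (conjFamily e S) x y ↔ GenPair S (e x) (e y) := by
  have h1 : (fun t : ℝ≥0 => ((t : ℝ) : ℂ)⁻¹ • (S t (e x) - e x)) =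
      e ∘ fun t : ℝ≥0 => ((t : ℝ) : ℂ)⁻¹ • (conjFamily e S t x - x) := by
    funext t
    simp [conjFamily_apply]
  rw [GenPair, GenPair, h1]
  exact e.toHomeomorph.isInducing.tendsto_nhds_iff

end Conjugation

/-! ### A criterion for cores -/

section Core

variable {X : Type*} [NormedAddCommGroup X] [NormedSpace ℂ X] [CompleteSpace X]
  {S : ℝ≥0 → X →L[ℂ] X}

/-- Above the growth bound, the generator satisfies a resolvent estimate. -/
theorem IsC0Semigroup.exists_norm_le_of_genPair (hS : IsC0Semigroup S) {γ : ℝ}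
    (hγ : ∀ t : ℝ≥0, ‖S t‖ ≤ Real.exp (γ * t)) {κ : ℝ} (hκ : γ < κ) :
    ∃ M : ℝ, ∀ x y, GenPair S x y → ‖x‖ ≤ M * ‖(κ : ℂ) • x - y‖ := by
  have hU := IsC0Semigroup.expRescale hS (κ : ℂ)
  set q := Real.exp (γ - κ) with hq
  have hq1 : q < 1 := Real.exp_lt_one_iff.2 (by linarith)
  have hq2 : 0 < 1 - q := by linarith
  refine ⟨‖hU.integralL 1‖ / (1 - q), fun x y hxy => ?_⟩
  -- The rescaled semigroup contracts by `q < 1` at time `1`, so `(1 - q)‖x‖` is at most the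
  -- displacement of `x`, which is an integral of the orbit of `y - κx`.
  have h1 := hU.integralL_of_genPair 1 (hxy.expRescale (κ : ℂ))
  have h2 : ‖_root_.expRescale (κ : ℂ) S 1 x‖ ≤ q * ‖x‖ := by
    rw [expRescale_apply, norm_smul, Complex.norm_exp]
    have h3 := (S 1).le_of_opNorm_le (hγ 1) x
    rw [NNReal.coe_one, mul_one] at h3
    calc _ ≤ Real.exp (-κ) * (Real.exp γ * ‖x‖) := by
          gcongr
          simp
      _ = q * ‖x‖ := by rw [hq, ← mul_assoc, ← Real.exp_add]; ring_nf
  have h3 := (hU.integralL 1).le_opNorm (y - (κ : ℂ) • x)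
  rw [h1, norm_sub_rev y] at h3
  have h4 : ‖x‖ ≤ ‖_root_.expRescale (κ : ℂ) S 1 x‖ +
      ‖_root_.expRescale (κ : ℂ) S 1 x - x‖ := norm_le_insert _ _
  rw [div_mul_eq_mul_div, le_div_iff₀ hq2]
  linarith

/-- A set of pairs in the generator whose image under `κ - A` is dense is a core. -/
theorem IsC0Semigroup.mem_closure_of_dense (hS : IsC0Semigroup S) {γ : ℝ}
    (hγ : ∀ t : ℝ≥0, ‖S t‖ ≤ Real.exp (γ * t)) {κ : ℝ} (hκ : γ < κ) {P : Set (X × X)}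
    (hP : ∀ p ∈ P, GenPair S p.1 p.2)
    (hdense : Dense ((fun p : X × X => (κ : ℂ) • p.1 - p.2) '' P)) {x y : X}
    (hxy : GenPair S x y) : (x, y) ∈ closure P := by
  obtain ⟨M, hM⟩ := hS.exists_norm_le_of_genPair hγ hκ
  obtain ⟨z, hz, hzlim⟩ := mem_closure_iff_seq_limit.1 (hdense ((κ : ℂ) • x - y))
  choose p hp hpz using hz
  refine mem_closure_iff_seq_limit.2 ⟨p, hp, ?_⟩
  have h1 : Tendsto (fun n => (p n).1) atTop (𝓝 x) := by
    rw [tendsto_iff_norm_sub_tendsto_zero] at hzlim ⊢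
    have hlim := hzlim.const_mul M
    rw [mul_zero] at hlim
    refine squeeze_zero (fun _ => norm_nonneg _) (fun n => ?_) hlim
    have h2 := hM _ _ ((hP _ (hp n)).sub hxy)
    refine h2.trans (le_of_eq ?_)
    rw [← hpz n]
    have h3 : (κ : ℂ) • ((p n).1 - x) - ((p n).2 - y) =
        (κ : ℂ) • (p n).1 - (p n).2 - ((κ : ℂ) • x - y) := by
      rw [smul_sub]
      abel
    rw [h3]
  have h2 : Tendsto (fun n => (p n).2) atTop (𝓝 y) := by
    have h3 := (h1.const_smul (κ : ℂ)).sub hzlim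
    rw [sub_sub_cancel] at h3
    refine h3.congr fun n => ?_
    rw [← hpz n]
    simp
  exact h1.prodMk_nhds h2

end Core

/-! ### The generator on the Fourier side and its Schwartz core -/

section FourierGenerator

open Laplacian LineDeriv

variable {d : ℕ}

theorem hasTemperateGrowth_inner_left (m : EuclideanSpace ℝ (Fin d)) :
    (fun x : EuclideanSpace ℝ (Fin d) => inner ℝ x m).HasTemperateGrowth := by
  fun_prop

theorem hasTemperateGrowth_norm_sq :
    (fun x : EuclideanSpace ℝ (Fin d) => ‖x‖ ^ 2).HasTemperateGrowth := by
  fun_prop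

/-- The operator `f ↦ (2d - 4π²|ξ|²) f + 2 ξ·∇f` on Schwartz functions. -/
def fourierGen (f : 𝓢(EuclideanSpace ℝ (Fin d), ℂ)) : 𝓢(EuclideanSpace ℝ (Fin d), ℂ) :=
  (2 * d : ℝ) • f - (2 * Real.pi) ^ 2 • SchwartzMap.smulLeftCLM ℂ
      (fun x : EuclideanSpace ℝ (Fin d) => ‖x‖ ^ 2) f +
    (2 : ℝ) • ∑ i, SchwartzMap.smulLeftCLM ℂ
      (fun x : EuclideanSpace ℝ (Fin d) => inner ℝ x (EuclideanSpace.basisFun (Fin d) ℝ i))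
      (∂_{EuclideanSpace.basisFun (Fin d) ℝ i} f)

theorem sum_inner_smul_apply_basis (x : EuclideanSpace ℝ (Fin d)) (L : EuclideanSpace ℝ (Fin d) →L[ℝ] ℂ) :
    ∑ i, (inner ℝ x (EuclideanSpace.basisFun (Fin d) ℝ i)) •
      L (EuclideanSpace.basisFun (Fin d) ℝ i) = L x := by
  conv_rhs => rw [← (EuclideanSpace.basisFun (Fin d) ℝ).sum_repr' x, map_sum]
  simp only [map_smul, real_inner_comm]

theorem fourierGen_apply (f : 𝓢(EuclideanSpace ℝ (Fin d), ℂ)) (ξ : EuclideanSpace ℝ (Fin d)) :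
    fourierGen f ξ = (2 * d - (2 * Real.pi) ^ 2 * ‖ξ‖ ^ 2 : ℝ) * f ξ + 2 * fderiv ℝ f ξ ξ := by
  have h := sum_inner_smul_apply_basis ξ (fderiv ℝ f ξ)
  simp only [fourierGen, add_apply, sub_apply, smul_apply,
    sum_apply, SchwartzMap.smulLeftCLM_apply_apply hasTemperateGrowth_norm_sq,
    SchwartzMap.smulLeftCLM_apply_apply (hasTemperateGrowth_inner_left _),
    SchwartzMap.lineDerivOp_apply_eq_fderiv, h]
  simp only [Complex.real_smul]
  push_cast
  ring

theorem fourierGen_add (f g : 𝓢(EuclideanSpace ℝ (Fin d), ℂ)) :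
    fourierGen (f + g) = fourierGen f + fourierGen g := by
  ext ξ
  rw [add_apply, fourierGen_apply, fourierGen_apply, fourierGen_apply,
    show ⇑(f + g) = ⇑f + ⇑g from rfl, fderiv_add f.differentiableAt g.differentiableAt]
  simp only [Pi.add_apply, add_apply]
  ring

theorem fourierGen_smul (c : ℂ) (f : 𝓢(EuclideanSpace ℝ (Fin d), ℂ)) :
    fourierGen (c • f) = c • fourierGen f := by
  ext ξ
  rw [smul_apply, fourierGen_apply, fourierGen_apply,
    show ⇑(c • f) = c • ⇑f from rfl, fderiv_const_smul f.differentiableAt]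
  simp only [Pi.smul_apply, smul_apply, smul_eq_mul]
  ring

/-- The pointwise time derivative is the orbit of `fourierGen f`, so a decay bound on `fourierGen f`
dominates the difference quotients for times in `[0, 1]`. -/
theorem hasDerivAt_ouSymbol_mul (f : 𝓢(EuclideanSpace ℝ (Fin d), ℂ))
    (ξ : EuclideanSpace ℝ (Fin d)) (t : ℝ) :
    HasDerivAt (fun t : ℝ => (ouSymbol t ξ : ℂ) * f (Real.exp (2 * t) • ξ))
      ((ouSymbol t ξ : ℂ) * fourierGen f (Real.exp (2 * t) • ξ)) t := by
  have h1 : HasDerivAt (fun t : ℝ => ouSymbol t ξ)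
      (ouSymbol t ξ * (2 * d - (2 * Real.pi) ^ 2 * ‖ξ‖ ^ 2 * Real.exp (4 * t))) t := by
    have h2 : HasDerivAt (fun t : ℝ => 2 * d * t - Real.pi ^ 2 * ‖ξ‖ ^ 2 * (Real.exp (4 * t) - 1))
        (2 * d - (2 * Real.pi) ^ 2 * ‖ξ‖ ^ 2 * Real.exp (4 * t)) t := by
      have := ((hasDerivAt_id t).const_mul (2 * d : ℝ)).sub
        (((((hasDerivAt_id t).const_mul (4 : ℝ)).exp).sub_const 1).const_mul
          (Real.pi ^ 2 * ‖ξ‖ ^ 2))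
      refine this.congr_deriv ?_
      simp only [id]
      ring
    exact h2.exp
  have h3 : HasDerivAt (fun t : ℝ => Real.exp (2 * t) • ξ) ((2 * Real.exp (2 * t)) • ξ) t := by
    have := (((hasDerivAt_id t).const_mul (2 : ℝ)).exp).smul_const ξ
    refine this.congr_deriv ?_
    simp [mul_comm]
  have h4 := (f.hasFDerivAt (Real.exp (2 * t) • ξ)).comp_hasDerivAt t h3
  refine (h1.ofReal_comp.mul h4).congr_deriv ?_
  have h2 : Real.exp (2 * t) ^ 2 = Real.exp (4 * t) := by
    rw [← Real.exp_nat_mul]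
    congr 1
    push_cast
    ring
  rw [fourierGen_apply, norm_smul, Real.norm_of_nonneg (Real.exp_pos _).le,
    mul_pow (Real.exp _), h2, mul_smul,
    map_smul]
  simp only [Complex.real_smul, Function.comp]
  push_cast
  ring

theorem genPair_fourierOU_toLp (f : 𝓢(EuclideanSpace ℝ (Fin d), ℂ)) :
    GenPair (fourierOU d) (f.toLp 2 volume) ((fourierGen f).toLp 2 volume) := by
  obtain ⟨C, hC0, hC⟩ := SchwartzMap.exists_norm_le_decayBound (fourierGen f)
  have hE : 1 ≤ Real.exp (2 * d * 1) := Real.one_le_exp (by positivity)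
  refine tendsto_lp_two_of_dominated (l := 𝓝[>] (0 : ℝ≥0))
    (F := fun (t : ℝ≥0) ξ => ((t : ℝ) : ℂ)⁻¹ *
      ((ouSymbol (t : ℝ) ξ : ℂ) * f (Real.exp (2 * (t : ℝ)) • ξ) - f ξ))
    (f := fourierGen f) (bound := fun ξ => Real.exp (2 * d * 1) * C * decayBound d ξ)
    (Eventually.of_forall fun t => ?_) ((fourierGen f).coeFn_toLp 2 volume)
    (memLp_decayBound.const_mul _) ?_ (Eventually.of_forall fun ξ => ?_)
    (Eventually.of_forall fun ξ => ?_)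
  · filter_upwards [Lp.coeFn_smul (((t : ℝ) : ℂ)⁻¹) (fourierOU d t (f.toLp 2 volume) -
        f.toLp 2 volume), Lp.coeFn_sub (fourierOU d t (f.toLp 2 volume)) (f.toLp 2 volume),
      coeFn_fourierOU_toLp t f, f.coeFn_toLp 2 volume] with ξ h1 h2 h3 h4
    rw [h1, Pi.smul_apply, h2, Pi.sub_apply, h3, h4, smul_eq_mul]
  · have h1 : ∀ᶠ t : ℝ≥0 in 𝓝[>] 0, t < 1 := nhdsWithin_le_nhds (gt_mem_nhds one_pos)
    filter_upwards [h1, self_mem_nhdsWithin] with t ht1 ht0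
    have ht0' : (0 : ℝ) < t := NNReal.coe_pos.2 ht0
    have ht1' : (t : ℝ) ≤ 1 := by exact_mod_cast ht1.le
    refine Eventually.of_forall fun ξ => ?_
    have h2 := (convex_Icc (0 : ℝ) 1).norm_image_sub_le_of_norm_hasDerivWithin_le
      (f := fun t : ℝ => (ouSymbol t ξ : ℂ) * f (Real.exp (2 * t) • ξ))
      (f' := fun t : ℝ => (ouSymbol t ξ : ℂ) * fourierGen f (Real.exp (2 * t) • ξ))
      (C := Real.exp (2 * d * 1) * C * decayBound d ξ) (x := 0) (y := (t : ℝ))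
      (fun s _ => (hasDerivAt_ouSymbol_mul f ξ s).hasDerivWithinAt)
      (fun s hs => norm_ouSymbol_mul_le hs.1 hs.2 hC0 hC ξ) ⟨le_rfl, zero_le_one⟩
      ⟨ht0'.le, ht1'⟩
    have h3 : (ouSymbol 0 ξ : ℂ) * f (Real.exp (2 * 0) • ξ) = f ξ := by simp [ouSymbol]
    simp only [h3, sub_zero] at h2
    rw [Real.norm_of_nonneg ht0'.le] at h2
    rw [norm_mul, norm_inv, Complex.norm_real, Real.norm_of_nonneg ht0'.le,
      inv_mul_le_iff₀ ht0', mul_comm (t : ℝ)]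
    exact h2
  · refine (hC ξ).trans (mul_le_mul_of_nonneg_right ?_ (decayBound_nonneg ξ))
    exact le_mul_of_one_le_left hC0 hE
  · have hd := hasDerivAt_ouSymbol_mul f ξ 0
    have h3 : (ouSymbol 0 ξ : ℂ) = 1 := by simp [ouSymbol]
    rw [hasDerivAt_iff_tendsto_slope] at hd
    have h2 := (hd.mono_left (nhdsWithin_mono 0
      (fun t (ht : t ∈ Ioi (0 : ℝ)) => ne_of_gt ht))).comp tendsto_coe_nhdsGT_zero
    simp only [h3, mul_zero, Real.exp_zero, one_smul, one_mul] at h2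
    refine h2.congr fun t => ?_
    simp [slope, h3]

/-- Smooth functions with compact support are invariant under `fourierOU`. -/
theorem exists_fourierOU_toLp_eq {f : 𝓢(EuclideanSpace ℝ (Fin d), ℂ)} (hf : HasCompactSupport f)
    (t : ℝ≥0) : ∃ g : 𝓢(EuclideanSpace ℝ (Fin d), ℂ),
      fourierOU d t (f.toLp 2 volume) = g.toLp 2 volume := by
  set F : EuclideanSpace ℝ (Fin d) → ℂ :=
    fun ξ => (ouSymbol (t : ℝ) ξ : ℂ) * f (Real.exp (2 * (t : ℝ)) • ξ) with hF
  have h1 : HasCompactSupport F :=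
    (hf.comp_homeomorph (Homeomorph.smulOfNeZero _ (Real.exp_pos (2 * (t : ℝ))).ne')).mul_left
  have h2 : ContDiff ℝ ∞ F := by
    have h3 : ContDiff ℝ ∞ f := f.smooth ⊤
    have h4 : ContDiff ℝ ∞ (ouSymbol (d := d) (t : ℝ)) := by
      have h5 : ContDiff ℝ ∞ fun ξ : EuclideanSpace ℝ (Fin d) => ‖ξ‖ ^ 2 := contDiff_norm_sq ℝ
      unfold ouSymbol
      exact Real.contDiff_exp.comp (contDiff_const.sub ((contDiff_const.mul h5).mul contDiff_const))
    have h5 : ContDiff ℝ ∞ fun ξ => (ouSymbol (d := d) (t : ℝ) ξ : ℂ) :=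
      Complex.ofRealCLM.contDiff.comp h4
    exact h5.mul (h3.comp (contDiff_const_smul _))
  refine ⟨h1.toSchwartzMap h2, Lp.ext ?_⟩
  filter_upwards [coeFn_fourierOU_toLp t f, (h1.toSchwartzMap h2).coeFn_toLp 2 volume]
    with ξ h3 h4
  rw [h3, h4]
  rfl

/-- The range of `κ - fourierGen`, as a subspace of `L²`. -/
def rangeSubFourierGen (d : ℕ) (κ : ℂ) : Submodule ℂ (L2Space d) where
  carrier := {w | ∃ f : 𝓢(EuclideanSpace ℝ (Fin d), ℂ),
    w = κ • f.toLp 2 volume - (fourierGen f).toLp 2 volume}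
  zero_mem' := by
    refine ⟨0, ?_⟩
    have h : ∀ f : 𝓢(EuclideanSpace ℝ (Fin d), ℂ),
        (f.toLp 2 volume : L2Space d) = SchwartzMap.toLpCLM ℂ ℂ 2 volume f := fun _ => rfl
    have h1 := fourierGen_smul (0 : ℂ) (0 : 𝓢(EuclideanSpace ℝ (Fin d), ℂ))
    rw [zero_smul, zero_smul] at h1
    rw [h1, h, map_zero, smul_zero, sub_zero]
  add_mem' := by
    rintro _ _ ⟨f, rfl⟩ ⟨g, rfl⟩
    refine ⟨f + g, ?_⟩
    have h : ∀ f : 𝓢(EuclideanSpace ℝ (Fin d), ℂ),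
        (f.toLp 2 volume : L2Space d) = SchwartzMap.toLpCLM ℂ ℂ 2 volume f := fun _ => rfl
    rw [fourierGen_add]
    simp only [h, map_add, smul_add]
    abel
  smul_mem' := by
    rintro c _ ⟨f, rfl⟩
    refine ⟨c • f, ?_⟩
    have h : ∀ f : 𝓢(EuclideanSpace ℝ (Fin d), ℂ),
        (f.toLp 2 volume : L2Space d) = SchwartzMap.toLpCLM ℂ ℂ 2 volume f := fun _ => rfl
    rw [fourierGen_smul]
    simp only [h, map_smul, smul_sub, smul_comm κ c]

/-- Let `w` be orthogonal to the range and `f` a test function. The orbit of `f` stays Schwartz, so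
the derivative of `⟨w, e^{-κt} S(t) f⟩` vanishes. This constant tends to `0` because `κ > d`, so
`⟨w, f⟩ = 0`. -/
theorem dense_rangeSubFourierGen {κ : ℝ} (hκ : d < κ) :
    Dense (rangeSubFourierGen d κ : Set (L2Space d)) := by
  have hS := isC0Semigroup_fourierOU d
  rw [Submodule.dense_iff_topologicalClosure_eq_top, Submodule.topologicalClosure_eq_top_iff,
    Submodule.eq_bot_iff]
  intro w hw
  have hU := IsC0Semigroup.expRescale hS (κ : ℂ)
  have key : ∀ f : 𝓢(EuclideanSpace ℝ (Fin d), ℂ), HasCompactSupport f →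
      inner ℂ w (f.toLp 2 volume : L2Space d) = 0 := by
    intro f hf
    have hgen := genPair_fourierOU_toLp f
    have h1 : ∀ s : ℝ≥0, inner ℂ w (_root_.expRescale (κ : ℂ) (fourierOU d) s
        ((fourierGen f).toLp 2 volume - (κ : ℂ) • f.toLp 2 volume)) = 0 := by
      intro s
      obtain ⟨g, hg⟩ := exists_fourierOU_toLp_eq hf s
      have h2 := hS.genPair_apply hgen s
      rw [hg] at h2
      have h3 := h2.unique (genPair_fourierOU_toLp g)
      rw [expRescale_apply, map_sub, map_smul, h3, hg, inner_smul_right,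
        ← neg_sub ((κ : ℂ) • _), inner_neg_right, Submodule.inner_left_of_mem_orthogonal
          (K := rangeSubFourierGen d κ) ⟨g, rfl⟩ hw, neg_zero, mul_zero]
    have h2 : ∀ t : ℝ≥0, inner ℂ w (f.toLp 2 volume : L2Space d) =
        inner ℂ w (_root_.expRescale (κ : ℂ) (fourierOU d) t (f.toLp 2 volume)) := by
      intro t
      have h3 := hU.integral_of_genPair (hgen.expRescale (κ : ℂ)) t
      have h4 : inner ℂ w (_root_.expRescale (κ : ℂ) (fourierOU d) t (f.toLp 2 volume) -
          f.toLp 2 volume) = 0 := by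
        have h5 := ContinuousLinearMap.intervalIntegral_comp_comm (innerSL ℂ w)
          (hU.intervalIntegrable_orbit ((fourierGen f).toLp 2 volume -
            (κ : ℂ) • f.toLp 2 volume) 0 t)
        simp only [innerSL_apply_apply, h1, intervalIntegral.integral_zero] at h5
        rw [h3]
        exact h5.symm
      rw [inner_sub_right, sub_eq_zero] at h4
      exact h4.symm
    have h5 : Tendsto (fun t : ℝ≥0 => ‖w‖ * (Real.exp ((d - κ) * t) *
        ‖(f.toLp 2 volume : L2Space d)‖)) atTop (𝓝 0) := by
      have h3 : Tendsto (fun t : ℝ≥0 => (d - κ) * (t : ℝ)) atTop atBot :=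
        (NNReal.tendsto_coe_atTop.2 tendsto_id).const_mul_atTop_of_neg (by linarith)
      simpa using ((Real.tendsto_exp_atBot.comp h3).mul_const
        ‖(f.toLp 2 volume : L2Space d)‖).const_mul ‖w‖
    refine norm_le_zero_iff.1 (ge_of_tendsto' h5 fun t => ?_)
    rw [h2 t]
    refine (norm_inner_le_norm _ _).trans (mul_le_mul_of_nonneg_left ?_ (norm_nonneg _))
    rw [expRescale_apply, norm_smul, Complex.norm_exp, sub_mul, sub_eq_neg_add, Real.exp_add,
      mul_assoc]
    have h6 : (-(κ : ℂ) * ((t : ℝ) : ℂ)).re = -(κ * t) := by simp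
    rw [h6]
    exact mul_le_mul_of_nonneg_left ((fourierOU d t).le_of_opNorm_le (norm_fourierOU_le t) _)
      (Real.exp_pos _).le
  have hd2 := MeasureTheory.Lp.dense_hasCompactSupport_contDiff (F := ℂ) (p := 2)
    (μ := (volume : Measure (EuclideanSpace ℝ (Fin d)))) (by norm_num)
  refine hd2.eq_zero_of_inner_left ℂ fun v hv => ?_
  obtain ⟨g, hg, hg1, hg2⟩ := hv
  have h7 : v = (hg1.toSchwartzMap hg2).toLp 2 volume := by
    refine Lp.ext (hg.trans ?_)
    exact ((hg1.toSchwartzMap hg2).coeFn_toLp 2 volume).symm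
  rw [h7]
  exact key _ hg1

theorem mem_closure_of_genPair_fourierOU {x y : L2Space d} (h : GenPair (fourierOU d) x y) :
    (x, y) ∈ closure (range fun f : 𝓢(EuclideanSpace ℝ (Fin d), ℂ) =>
      ((f.toLp 2 volume : L2Space d), ((fourierGen f).toLp 2 volume : L2Space d))) := by
  refine (isC0Semigroup_fourierOU d).mem_closure_of_dense norm_fourierOU_le
    (lt_add_one (d : ℝ)) ?_ ?_ h
  · rintro _ ⟨f, rfl⟩
    exact genPair_fourierOU_toLp f
  · refine (dense_rangeSubFourierGen (lt_add_one (d : ℝ))).mono ?_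
    rintro _ ⟨f, rfl⟩
    exact ⟨_, ⟨f, rfl⟩, rfl⟩

end FourierGenerator

/-! ### Back to physical space: Schwartz functions as a core -/

section Schwartz

open Laplacian LineDeriv FourierTransform

variable {d : ℕ}

/-- The operator `w ↦ Δw - 2 x·∇w` on Schwartz functions. -/
def ouSchwartz (w : 𝓢(EuclideanSpace ℝ (Fin d), ℂ)) : 𝓢(EuclideanSpace ℝ (Fin d), ℂ) :=
  Δ w - (2 : ℝ) • ∑ i, SchwartzMap.smulLeftCLM ℂ
      (fun x : EuclideanSpace ℝ (Fin d) => inner ℝ x (EuclideanSpace.basisFun (Fin d) ℝ i))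
      (∂_{EuclideanSpace.basisFun (Fin d) ℝ i} w)

theorem ouSchwartz_apply (w : 𝓢(EuclideanSpace ℝ (Fin d), ℂ)) (x : EuclideanSpace ℝ (Fin d)) :
    ouSchwartz w x = ouExpr 0 w x := by
  have h := sum_inner_smul_apply_basis x (fderiv ℝ w x)
  simp only [ouSchwartz, sub_apply, smul_apply, sum_apply,
    SchwartzMap.smulLeftCLM_apply_apply (hasTemperateGrowth_inner_left _),
    SchwartzMap.lineDerivOp_apply_eq_fderiv, h, ouExpr, SchwartzMap.laplacian_apply]
  simp [Complex.real_smul]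

/-- Multiplication by `x_i` and `∂_i` exchange roles, so `x_i ∂_i` becomes `-∂_i ξ_i = -1 - ξ_i
∂_i`. Summed over `i` and multiplied by `-2`, this is the source of the constant `2d`. -/
theorem fourier_smulLeftCLM_lineDerivOp (w : 𝓢(EuclideanSpace ℝ (Fin d), ℂ))
    (i : Fin d) :
    𝓕 (SchwartzMap.smulLeftCLM ℂ
      (fun x : EuclideanSpace ℝ (Fin d) => inner ℝ x (EuclideanSpace.basisFun (Fin d) ℝ i))
      (∂_{EuclideanSpace.basisFun (Fin d) ℝ i} w)) =
    -(𝓕 w) - SchwartzMap.smulLeftCLM ℂ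
      (fun x : EuclideanSpace ℝ (Fin d) => inner ℝ x (EuclideanSpace.basisFun (Fin d) ℝ i))
      (∂_{EuclideanSpace.basisFun (Fin d) ℝ i} (𝓕 w)) := by
  set e := EuclideanSpace.basisFun (Fin d) ℝ i with he
  have hee : inner ℝ e e = (1 : ℝ) := by simp [he]
  have hne : (2 * Real.pi * Complex.I : ℂ) ≠ 0 := by simp [Real.pi_ne_zero]
  have h1 := SchwartzMap.lineDerivOp_fourier_eq (∂_{e} w) e
  rw [SchwartzMap.fourier_lineDerivOp_eq] at h1
  have h2 : ∂_{e} (SchwartzMap.smulLeftCLM ℂ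
      (fun x : EuclideanSpace ℝ (Fin d) => inner ℝ x e) (𝓕 w)) =
      𝓕 w + SchwartzMap.smulLeftCLM ℂ
      (fun x : EuclideanSpace ℝ (Fin d) => inner ℝ x e) (∂_{e} (𝓕 w)) := by
    ext x
    have h3 : HasFDerivAt (fun x : EuclideanSpace ℝ (Fin d) => inner ℝ x e)
        ((innerSL ℝ).flip e) x := ((innerSL ℝ).flip e).hasFDerivAt
    have h4 : HasFDerivAt (fun x : EuclideanSpace ℝ (Fin d) => inner ℝ x e • (𝓕 w) x) _ x :=
      h3.smul ((𝓕 w).hasFDerivAt x)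
    rw [SchwartzMap.lineDerivOp_apply_eq_fderiv,
      SchwartzMap.smulLeftCLM_apply (hasTemperateGrowth_inner_left e), h4.fderiv]
    simp only [add_apply, SchwartzMap.smulLeftCLM_apply_apply (hasTemperateGrowth_inner_left e),
      SchwartzMap.lineDerivOp_apply_eq_fderiv, smul_apply, ContinuousLinearMap.smulRight_apply,
      ContinuousLinearMap.flip_apply, innerSL_apply_apply ℝ, hee, one_smul]
    rw [add_comm]
  have h5 : (2 * Real.pi * Complex.I : ℂ) • ∂_{e} (SchwartzMap.smulLeftCLM ℂ
      (fun x : EuclideanSpace ℝ (Fin d) => inner ℝ x e) (𝓕 w)) =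
      -(2 * Real.pi * Complex.I : ℂ) • 𝓕 (SchwartzMap.smulLeftCLM ℂ
      (fun x : EuclideanSpace ℝ (Fin d) => inner ℝ x e) (∂_{e} w)) := by
    rw [← lineDerivOp_smul, h1, FourierTransform.fourier_smul]
  rw [neg_smul, ← smul_neg] at h5
  have h6 := smul_right_injective _ hne h5
  rw [h2] at h6
  rw [← neg_eq_iff_eq_neg.2 h6]
  abel

theorem fourier_ouSchwartz (w : 𝓢(EuclideanSpace ℝ (Fin d), ℂ)) :
    𝓕 (ouSchwartz w) = fourierGen (𝓕 w) := by
  have h1 : 𝓕 (Δ w) = -(2 * Real.pi) ^ 2 • SchwartzMap.smulLeftCLM ℂ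
      (fun x : EuclideanSpace ℝ (Fin d) => ‖x‖ ^ 2) (𝓕 w) := by
    rw [SchwartzMap.laplacian_eq_fourierMultiplierCLM, SchwartzMap.fourierMultiplierCLM_apply,
      ← FourierTransform.fourierInv_smul, FourierTransform.fourier_fourierInv_eq]
  have h2 : ∀ (f : Fin d → 𝓢(EuclideanSpace ℝ (Fin d), ℂ)),
      𝓕 (∑ i, f i) = ∑ i, 𝓕 (f i) := fun f =>
    map_sum (FourierTransform.fourierCLM ℂ 𝓢(EuclideanSpace ℝ (Fin d), ℂ)) _ _
  have h3 : ∀ f g : 𝓢(EuclideanSpace ℝ (Fin d), ℂ), 𝓕 (f - g) = 𝓕 f - 𝓕 g :=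
    map_sub (FourierTransform.fourierCLM ℂ 𝓢(EuclideanSpace ℝ (Fin d), ℂ))
  rw [ouSchwartz, h3, h1, FourierTransform.fourier_smul, h2]
  simp only [fourier_smulLeftCLM_lineDerivOp, fourierGen, Finset.sum_sub_distrib,
    Finset.sum_const, Finset.card_univ, Fintype.card_fin]
  module

/-- The Ornstein–Uhlenbeck semigroup on `L²(ℝ^d)`, generated by `Δ - 2 x·∇`. -/
def ouSemigroup (d : ℕ) : ℝ≥0 → L2Space d →L[ℂ] L2Space d :=
  conjFamily (Lp.fourierTransformₗᵢ (EuclideanSpace ℝ (Fin d)) ℂ) (fourierOU d)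

theorem isC0Semigroup_ouSemigroup (d : ℕ) : IsC0Semigroup (ouSemigroup d) :=
  (isC0Semigroup_fourierOU d).conjFamily _

theorem norm_ouSemigroup_le (t : ℝ≥0) : ‖ouSemigroup d t‖ ≤ Real.exp (d * t) :=
  (norm_conjFamily_le _ _ _).trans (norm_fourierOU_le t)

theorem fourierTransformₗᵢ_toLp (w : 𝓢(EuclideanSpace ℝ (Fin d), ℂ)) :
    Lp.fourierTransformₗᵢ (EuclideanSpace ℝ (Fin d)) ℂ (w.toLp 2 volume) =
      (𝓕 w).toLp 2 volume :=
  SchwartzMap.toLp_fourier_eq w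

theorem genPair_ouSemigroup_toLp (w : 𝓢(EuclideanSpace ℝ (Fin d), ℂ)) :
    GenPair (ouSemigroup d) (w.toLp 2 volume) ((ouSchwartz w).toLp 2 volume) := by
  rw [ouSemigroup, genPair_conjFamily_iff, fourierTransformₗᵢ_toLp, fourierTransformₗᵢ_toLp,
    fourier_ouSchwartz]
  exact genPair_fourierOU_toLp _

/-- The graph of `Δ - 2 x·∇` on Schwartz functions. -/
def ouSchwartzGraph (d : ℕ) : Set (L2Space d × L2Space d) :=
  range fun w : 𝓢(EuclideanSpace ℝ (Fin d), ℂ) =>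
    ((w.toLp 2 volume : L2Space d), ((ouSchwartz w).toLp 2 volume : L2Space d))

theorem mem_closure_of_genPair_ouSemigroup {x y : L2Space d} (h : GenPair (ouSemigroup d) x y) :
    (x, y) ∈ closure (ouSchwartzGraph d) := by
  set e := Lp.fourierTransformₗᵢ (EuclideanSpace ℝ (Fin d)) ℂ with he
  have h1 := mem_closure_of_genPair_fourierOU ((genPair_conjFamily_iff e _ x y).1 h)
  have h2 : Continuous fun p : L2Space d × L2Space d => (e.symm p.1, e.symm p.2) :=
    (e.symm.continuous.comp continuous_fst).prodMk (e.symm.continuous.comp continuous_snd)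
  have h3 := map_mem_closure h2 h1 (t := ouSchwartzGraph d) ?_
  · simpa using h3
  · rintro _ ⟨f, rfl⟩
    have h4 : f = 𝓕 (𝓕⁻ f) := (FourierTransform.fourier_fourierInv_eq f).symm
    refine ⟨𝓕⁻ f, ?_⟩
    have h5 : fourierGen f = 𝓕 (ouSchwartz (𝓕⁻ f)) := by rw [fourier_ouSchwartz, ← h4]
    have h6 : f.toLp 2 volume = (𝓕 (𝓕⁻ f)).toLp 2 volume := by rw [← h4]
    simp only [h5]
    rw [h6]
    simp only [← fourierTransformₗᵢ_toLp, ← he, LinearIsometryEquiv.symm_apply_apply]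

theorem closure_ouSchwartzGraph :
    closure (ouSchwartzGraph d) = {p | GenPair (ouSemigroup d) p.1 p.2} := by
  refine Subset.antisymm (closure_minimal ?_ (isC0Semigroup_ouSemigroup d).isClosed_genPair)
    fun p hp => mem_closure_of_genPair_ouSemigroup hp
  rintro _ ⟨w, rfl⟩
  exact genPair_ouSemigroup_toLp w

/-- The potential term is itself in `L²`, so the domain does not depend on the bounded potential. -/
theorem memLp_ouExpr {V : ℝ → ℂ} (hV : MemLp (fun x : EuclideanSpace ℝ (Fin d) => V ‖x‖) ⊤ volume)
    {u : EuclideanSpace ℝ (Fin d) → ℂ} (hu : MemLp u 2 volume) :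
    MemLp (ouExpr V u) 2 volume ↔ MemLp (ouExpr 0 u) 2 volume := by
  have h1 : MemLp (fun x : EuclideanSpace ℝ (Fin d) => V ‖x‖ * u x) 2 volume := by
    exact hu.smul hV (r := 2)
  have h2 : ouExpr V u = ouExpr 0 u + fun x => V ‖x‖ * u x := by
    funext x
    simp [ouExpr]
  constructor
  · intro h
    have : ouExpr 0 u = ouExpr V u - fun x => V ‖x‖ * u x := by rw [h2, add_sub_cancel_right]
    rw [this]
    exact h.sub h1
  · intro h
    rw [h2]
    exact h.add h1

theorem isOURep_schwartz {V : ℝ → ℂ}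
    (hV : MemLp (fun x : EuclideanSpace ℝ (Fin d) => V ‖x‖) ⊤ volume)
    (w : 𝓢(EuclideanSpace ℝ (Fin d), ℂ)) : IsOURep V (w.toLp 2 volume) w where
  smooth := w.smooth ⊤
  ae_eq := w.coeFn_toLp 2 volume
  sobolev := by
    rw [Lp.toTemperedDistribution_toLp_eq]
    exact w.memSobolev
  memLp := by
    rw [memLp_ouExpr hV (w.memLp 2 volume)]
    have : ouExpr 0 w = ouSchwartz w := funext fun x => (ouSchwartz_apply w x).symm
    rw [this]
    exact (ouSchwartz w).memLp 2 volume

end Schwartz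

/-! ### Approximation of domain elements by cutoffs -/

section Cutoff

open Laplacian LineDeriv

variable {d : ℕ}

theorem laplacian_eq_sum_fderiv {F : Type*} [NormedAddCommGroup F] [NormedSpace ℝ F]
    {f : EuclideanSpace ℝ (Fin d) → F} (hf : ContDiff ℝ 2 f) (x : EuclideanSpace ℝ (Fin d)) :
    Δ f x = ∑ i, fderiv ℝ (fun y => fderiv ℝ f y (EuclideanSpace.basisFun (Fin d) ℝ i)) x
      (EuclideanSpace.basisFun (Fin d) ℝ i) := by
  rw [InnerProductSpace.laplacian_eq_iteratedFDeriv_orthonormalBasis f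
    (EuclideanSpace.basisFun (Fin d) ℝ)]
  refine Finset.sum_congr rfl fun i _ => ?_
  have h1 : DifferentiableAt ℝ (fderiv ℝ f) x :=
    ((hf.fderiv_right (m := 1) (by norm_num)).differentiable (by norm_num)) x
  have h2 := (h1.hasFDerivAt.clm_apply (hasFDerivAt_const
    (EuclideanSpace.basisFun (Fin d) ℝ i) x)).fderiv
  rw [h2, iteratedFDeriv_two_apply]
  simp

/-- In this grouping the unbounded coefficient `x` meets only `∇ψ`, where scaling controls it, or
sits inside `ouExpr 0 u`, which is known to be in `L²`. -/
theorem ouExpr_zero_smul {ψ : EuclideanSpace ℝ (Fin d) → ℝ} {u : EuclideanSpace ℝ (Fin d) → ℂ}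
    (hψ : ContDiff ℝ ∞ ψ) (hu : ContDiff ℝ ∞ u) (x : EuclideanSpace ℝ (Fin d)) :
    ouExpr 0 (fun y => ψ y • u y) x = ψ x • ouExpr 0 u x +
      (2 : ℝ) • ∑ i, fderiv ℝ ψ x (EuclideanSpace.basisFun (Fin d) ℝ i) •
        fderiv ℝ u x (EuclideanSpace.basisFun (Fin d) ℝ i) +
      (Δ ψ x - 2 * fderiv ℝ ψ x x) • u x := by
  have hψ2 : ContDiff ℝ 2 ψ := contDiff_infty.1 hψ 2
  have hu2 : ContDiff ℝ 2 u := contDiff_infty.1 hu 2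
  have h1 : ∀ y v, fderiv ℝ (fun y => ψ y • u y) y v =
      ψ y • fderiv ℝ u y v + fderiv ℝ ψ y v • u y := by
    intro y v
    have h := ((hψ.differentiable (by simp) y).hasFDerivAt.smul
      (hu.differentiable (by simp) y).hasFDerivAt).fderiv
    change fderiv ℝ (ψ • u) y v = _
    rw [h]
    simp
  have h2 : ∀ v, fderiv ℝ (fun y => fderiv ℝ (fun y => ψ y • u y) y v) x v =
      ψ x • fderiv ℝ (fun y => fderiv ℝ u y v) x v + (2 : ℝ) • fderiv ℝ ψ x v • fderiv ℝ u x v +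
      fderiv ℝ (fun y => fderiv ℝ ψ y v) x v • u x := by
    intro v
    have hψv : DifferentiableAt ℝ (fun y => fderiv ℝ ψ y v) x :=
      ((hψ2.fderiv_right (m := 1) (by norm_num)).differentiable (by norm_num) x).clm_apply
        (differentiableAt_const v)
    have huv : DifferentiableAt ℝ (fun y => fderiv ℝ u y v) x :=
      ((hu2.fderiv_right (m := 1) (by norm_num)).differentiable (by norm_num) x).clm_apply
        (differentiableAt_const v)
    have h3 := (((hψ.differentiable (by simp) x).hasFDerivAt.smul huv.hasFDerivAt).add
      (hψv.hasFDerivAt.smul (hu.differentiable (by simp) x).hasFDerivAt)).fderiv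
    simp only [h1]
    change fderiv ℝ (ψ • (fun y => fderiv ℝ u y v) + (fun y => fderiv ℝ ψ y v) • u) x v = _
    rw [h3]
    simp only [add_apply, smul_apply, ContinuousLinearMap.smulRight_apply]
    module
  have hψu : ContDiff ℝ 2 fun y => ψ y • u y := hψ2.smul hu2
  simp only [ouExpr, Pi.zero_apply, zero_mul, add_zero]
  rw [laplacian_eq_sum_fderiv hψu, laplacian_eq_sum_fderiv hψ2,
    laplacian_eq_sum_fderiv hu2, h1]
  simp only [h2, Finset.sum_add_distrib, ← Finset.smul_sum, ← Finset.sum_smul]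
  simp only [Complex.real_smul]
  push_cast
  ring

/-- The weak derivative of a smooth function is its classical derivative. -/
theorem memLp_fderiv_of_memSobolev {f : L2Space d} {u : EuclideanSpace ℝ (Fin d) → ℂ}
    (hu : ContDiff ℝ 1 u) (hfu : f =ᵐ[volume] u)
    (hf : TemperedDistribution.MemSobolev 1 2 (f : 𝓢'(EuclideanSpace ℝ (Fin d), ℂ)))
    (m : EuclideanSpace ℝ (Fin d)) : MemLp (fun x => fderiv ℝ u x m) 2 volume := by
  have h1 := hf.lineDerivOp (m := m)
  rw [sub_self, TemperedDistribution.memSobolev_zero_iff] at h1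
  obtain ⟨h, hh⟩ := h1
  have hcont : Continuous fun x => fderiv ℝ u x m :=
    (hu.continuous_fderiv one_ne_zero).clm_apply continuous_const
  suffices h2 : ∀ᵐ x, h x = fderiv ℝ u x m from (Lp.memLp h).ae_eq h2
  refine ae_eq_of_integral_contDiff_smul_eq
    ((Lp.memLp h).locallyIntegrable (by norm_num)) hcont.locallyIntegrable fun g hg hg1 => ?_
  have hgc : HasCompactSupport fun x => (g x : ℂ) := hg1.comp_left Complex.ofReal_zero
  have hgs : ContDiff ℝ ∞ fun x => (g x : ℂ) := Complex.ofRealCLM.contDiff.comp hg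
  set φ : 𝓢(EuclideanSpace ℝ (Fin d), ℂ) := hgc.toSchwartzMap hgs with hφ
  have h3 : ∂_{m} (f : 𝓢'(EuclideanSpace ℝ (Fin d), ℂ)) φ = Lp.toTemperedDistribution h φ := by
    rw [hh]
  rw [TemperedDistribution.lineDerivOp_apply_apply, Lp.toTemperedDistribution_apply,
    Lp.toTemperedDistribution_apply] at h3
  have h4 : ∀ x, (-∂_{m} φ) x = -((fderiv ℝ g x m : ℝ) : ℂ) := by
    intro x
    rw [neg_apply, SchwartzMap.lineDerivOp_apply_eq_fderiv]
    have h5 := (Complex.ofRealCLM.hasFDerivAt.comp x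
      (hg.differentiable (by simp) x).hasFDerivAt).fderiv
    have h6 : (Complex.ofRealCLM ∘ g) = φ := rfl
    rw [h6] at h5
    rw [h5]
    simp
  have hgd : Continuous fun x => fderiv ℝ g x m :=
    (hg.continuous_fderiv (by simp)).clm_apply continuous_const
  have h5 := integral_smul_fderiv_eq_neg_fderiv_smul_of_integrable (μ := volume)
    (f := g) (g := u) (v := m)
    ((hgd.smul hu.continuous).integrable_of_hasCompactSupport
      ((hg1.fderiv_apply (𝕜 := ℝ) m).smul_right))
    ((hg.continuous.smul hcont).integrable_of_hasCompactSupport hg1.smul_right)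
    ((hg.continuous.smul hu.continuous).integrable_of_hasCompactSupport hg1.smul_right)
    (fun x _ => hg.differentiable (by simp) x) (fun x _ => hu.differentiable (by simp) x)
  rw [h5, ← integral_neg]
  calc ∫ x, g x • h x = ∫ x, φ x • h x :=
        integral_congr_ae (Eventually.of_forall fun x => (Complex.real_smul).trans rfl)
    _ = ∫ x, (-∂_{m} φ) x • f x := h3.symm
    _ = ∫ x, -(fderiv ℝ g x m • u x) := by
        refine integral_congr_ae ?_
        filter_upwards [hfu] with x hx
        rw [h4, hx, Complex.real_smul, smul_eq_mul, neg_mul]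

/-- A family of smooth cutoff functions. -/
theorem exists_cutoff_bounds (d : ℕ) : ∃ (χ : EuclideanSpace ℝ (Fin d) → ℝ) (M : ℝ),
    ContDiff ℝ ∞ χ ∧ HasCompactSupport χ ∧ χ =ᶠ[𝓝 0] 1 ∧ 0 ≤ M ∧
    ∀ c : ℝ, 0 < c → c ≤ 1 → ∀ x, ‖χ (c • x)‖ ≤ M ∧
      (∀ i, ‖fderiv ℝ (fun y => χ (c • y)) x (EuclideanSpace.basisFun (Fin d) ℝ i)‖ ≤ M) ∧
      ‖Δ (fun y => χ (c • y)) x - 2 * fderiv ℝ (fun y => χ (c • y)) x x‖ ≤ M := by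
  let χ : ContDiffBump (0 : EuclideanSpace ℝ (Fin d)) := default
  have hχ : ContDiff ℝ ∞ χ := χ.contDiff
  have hχ2 : ContDiff ℝ 2 χ := contDiff_infty.1 hχ 2
  have hc := χ.hasCompactSupport
  have hd : Continuous (fderiv ℝ χ) := hχ.continuous_fderiv (by simp)
  obtain ⟨M0, hM0⟩ := hχ.continuous.bounded_above_of_compact_support hc
  have hb1 : ∀ i, ∃ M, ∀ x, ‖fderiv ℝ χ x (EuclideanSpace.basisFun (Fin d) ℝ i)‖ ≤ M := fun i =>
    (hd.clm_apply continuous_const).bounded_above_of_compact_support (hc.fderiv_apply (𝕜 := ℝ) _)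
  choose M1 hM1 using hb1
  have hb2 : ∀ i, ∃ M, ∀ x,
      ‖fderiv ℝ (fun y => fderiv ℝ χ y (EuclideanSpace.basisFun (Fin d) ℝ i)) x
        (EuclideanSpace.basisFun (Fin d) ℝ i)‖ ≤ M := fun i => by
    have h1 : ContDiff ℝ 1 fun y => fderiv ℝ χ y (EuclideanSpace.basisFun (Fin d) ℝ i) :=
      (hχ2.fderiv_right (m := 1) (by norm_num)).clm_apply contDiff_const
    exact ((h1.continuous_fderiv one_ne_zero).clm_apply
      continuous_const).bounded_above_of_compact_support
        ((hc.fderiv_apply (𝕜 := ℝ) _).fderiv_apply (𝕜 := ℝ) _)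
  choose M2 hM2 using hb2
  -- The drift term is scale invariant: `x·∇(χ(cx)) = (cx)·(∇χ)(cx)`, so one bound serves all `c`.
  have hb3 : ∃ M, ∀ x, ‖fderiv ℝ χ x x‖ ≤ M := by
    refine (hd.clm_apply continuous_id).bounded_above_of_compact_support
      ((hc.fderiv (𝕜 := ℝ)).mono ?_)
    intro x hx hx0
    exact hx (by simp [hx0])
  obtain ⟨M3, hM3⟩ := hb3
  have hM0' : 0 ≤ M0 := (norm_nonneg _).trans (hM0 0)
  have hM1' : ∀ i, 0 ≤ M1 i := fun i => (norm_nonneg _).trans (hM1 i 0)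
  have hM2' : ∀ i, 0 ≤ M2 i := fun i => (norm_nonneg _).trans (hM2 i 0)
  have hM3' : 0 ≤ M3 := (norm_nonneg _).trans (hM3 0)
  have hS1 : 0 ≤ ∑ i, M1 i := Finset.sum_nonneg fun i _ => hM1' i
  have hS2 : 0 ≤ ∑ i, M2 i := Finset.sum_nonneg fun i _ => hM2' i
  refine ⟨χ, M0 + ∑ i, M1 i + (∑ i, M2 i + 2 * M3), hχ, hc, χ.eventuallyEq_one,
    by positivity, fun c hc0 hc1 x => ?_⟩
  have hder : ∀ y, fderiv ℝ (fun y => χ (c • y)) y = c • fderiv ℝ χ (c • y) := fun y =>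
    fderiv_comp_smul c
  refine ⟨?_, fun i => ?_, ?_⟩
  · linarith [hM0 (c • x)]
  · rw [hder, smul_apply, norm_smul, Real.norm_of_nonneg hc0.le]
    have h1 := mul_le_mul hc1 (hM1 i (c • x)) (norm_nonneg _) zero_le_one
    have h2 := Finset.single_le_sum (fun i _ => hM1' i) (Finset.mem_univ i)
    linarith
  · have hsm : ContDiff ℝ 2 fun y => χ (c • y) := hχ2.comp (contDiff_const_smul c)
    rw [laplacian_eq_sum_fderiv hsm]
    have h1 : ∀ i, ‖fderiv ℝ (fun y => fderiv ℝ (fun y => χ (c • y)) y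
        (EuclideanSpace.basisFun (Fin d) ℝ i)) x (EuclideanSpace.basisFun (Fin d) ℝ i)‖ ≤ M2 i := by
      intro i
      set g : EuclideanSpace ℝ (Fin d) → ℝ :=
        fun y => fderiv ℝ χ y (EuclideanSpace.basisFun (Fin d) ℝ i) with hg
      have h2 : (fun y => fderiv ℝ (fun y => χ (c • y)) y
          (EuclideanSpace.basisFun (Fin d) ℝ i)) = c • fun y => g (c • y) := by
        funext y
        rw [hder]
        rfl
      have h3 : DifferentiableAt ℝ (fun y => g (c • y)) x := by
        have h4 : ContDiff ℝ 1 g :=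
          (hχ2.fderiv_right (m := 1) (by norm_num)).clm_apply contDiff_const
        exact (h4.comp (contDiff_const_smul c)).differentiable (by norm_num) x
      rw [h2, fderiv_const_smul h3, fderiv_comp_smul, smul_apply, smul_apply, norm_smul,
        norm_smul, Real.norm_of_nonneg hc0.le, ← mul_assoc]
      have h4 := mul_le_mul (mul_le_one₀ hc1 hc0.le hc1) (hM2 i (c • x)) (norm_nonneg _)
        zero_le_one
      linarith
    have h2 : ‖fderiv ℝ (fun y => χ (c • y)) x x‖ ≤ M3 := by
      have h3 : fderiv ℝ (fun y => χ (c • y)) x x = fderiv ℝ χ (c • x) (c • x) := by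
        rw [hder, smul_apply, map_smul]
      rw [h3]
      exact hM3 _
    refine (norm_sub_le _ _).trans ?_
    rw [norm_mul, Real.norm_ofNat]
    have h3 := (norm_sum_le _ _).trans (Finset.sum_le_sum fun i (_ : i ∈ Finset.univ) => h1 i)
    linarith

theorem ouExpr_congr_of_eventuallyEq {V : ℝ → ℂ} {u v : EuclideanSpace ℝ (Fin d) → ℂ}
    {x : EuclideanSpace ℝ (Fin d)} (h : u =ᶠ[𝓝 x] v) : ouExpr V u x = ouExpr V v x := by
  simp only [ouExpr]
  rw [(InnerProductSpace.laplacian_congr_nhds h).self_of_nhds, h.fderiv_eq, h.self_of_nhds]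

/-- Elements of the domain can be approximated in the graph norm by test functions. -/
theorem mem_closure_ouSchwartzGraph {f g : L2Space d} {u : EuclideanSpace ℝ (Fin d) → ℂ}
    (hf : IsOURep 0 f u) (hg : g =ᵐ[volume] ouExpr 0 u) :
    (f, g) ∈ closure (ouSchwartzGraph d) := by
  obtain ⟨χ, M, hχ, hχc, hχ1, hM, hb⟩ := exists_cutoff_bounds d
  set c : ℕ → ℝ := fun n => 1 / ((n : ℝ) + 1) with hcdef
  have hc0 : ∀ n, 0 < c n := fun n => by positivity
  have hc1 : ∀ n, c n ≤ 1 := fun n => by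
    rw [hcdef, div_le_one (by positivity)]
    linarith [(n.cast_nonneg : (0 : ℝ) ≤ n)]
  have hclim : Tendsto c atTop (𝓝 0) := tendsto_one_div_add_atTop_nhds_zero_nat
  have hψ : ∀ n, ContDiff ℝ ∞ fun y => χ (c n • y) := fun n => hχ.comp (contDiff_const_smul _)
  have hwc : ∀ n, HasCompactSupport fun y => χ (c n • y) • u y := fun n =>
    (hχc.comp_homeomorph (Homeomorph.smulOfNeZero _ (hc0 n).ne')).smul_right
  have hws : ∀ n, ContDiff ℝ ∞ fun y => χ (c n • y) • u y := fun n => (hψ n).smul hf.smooth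
  set w : ℕ → 𝓢(EuclideanSpace ℝ (Fin d), ℂ) := fun n => (hwc n).toSchwartzMap (hws n) with hw
  have hwcoe : ∀ n, ⇑(w n) = fun y => χ (c n • y) • u y := fun n => rfl
  -- Equality on a neighbourhood of `x`, not just at `x`, so that derivatives agree as well.
  have hnear : ∀ x, ∀ᶠ n in atTop, (fun y => χ (c n • y) • u y) =ᶠ[𝓝 x] u := by
    intro x
    have h1 : Tendsto (fun p : ℕ × EuclideanSpace ℝ (Fin d) => c p.1 • p.2) (atTop ×ˢ 𝓝 x)
        (𝓝 0) := by
      simpa using (hclim.comp tendsto_fst).smul (tendsto_snd (f := (atTop : Filter ℕ)) (g := 𝓝 x))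
    filter_upwards [(h1.eventually hχ1).curry] with n hn
    filter_upwards [hn] with y hy
    rw [hy, Pi.one_apply, one_smul]
  have hu2 : MemLp u 2 volume := (Lp.memLp f).ae_eq hf.ae_eq
  -- Sobolev regularity of the domain supplies the majorant for the cross term `2∇ψ·∇u`.
  have hdu : ∀ i, MemLp (fun x => fderiv ℝ u x (EuclideanSpace.basisFun (Fin d) ℝ i)) 2 volume :=
    fun i => memLp_fderiv_of_memSobolev (contDiff_infty.1 hf.smooth 1) hf.ae_eq
      (hf.sobolev.mono (by norm_num)) _
  refine mem_closure_of_tendsto (b := atTop) (f := fun n =>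
    (((w n).toLp 2 volume : L2Space d), ((ouSchwartz (w n)).toLp 2 volume : L2Space d)))
    (Tendsto.prodMk_nhds ?_ ?_) (Eventually.of_forall fun n => ⟨w n, rfl⟩)
  · refine tendsto_lp_two_of_dominated (F := fun n x => w n x) (f := u)
      (bound := fun x => (M + 1) * ‖u x‖) (Eventually.of_forall fun n => (w n).coeFn_toLp 2 volume)
      hf.ae_eq (hu2.norm.const_mul _) (Eventually.of_forall fun n => Eventually.of_forall fun x =>
        ?_) (Eventually.of_forall fun x => ?_) (Eventually.of_forall fun x => ?_)
    · rw [hwcoe, norm_smul]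
      have := (hb (c n) (hc0 n) (hc1 n) x).1
      gcongr
      linarith
    · exact le_mul_of_one_le_left (norm_nonneg _) (by linarith)
    · refine tendsto_const_nhds.congr' ?_
      filter_upwards [hnear x] with n hn
      exact hn.self_of_nhds.symm
  · refine tendsto_lp_two_of_dominated (F := fun n x => ouExpr 0 (w n) x) (f := ouExpr 0 u)
      (bound := fun x => (M + 1) * ‖ouExpr 0 u x‖ +
        2 * (M * ∑ i, ‖fderiv ℝ u x (EuclideanSpace.basisFun (Fin d) ℝ i)‖) + M * ‖u x‖)
      (Eventually.of_forall fun n => ?_)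
      hg (((hf.memLp.norm.const_mul _).add (((memLp_finsetSum _
        fun i _ => (hdu i).norm).const_mul _).const_mul _)).add (hu2.norm.const_mul _))
      (Eventually.of_forall fun n => Eventually.of_forall fun x => ?_)
      (Eventually.of_forall fun x => ?_) (Eventually.of_forall fun x => ?_)
    · filter_upwards [(ouSchwartz (w n)).coeFn_toLp 2 volume] with x hx
      rw [hx, ouSchwartz_apply]
    · obtain ⟨h1, h2, h3⟩ := hb (c n) (hc0 n) (hc1 n) x
      rw [hwcoe, ouExpr_zero_smul (hψ n) hf.smooth]
      refine (norm_add₃_le).trans ?_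
      rw [norm_smul, norm_smul, norm_smul, Real.norm_ofNat, Finset.mul_sum]
      gcongr
      · linarith
      · refine (norm_sum_le _ _).trans (Finset.sum_le_sum fun i _ => ?_)
        rw [norm_smul]
        exact mul_le_mul_of_nonneg_right (h2 i) (norm_nonneg _)
    · have h1 : 0 ≤ ∑ i, ‖fderiv ℝ u x (EuclideanSpace.basisFun (Fin d) ℝ i)‖ :=
        Finset.sum_nonneg fun i _ => norm_nonneg _
      have h2 : 0 ≤ M * ‖ouExpr 0 u x‖ := by positivity
      have h3 : 0 ≤ 2 * (M * ∑ i, ‖fderiv ℝ u x (EuclideanSpace.basisFun (Fin d) ℝ i)‖) := by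
        positivity
      have h4 : 0 ≤ M * ‖u x‖ := by positivity
      linarith
    · refine tendsto_const_nhds.congr' ?_
      filter_upwards [hnear x] with n hn
      exact (ouExpr_congr_of_eventuallyEq hn).symm

theorem IsOURep.genPair_ouSemigroup {f g : L2Space d} {u : EuclideanSpace ℝ (Fin d) → ℂ}
    (hf : IsOURep 0 f u) (hg : g =ᵐ[volume] ouExpr 0 u) : GenPair (ouSemigroup d) f g := by
  have h := mem_closure_ouSchwartzGraph hf hg
  rw [closure_ouSchwartzGraph] at h
  exact h

end Cutoff

/-! ### Operators with square integrable kernels -/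

section HilbertSchmidt

open scoped ENNReal

/-- An operator on `L²` given by a square integrable kernel `α → E*`. -/
def kernelL {E α : Type*} [NormedAddCommGroup E] [NormedSpace ℂ E] [MeasurableSpace α]
    (μ : Measure α) : Lp (E →L[ℂ] ℂ) 2 μ →L[ℂ] E →L[ℂ] Lp ℂ 2 μ :=
  ((ContinuousLinearMap.apply ℂ ℂ : E →L[ℂ] (E →L[ℂ] ℂ) →L[ℂ] ℂ).compLpL₂ 2 μ).flip

theorem coeFn_kernelL {E α : Type*} [NormedAddCommGroup E] [NormedSpace ℂ E] [MeasurableSpace α]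
    {μ : Measure α} (k : Lp (E →L[ℂ] ℂ) 2 μ) (f : E) : kernelL μ k f =ᵐ[μ] fun x => k x f :=
  ContinuousLinearMap.coeFn_compLp _ k

/-- Indicator kernels give operators of rank at most one, and their sums are dense. The
kernel-to-operator map is continuous and compact operators are norm closed. -/
theorem isCompactOperator_kernelL {E α : Type*} [NormedAddCommGroup E] [NormedSpace ℂ E]
    [MeasurableSpace α] {μ : Measure α} (k : Lp (E →L[ℂ] ℂ) 2 μ) :
    IsCompactOperator (kernelL μ k) := by
  refine Lp.induction (by norm_num) (motive := fun k => IsCompactOperator (kernelL μ k))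
    (fun c s hs hμs => ?_) (fun f g hf hg _ h1 h2 => ?_) ?_ k
  · set φ : Lp ℂ 2 μ := indicatorConstLp 2 hs hμs.ne (1 : ℂ) with hφ
    have h1 : kernelL μ (Lp.simpleFunc.indicatorConst 2 hs hμs.ne c : Lp (E →L[ℂ] ℂ) 2 μ) =
        (ContinuousLinearMap.toSpanSingleton ℂ φ).comp c := by
      ext f
      rw [Lp.simpleFunc.coe_indicatorConst]
      filter_upwards [coeFn_kernelL (indicatorConstLp 2 hs hμs.ne c) f,
        indicatorConstLp_coeFn (p := 2) (hs := hs) (hμs := hμs.ne) (c := c),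
        indicatorConstLp_coeFn (p := 2) (hs := hs) (hμs := hμs.ne) (c := (1 : ℂ)),
        Lp.coeFn_smul (c f) φ] with x h2 h3 h4 h5
      rw [h2, h3, ContinuousLinearMap.comp_apply, ContinuousLinearMap.toSpanSingleton_apply, h5,
        Pi.smul_apply, hφ, h4]
      by_cases hx : x ∈ s <;> simp [hx]
    rw [h1]
    have h2 : IsCompactOperator (ContinuousLinearMap.toSpanSingleton ℂ φ) :=
      isCompactOperator_of_locallyCompactSpace_rng _
    exact h2.comp_clm c
  · rw [map_add]
    exact h1.add h2
  · exact isClosed_setOfPred_isCompactOperator.preimage (kernelL μ).continuous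

end HilbertSchmidt

/-! ### Compactness of the smoothed potential -/

section FourierKernel

open FourierTransform

variable {d : ℕ}

/-- The `L²` Fourier transform is given by the integral formula on `L¹ ∩ L²`. -/
theorem coeFn_fourierTransformₗᵢ {h : L2Space d} (hh : Integrable h) :
    Lp.fourierTransformₗᵢ (EuclideanSpace ℝ (Fin d)) ℂ h =ᵐ[volume]
      (𝓕 (h : EuclideanSpace ℝ (Fin d) → ℂ) : EuclideanSpace ℝ (Fin d) → ℂ) := by
  have hcont : Continuous (𝓕 (h : EuclideanSpace ℝ (Fin d) → ℂ) : EuclideanSpace ℝ (Fin d) → ℂ) :=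
    VectorFourier.fourierIntegral_continuous Real.continuous_fourierChar
      continuous_inner hh
  refine ae_eq_of_integral_contDiff_smul_eq ((Lp.memLp _).locallyIntegrable (by norm_num))
    hcont.locallyIntegrable fun g hg hg1 => ?_
  have hgc : HasCompactSupport fun x => (g x : ℂ) := hg1.comp_left Complex.ofReal_zero
  have hgs : ContDiff ℝ ∞ fun x => (g x : ℂ) := Complex.ofRealCLM.contDiff.comp hg
  set φ : 𝓢(EuclideanSpace ℝ (Fin d), ℂ) := hgc.toSchwartzMap hgs with hφ
  have h1 := DFunLike.congr_fun (Lp.fourier_toTemperedDistribution_eq h) φ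
  rw [TemperedDistribution.fourier_apply, Lp.toTemperedDistribution_apply,
    Lp.toTemperedDistribution_apply] at h1
  have h2 := VectorFourier.integral_fourierIntegral_smul_eq_flip (μ := volume) (ν := volume)
    (L := innerₗ (EuclideanSpace ℝ (Fin d)))
    Real.continuous_fourierChar continuous_inner φ.integrable hh
  rw [flip_innerₗ] at h2
  calc _ = ∫ x, φ x • (𝓕 h : L2Space d) x :=
        integral_congr_ae (Eventually.of_forall fun x => (Complex.real_smul).symm.trans rfl)
    _ = _ := h1.symm.trans h2
    _ = _ := integral_congr_ae (Eventually.of_forall fun x => (Complex.real_smul).symm.trans rfl)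

theorem memLp_fourierChar_smul {b : EuclideanSpace ℝ (Fin d) → ℂ} (hb : MemLp b 2 volume)
    (ξ : EuclideanSpace ℝ (Fin d)) :
    MemLp (fun x => Real.fourierChar (inner ℝ x ξ) • b x) 2 volume := by
  have hc : Continuous fun x : EuclideanSpace ℝ (Fin d) =>
      ((Real.fourierChar (inner ℝ x ξ) : Circle) : ℂ) :=
    continuous_subtype_val.comp (Real.continuous_fourierChar.comp (by fun_prop))
  refine hb.of_le (hc.aestronglyMeasurable.mul hb.1) (Eventually.of_forall fun x => ?_)
  rw [Circle.norm_smul]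

theorem continuous_toLp_fourierChar_smul {b : EuclideanSpace ℝ (Fin d) → ℂ}
    (hb : MemLp b 2 volume) :
    Continuous fun ξ => (memLp_fourierChar_smul hb ξ).toLp _ := by
  rw [continuous_iff_continuousAt]
  intro ξ
  refine tendsto_lp_two_of_dominated
    (F := fun η x => Real.fourierChar (inner ℝ x η) • b x) (bound := fun x => ‖b x‖)
    (Eventually.of_forall fun η => (memLp_fourierChar_smul hb η).coeFn_toLp)
    (memLp_fourierChar_smul hb ξ).coeFn_toLp hb.norm
    (Eventually.of_forall fun η => Eventually.of_forall fun x => ?_)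
    (Eventually.of_forall fun x => ?_) (Eventually.of_forall fun x => ?_)
  · rw [Circle.norm_smul]
  · rw [Circle.norm_smul]
  · have h1 : Continuous fun η : EuclideanSpace ℝ (Fin d) =>
        Real.fourierChar (inner ℝ x η) • b x :=
      (Real.continuous_fourierChar.comp (by fun_prop)).smul continuous_const
    exact h1.tendsto ξ

/-- Multiplication, Fourier transform, multiplication is a Hilbert–Schmidt operator. -/
theorem isCompactOperator_mulL_fourier_mulL {a w : EuclideanSpace ℝ (Fin d) → ℂ}
    (ha : MemLp a ⊤ volume) (ha2 : MemLp a 2 volume) (hw : MemLp w ⊤ volume)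
    (hw2 : MemLp w 2 volume) :
    IsCompactOperator ((mulL ha).comp
      (((Lp.fourierTransformₗᵢ (EuclideanSpace ℝ (Fin d)) ℂ).toContinuousLinearEquiv :
        L2Space d →L[ℂ] L2Space d).comp (mulL hw))) := by
  have hb : MemLp (star w) 2 volume := hw2.star
  -- The inner product is conjugate-linear in its first slot: pairing with `e^{2πi x·ξ} star w`
  -- gives the Fourier integral of `w f` at `ξ`.
  set g : EuclideanSpace ℝ (Fin d) → L2Space d :=
    fun ξ => (memLp_fourierChar_smul hb ξ).toLp _ with hg
  have hgc : Continuous g := continuous_toLp_fourierChar_smul hb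
  have hgn : ∀ ξ, ‖g ξ‖ = ‖hb.toLp (star w)‖ := by
    intro ξ
    rw [hg, Lp.norm_toLp, Lp.norm_toLp]
    congr 1
    exact eLpNorm_congr_norm_ae (Eventually.of_forall fun x => by rw [Circle.norm_smul])
  have hk : MemLp (fun ξ => a ξ • (innerSL ℂ (g ξ) : L2Space d →L[ℂ] ℂ)) 2 volume := by
    refine MemLp.of_le_mul (c := ‖hb.toLp (star w)‖) ha2
      (ha2.1.smul (((innerSL ℂ).continuous.comp hgc).aestronglyMeasurable))
      (Eventually.of_forall fun ξ => ?_)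
    rw [norm_smul, innerSL_apply_norm, hgn, mul_comm]
  have h1 : (mulL ha).comp
      (((Lp.fourierTransformₗᵢ (EuclideanSpace ℝ (Fin d)) ℂ).toContinuousLinearEquiv :
        L2Space d →L[ℂ] L2Space d).comp (mulL hw)) = kernelL volume (hk.toLp _) := by
    ext f
    have hint : Integrable (mulL hw f) := by
      refine Integrable.congr (f := fun x => w x * f x) ?_ (coeFn_mulL hw f).symm
      exact hw2.integrable_mul (Lp.memLp f)
    filter_upwards [coeFn_mulL ha (Lp.fourierTransformₗᵢ (EuclideanSpace ℝ (Fin d)) ℂ (mulL hw f)),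
      coeFn_fourierTransformₗᵢ hint, coeFn_kernelL (hk.toLp _) f, hk.coeFn_toLp] with ξ h2 h3 h4 h5
    rw [h4, h5]
    refine h2.trans ?_
    rw [h3, smul_apply, smul_eq_mul, innerSL_apply_apply, L2.inner_def, Real.fourier_eq]
    congr 1
    refine integral_congr_ae ?_
    filter_upwards [coeFn_mulL hw f, (memLp_fourierChar_smul hb ξ).coeFn_toLp] with x h6 h7
    rw [h6, hg, h7, RCLike.inner_apply, Circle.smul_def, Circle.smul_def, AddChar.map_neg_eq_inv,
      Circle.coe_inv_eq_conj, smul_eq_mul, smul_eq_mul, Pi.star_apply, map_mul, RCLike.star_def,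
      Complex.conj_conj]
    ring
  rw [h1]
  exact isCompactOperator_kernelL _

theorem memLp_two_gaussWeight {t : ℝ} (ht : 0 < t) :
    MemLp (gaussWeight (d := d) t) 2 volume := by
  rw [memLp_two_iff_integrable_sq_norm (continuous_gaussWeight t).aestronglyMeasurable]
  have h1 : Real.exp (-4 * t) < 1 := Real.exp_lt_one_iff.2 (by linarith)
  set b : ℝ := 2 * (Real.pi ^ 2 * (1 - Real.exp (-4 * t))) with hb
  have hb0 : 0 < b := by
    have : 0 < 1 - Real.exp (-4 * t) := by linarith
    positivity
  have h2 := (GaussianFourier.integrable_cexp_neg_mul_sq_norm_add (V := EuclideanSpace ℝ (Fin d))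
    (b := (b : ℂ)) (by simpa using hb0) 0 0).norm
  refine h2.congr (Eventually.of_forall fun x => ?_)
  simp only [gaussWeight]
  rw [Complex.norm_exp, Complex.norm_real, Real.norm_of_nonneg (Real.exp_pos _).le,
    ← Real.exp_nat_mul]
  congr 1
  have h3 : (-(b : ℂ) * (‖x‖ : ℂ) ^ 2 + 0 * (inner ℝ (0 : EuclideanSpace ℝ (Fin d)) x : ℝ)) =
      ((-b * ‖x‖ ^ 2 : ℝ) : ℂ) := by push_cast; ring
  rw [h3, Complex.ofReal_re, hb]
  push_cast
  ring

/-- Multiplication by a bounded function vanishing at infinity is relatively compact. -/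
theorem isCompactOperator_ouSemigroup_comp_mulL {w : EuclideanSpace ℝ (Fin d) → ℂ}
    (hw : MemLp w ⊤ volume) (hw0 : ∀ ε > 0, ∃ R : ℝ, ∀ x, R < ‖x‖ → ‖w x‖ ≤ ε) {t : ℝ≥0}
    (ht : 0 < t) : IsCompactOperator ((ouSemigroup d t).comp (mulL hw)) := by
  set F := ((Lp.fourierTransformₗᵢ (EuclideanSpace ℝ (Fin d)) ℂ).toContinuousLinearEquiv :
    L2Space d →L[ℂ] L2Space d) with hF
  set G := (((Lp.fourierTransformₗᵢ (EuclideanSpace ℝ (Fin d)) ℂ).symm).toContinuousLinearEquiv :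
    L2Space d →L[ℂ] L2Space d) with hG
  have hg2 : MemLp (gaussWeight (d := d) (t : ℝ)) 2 volume := memLp_two_gaussWeight ht
  have key : IsCompactOperator ((mulL (memLp_gaussWeight (d := d) t)).comp (F.comp (mulL hw))) := by
    have hball : ∀ n : ℕ, MeasurableSet (Metric.closedBall (0 : EuclideanSpace ℝ (Fin d)) n) :=
      fun n => measurableSet_closedBall
    -- Truncation to balls puts `w` in `L²`; the truncated multiplications converge in operator norm
    -- because `w` vanishes at infinity.
    have hwn : ∀ n : ℕ, MemLp ((Metric.closedBall (0 : EuclideanSpace ℝ (Fin d)) n).indicator w)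
      ⊤ volume := fun n => hw.indicator (hball n)
    have hwn2 : ∀ n : ℕ, MemLp ((Metric.closedBall (0 : EuclideanSpace ℝ (Fin d)) n).indicator w)
        2 volume := by
      intro n
      rw [memLp_indicator_iff_restrict (hball n)]
      have : IsFiniteMeasure (volume.restrict
        (Metric.closedBall (0 : EuclideanSpace ℝ (Fin d)) n)) :=
        ⟨by rw [Measure.restrict_apply_univ]; exact measure_closedBall_lt_top⟩
      exact (hw.restrict _).mono_exponent le_top
    have hlim : Tendsto (fun n : ℕ => mulL (hwn n)) atTop (𝓝 (mulL hw)) := by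
      rw [Metric.tendsto_atTop]
      intro ε hε
      obtain ⟨R, hR⟩ := hw0 (ε / 2) (by positivity)
      obtain ⟨N, hN⟩ := exists_nat_gt R
      refine ⟨N, fun n hn => ?_⟩
      rw [dist_eq_norm]
      refine lt_of_le_of_lt (ContinuousLinearMap.opNorm_le_bound _ (by positivity) fun f => ?_)
        (half_lt_self hε)
      refine Lp.norm_le_mul_norm_of_ae_le_mul ?_
      filter_upwards [coeFn_mulL (hwn n) f, coeFn_mulL hw f,
        Lp.coeFn_sub (mulL (hwn n) f) (mulL hw f)] with x h1 h2 h3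
      rw [sub_apply, h3, Pi.sub_apply, h1, h2, ← sub_mul, norm_mul]
      refine mul_le_mul_of_nonneg_right ?_ (norm_nonneg _)
      by_cases hx : x ∈ Metric.closedBall (0 : EuclideanSpace ℝ (Fin d)) n
      · rw [indicator_of_mem hx, sub_self, norm_zero]
        positivity
      · rw [indicator_of_notMem hx, zero_sub, norm_neg]
        refine hR x (hN.trans_le ?_)
        rw [mem_closedBall_zero_iff, not_le] at hx
        exact (Nat.cast_le.2 hn).trans hx.le
    have hlim2 : Tendsto (fun n : ℕ => (mulL (memLp_gaussWeight (d := d) t)).comp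
        (F.comp (mulL (hwn n)))) atTop
        (𝓝 ((mulL (memLp_gaussWeight (d := d) t)).comp (F.comp (mulL hw)))) := by
      have hc : Continuous fun B : L2Space d →L[ℂ] L2Space d =>
        (mulL (memLp_gaussWeight (d := d) t)).comp (F.comp B) :=
        continuous_const.clm_comp (continuous_const.clm_comp continuous_id)
      exact (hc.tendsto (mulL hw)).comp hlim
    exact isCompactOperator_of_tendsto hlim2 (Eventually.of_forall fun n =>
      isCompactOperator_mulL_fourier_mulL _ hg2 (hwn n) (hwn2 n))
  have h1 : (ouSemigroup d t).comp (mulL hw) =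
      (G.comp (((Real.exp (2 * d * t) : ℝ) : ℂ) • dilL (Real.exp_pos (2 * (t : ℝ))))).comp
        ((mulL (memLp_gaussWeight (d := d) t)).comp (F.comp (mulL hw))) := by
    ext1 f
    rfl
  rw [h1]
  exact IsCompactOperator.clm_comp key
    (G.comp (((Real.exp (2 * d * t) : ℝ) : ℂ) • dilL (Real.exp_pos (2 * (t : ℝ)))))

end FourierKernel

/-! ### The closure of the operator and its generator -/

section Main

variable {d : ℕ}

/-- On the zero space `z - A` would trivially be onto; `-1` is just a point with real part below
`d`. -/
theorem nontrivial_L2Space (hd : 1 ≤ d) : Nontrivial (L2Space d) := by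
  by_contra h
  rw [not_nontrivial_iff_subsingleton] at h
  refine not_surjective_fourierOU hd (z := -1) (by simpa using d.cast_nonneg.trans_lt' (by norm_num))
    fun w => ⟨0, 0, ?_, Subsingleton.elim _ _⟩
  exact tendsto_const_nhds.congr fun t => Subsingleton.elim _ _

theorem eq_zero_of_eigenvector_ouSemigroup {z : ℂ} (hz : z.re < d) {f : L2Space d}
    (hf : GenPair (ouSemigroup d) f (z • f)) : f = 0 := by
  rw [ouSemigroup, genPair_conjFamily_iff, map_smul] at hf
  exact (map_eq_zero_iff _ (LinearIsometryEquiv.injective _)).1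
    (eq_zero_of_eigenvector_fourierOU hz hf)

theorem not_surjective_ouSemigroup (hd : 1 ≤ d) {z : ℂ} (hz : z.re < d) :
    ¬ ∀ w : L2Space d, ∃ x y, GenPair (ouSemigroup d) x y ∧ z • x - y = w := by
  intro h
  set e := Lp.fourierTransformₗᵢ (EuclideanSpace ℝ (Fin d)) ℂ with he
  refine not_surjective_fourierOU hd hz fun w => ?_
  obtain ⟨x, y, hxy, hw⟩ := h (e.symm w)
  refine ⟨e x, e y, (genPair_conjFamily_iff e _ x y).1 hxy, ?_⟩
  rw [← map_smul, ← map_sub, hw, e.apply_symm_apply]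

theorem genPair_of_mem_graph_ouOperator {V : ℝ → ℂ}
    (hV : MemLp (fun x : EuclideanSpace ℝ (Fin d) => V ‖x‖) ⊤ volume) {f g : L2Space d}
    (h : (f, g) ∈ (ouOperator d V).graph) : GenPair (ouSemigroup d) f (g - mulL hV f) := by
  obtain ⟨u, hu, hg⟩ := (mem_graph_ouOperator_iff f g).1 h
  have hu0 : IsOURep 0 f u := ⟨hu.smooth, hu.ae_eq, hu.sobolev,
    (memLp_ouExpr hV ((Lp.memLp f).ae_eq hu.ae_eq)).1 hu.memLp⟩
  refine hu0.genPair_ouSemigroup ?_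
  filter_upwards [hg, hu.ae_eq, coeFn_mulL hV f, Lp.coeFn_sub g (mulL hV f)] with x h1 h2 h3 h4
  rw [h4, Pi.sub_apply, h1, h3, h2]
  simp [ouExpr]

theorem mem_graph_ouOperator_schwartz {V : ℝ → ℂ}
    (hV : MemLp (fun x : EuclideanSpace ℝ (Fin d) => V ‖x‖) ⊤ volume)
    (w : 𝓢(EuclideanSpace ℝ (Fin d), ℂ)) :
    ((w.toLp 2 volume : L2Space d),
      (ouSchwartz w).toLp 2 volume + mulL hV (w.toLp 2 volume)) ∈ (ouOperator d V).graph := by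
  refine (mem_graph_ouOperator_iff _ _).2 ⟨w, isOURep_schwartz hV w, ?_⟩
  filter_upwards [(ouSchwartz w).coeFn_toLp 2 volume, w.coeFn_toLp 2 volume,
    coeFn_mulL hV (w.toLp 2 volume),
    Lp.coeFn_add ((ouSchwartz w).toLp 2 volume) (mulL hV (w.toLp 2 volume))] with x h1 h2 h3 h4
  rw [h4, Pi.add_apply, h1, h3, h2, ouSchwartz_apply]
  simp [ouExpr]

/-- The shear `(f, g) ↦ (f, g - V f)` is a homeomorphism, which reduces everything to `V = 0`. There
the graph lies between the Schwartz graph and the closed generator, and the former is dense in the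
latter. -/
theorem closure_graph_ouOperator {V : ℝ → ℂ}
    (hV : MemLp (fun x : EuclideanSpace ℝ (Fin d) => V ‖x‖) ⊤ volume) :
    closure ((ouOperator d V).graph : Set (L2Space d × L2Space d)) =
      {p | GenPair (ouSemigroup d) p.1 (p.2 - mulL hV p.1)} := by
  have hclosed : IsClosed {p : L2Space d × L2Space d |
      GenPair (ouSemigroup d) p.1 (p.2 - mulL hV p.1)} := by
    have hc : Continuous fun p : L2Space d × L2Space d => (p.1, p.2 - mulL hV p.1) :=
      continuous_fst.prodMk (continuous_snd.sub ((mulL hV).continuous.comp continuous_fst))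
    exact (isC0Semigroup_ouSemigroup d).isClosed_genPair.preimage hc
  refine Subset.antisymm (closure_minimal (fun p hp => genPair_of_mem_graph_ouOperator hV hp)
    hclosed) fun p hp => ?_
  have hc : Continuous fun p : L2Space d × L2Space d => (p.1, p.2 + mulL hV p.1) :=
    continuous_fst.prodMk (continuous_snd.add ((mulL hV).continuous.comp continuous_fst))
  have h1 := map_mem_closure hc (mem_closure_of_genPair_ouSemigroup hp)
    (t := ((ouOperator d V).graph : Set (L2Space d × L2Space d))) (by
      rintro _ ⟨w, rfl⟩
      exact mem_graph_ouOperator_schwartz hV w)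
  simpa using h1

theorem dense_ouDomain {V : ℝ → ℂ}
    (hV : MemLp (fun x : EuclideanSpace ℝ (Fin d) => V ‖x‖) ⊤ volume) :
    Dense ((ouOperator d V).domain : Set (L2Space d)) := by
  refine Dense.mono ?_ (dense_range_toLp (d := d))
  rintro _ ⟨w, rfl⟩
  exact ⟨w, isOURep_schwartz hV w⟩

/-- The closure of the graph lies in a sheared generator graph, and generators are single valued by
uniqueness of limits. -/
theorem isClosable_ouOperator {V : ℝ → ℂ}
    (hV : MemLp (fun x : EuclideanSpace ℝ (Fin d) => V ‖x‖) ⊤ volume) :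
    (ouOperator d V).IsClosable := by
  refine ⟨(ouOperator d V).graph.topologicalClosure.toLinearPMap,
    (Submodule.toLinearPMap_graph_eq _ ?_).symm⟩
  intro p hp hp1
  have h1 : p ∈ closure ((ouOperator d V).graph : Set (L2Space d × L2Space d)) := hp
  rw [closure_graph_ouOperator hV] at h1
  have h2 : GenPair (ouSemigroup d) p.1 (p.2 - mulL hV p.1) := h1
  rw [hp1, map_zero, sub_zero] at h2
  refine h2.unique (tendsto_const_nhds.congr fun t => ?_)
  rw [map_zero, sub_zero, smul_zero]

theorem mem_graph_closure_ouOperator_iff {V : ℝ → ℂ}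
    (hV : MemLp (fun x : EuclideanSpace ℝ (Fin d) => V ‖x‖) ⊤ volume) (f g : L2Space d) :
    (f, g) ∈ (ouOperator d V).closure.graph ↔ GenPair (ouSemigroup d) f (g - mulL hV f) := by
  rw [← (isClosable_ouOperator hV).graph_closure_eq_closure_graph]
  have h := Set.ext_iff.1 (closure_graph_ouOperator hV) (f, g)
  exact h

theorem japaneseBracket_zpow_neg_two (r : ℝ) : japaneseBracket r ^ (-2 : ℤ) = (1 + r ^ 2)⁻¹ := by
  rw [japaneseBracket, zpow_neg, inv_inj]
  exact Real.sq_sqrt (by positivity)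

theorem memLp_top_of_decay {V : ℝ → ℂ} {C : ℝ} (hC : 0 < C) (hVc : ContinuousOn V (Set.Ici 0))
    (hV : ∀ r : ℝ, 0 ≤ r → ‖V r‖ ≤ C * japaneseBracket r ^ (-2 : ℤ)) :
    MemLp (fun x : EuclideanSpace ℝ (Fin d) => V ‖x‖) ⊤ volume := by
  refine memLp_top_of_bound (hVc.comp_continuous continuous_norm
    fun x => norm_nonneg x).aestronglyMeasurable C (Eventually.of_forall fun x => ?_)
  refine (hV _ (norm_nonneg x)).trans ?_
  rw [japaneseBracket_zpow_neg_two]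
  exact mul_le_of_le_one_right hC.le (inv_le_one_of_one_le₀ (by nlinarith [sq_nonneg ‖x‖]))

theorem exists_norm_le_of_decay {V : ℝ → ℂ} {C : ℝ} (hC : 0 < C)
    (hV : ∀ r : ℝ, 0 ≤ r → ‖V r‖ ≤ C * japaneseBracket r ^ (-2 : ℤ)) {ε : ℝ} (hε : 0 < ε) :
    ∃ R : ℝ, ∀ x : EuclideanSpace ℝ (Fin d), R < ‖x‖ → ‖V ‖x‖‖ ≤ ε := by
  refine ⟨max 1 (C / ε), fun x hx => (hV _ (norm_nonneg x)).trans ?_⟩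
  have h1 : 1 < ‖x‖ := (le_max_left _ _).trans_lt hx
  have h2 : C / ε < ‖x‖ := (le_max_right _ _).trans_lt hx
  rw [div_lt_iff₀ hε] at h2
  rw [japaneseBracket_zpow_neg_two, ← div_eq_mul_inv, div_le_iff₀ (by positivity)]
  nlinarith

end Main

end

theorem theorem1p1 (d : ℕ) (hd : 1 ≤ d) (V : ℝ → ℂ) (C : ℝ) (hC : 0 < C)
    (hVdiff : DifferentiableOn ℝ V (Set.Ici 0))
    (hV : ∀ r : ℝ, 0 ≤ r → ‖V r‖ ≤ C * japaneseBracket r ^ (-2 : ℤ))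
    (hV' : ∀ r : ℝ, 0 ≤ r → ‖derivWithin V (Set.Ici 0) r‖ ≤ C * japaneseBracket r ^ (-3 : ℤ)) :
    Dense ((ouOperator d V).domain : Set (L2Space d)) ∧
    (ouOperator d V).IsClosable ∧
    ∃ S : ℝ≥0 → L2Space d →L[ℂ] L2Space d,
      IsC0Semigroup S ∧
      IsGenerator (ouOperator d V).closure S ∧
      ∀ t : ℝ≥0, spectrum ℂ (S t) \ {0} =
        (fun z : ℂ => Complex.exp (((t : ℝ) : ℂ) * z)) ''
          unboundedSpectrum (ouOperator d V).closure := by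
  have hw : MemLp (fun x : EuclideanSpace ℝ (Fin d) => V ‖x‖) ⊤ volume :=
    memLp_top_of_decay hC hVdiff.continuousOn hV
  have := nontrivial_L2Space hd
  have hS := isC0Semigroup_ouSemigroup d
  obtain ⟨U, hU, hUS⟩ := hS.exists_perturbation norm_ouSemigroup_le (mulL hw)
  have hgen : IsGenerator (ouOperator d V).closure U := fun f g =>
    (mem_graph_closure_ouOperator_iff hw f g).trans (hS.genPair_iff_of_duhamel hU hUS f g).symm
  exact ⟨dense_ouDomain hw, isClosable_ouOperator hw, U, hU, hgen,
    spectral_mapping_of_duhamel hS norm_ouSemigroup_le hU hUS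
      (fun ε hε => isCompactOperator_ouSemigroup_comp_mulL hw
        (fun δ hδ => exists_norm_le_of_decay hC hV hδ) hε)
      (fun z hz f hf => eq_zero_of_eigenvector_ouSemigroup hz hf)
      (fun z hz => not_surjective_ouSemigroup hd hz) hgen⟩
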